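/- Let $\mathfrak g=\mathfrak g_{\bar 0}\oplus\mathfrak g_{\bar 1}$ be a finite-dimensional solvable Lie superalgebra over $\mathbb C$. Let $L$ be the space of linear functionals $\lambda$ on $\mathfrak g$ with $\lambda(\mathfrak g_{\bar 1})=0$ and $\lambda([\mathfrak g_{\bar 0},\mathfrak g_{\bar 0}])=0$. For $\lambda\in L$ let $f_\lambda(\xi,\eta)=\lambda([\xi,\eta])$, a symmetric bilinear form on $\mathfrak g_{\bar 1}$. A polarization for $\lambda$ is a Lie subsuperalgebra $\mathfrak h\supset\mathfrak g_{\bar 0}$ with $\lambda([\mathfrak h,\mathfrak h])=0$ such that $\mathfrak h_{\bar 1}$ is a maximal isotropic subspace for $f_\lambda$. For a subsuperalgebra $\mathfrak h\supset\mathfrak g_{\bar 0}$ let $\theta_{\mathfrak h}\in L$ be given by $\theta_{\mathfrak h}(x)=\tfrac12\operatorname{str}_{\mathfrak g/\mathfrak h}(\operatorname{ad}x)$ for $x\in\mathfrak g_{\bar 0}$ and $\theta_{\mathfrak h}(x)=0$ for $x\in\mathfrak g_{\bar 1}$; it vanishes on $[\mathfrak h,\mathfrak h]$. If $\mathfrak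 h$ is a polarization for $\lambda$, then $\lambda\pm\theta_{\mathfrak h}$ are characters of $(1,0)$-dimensional representations of $\mathfrak h$, denoted by the same symbols, and one sets $$I^{\mathfrak g}_{\mathfrak h}(\lambda)=U(\mathfrak g)\otimes_{U(\mathfrak h)}(\lambda+\theta_{\mathfrak h}),\qquad CI^{\mathfrak g}_{\mathfrak h}(\lambda)=\operatorname{Hom}_{U(\mathfrak h)}(U(\mathfrak g),\lambda-\theta_{\mathfrak h}).$$ A representation of $\mathfrak g$ in a superspace is called irreducible if it is nonzero and has no invariant subsuperspaces other than $0$ and itself; $\Pi$ denotes the change of parity functor, and $\cong$ denotes isomorphism of representations of $\mathfrak g$ by an even linear map. Let $\lambda\in L$. Then: 1. for every polarization $\mathfrak h$ for $\lambda$, the representation $I^{\mathfrak g}_{\mathfrak h}(\lambda)$ is finite-dimensional and irreducible; 2. up to isomorphism and change of parity, $I^{\mathfrak g}_{\mathfrak h}(\lambda)$ does not depend on the polarization: for any two polarizations $\mathfrak h,\mathfrak t$ for $\lambda$, $I^{\mathfrak g}_{\mathfrak h}(\lambda)\cong I^{\mathfrak g}_{\mathfrak t}(\lambda)$ or $I^{\mathfrak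 g}_{\mathfrak h}(\lambda)\cong\Pi\, I^{\mathfrak g}_{\mathfrak t}(\lambda)$; 3. for any two polarizations $\mathfrak h,\mathfrak t$ for $\lambda$ (in particular for $\mathfrak t=\mathfrak h$), $CI^{\mathfrak g}_{\mathfrak h}(\lambda)\cong I^{\mathfrak g}_{\mathfrak t}(\lambda)$ or $CI^{\mathfrak g}_{\mathfrak h}(\lambda)\cong\Pi\, I^{\mathfrak g}_{\mathfrak t}(\lambda)$. -/

import Mathlib

open scoped TensorProduct

noncomputable section

namespace SolvSuper

/-! # Superspaces -/

/-- The sign `(-1) ^ i` of a parity `i`. -/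
def sgn (i : ZMod 2) : ℂ := if i = 0 then 1 else -1

@[simp] theorem sgn_zero : sgn 0 = 1 := by simp [sgn]

@[simp] theorem sgn_one : sgn 1 = -1 := by simp [sgn]

theorem zmod2_cases (i : ZMod 2) : i = 0 ∨ i = 1 := by
  revert i; decide

theorem zmod2_one_add_one : (1 : ZMod 2) + 1 = 0 := by decide

theorem sgn_add (i j : ZMod 2) : sgn (i + j) = sgn i * sgn j := by
  rcases zmod2_cases i with rfl | rfl <;> rcases zmod2_cases j with rfl | rfl <;>
    simp [zmod2_one_add_one]

theorem sgn_mul_self (i : ZMod 2) : sgn i * sgn i = 1 := by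
  rcases zmod2_cases i with rfl | rfl <;> simp

/-- A superspace: a complex vector space with a decomposition `V = V₀ ⊕ V₁` into an
even part `part 0` and an odd part `part 1`. -/
structure SuperSpace (V : Type*) [AddCommGroup V] [Module ℂ V] where
  part : ZMod 2 → Submodule ℂ V
  isCompl : IsCompl (part 0) (part 1)

namespace SuperSpace

variable {V : Type*} [AddCommGroup V] [Module ℂ V] (S : SuperSpace V)

/-- The projection of a superspace onto its even part along its odd part. -/
def evenProj : V →ₗ[ℂ] V := (S.part 0).projection (S.part 1) S.isCompl

/-- The projection of a superspace onto its odd part along its even part. -/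
def oddProj : V →ₗ[ℂ] V := (S.part 1).projection (S.part 0) S.isCompl.symm

/-- The parity operator: `v ↦ v` on the even part and `v ↦ -v` on the odd part. -/
def parity : V →ₗ[ℂ] V := S.evenProj - S.oddProj

/-- The supertrace `tr (T₀₀) - tr (T₁₁)`, that is the trace of the parity operator composed
with `T`. -/
def str (T : V →ₗ[ℂ] V) : ℂ := LinearMap.trace ℂ V (S.parity ∘ₗ T)

/-- A subspace is graded (a subsuperspace) if it is spanned by its even and odd elements. -/
def IsGraded (N : Submodule ℂ V) : Prop := N ≤ (N ⊓ S.part 0) ⊔ (N ⊓ S.part 1)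

theorem evenProj_mem (v : V) : S.evenProj v ∈ S.part 0 :=
  Submodule.projection_apply_mem _ _

theorem oddProj_mem (v : V) : S.oddProj v ∈ S.part 1 :=
  Submodule.projection_apply_mem _ _

theorem evenProj_add_oddProj (v : V) : S.evenProj v + S.oddProj v = v :=
  Submodule.projection_add_projection_eq_self _ _

theorem evenProj_of_even {v : V} (hv : v ∈ S.part 0) : S.evenProj v = v :=
  Submodule.projection_apply_of_mem_left _ hv

theorem evenProj_of_odd {v : V} (hv : v ∈ S.part 1) : S.evenProj v = 0 :=
  (Submodule.projection_apply_eq_zero_iff _).2 hv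

theorem oddProj_of_odd {v : V} (hv : v ∈ S.part 1) : S.oddProj v = v :=
  Submodule.projection_apply_of_mem_left _ hv

theorem oddProj_of_even {v : V} (hv : v ∈ S.part 0) : S.oddProj v = 0 :=
  (Submodule.projection_apply_eq_zero_iff _).2 hv

theorem parity_of_mem {i : ZMod 2} {v : V} (hv : v ∈ S.part i) : S.parity v = sgn i • v := by
  rcases zmod2_cases i with rfl | rfl
  · simp [parity, S.evenProj_of_even hv, S.oddProj_of_even hv]
  · simp [parity, S.evenProj_of_odd hv, S.oddProj_of_odd hv]

theorem parity_parity (v : V) : S.parity (S.parity v) = v := by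
  conv_rhs => rw [← S.evenProj_add_oddProj v]
  conv_lhs => rw [← S.evenProj_add_oddProj v]
  simp [S.parity_of_mem (S.evenProj_mem v), S.parity_of_mem (S.oddProj_mem v)]

theorem mem_part_iff {i : ZMod 2} {v : V} : v ∈ S.part i ↔ S.parity v = sgn i • v := by
  refine ⟨S.parity_of_mem, fun h => ?_⟩
  have hs := S.evenProj_add_oddProj v
  have hp : S.parity v = S.evenProj v - S.oddProj v := rfl
  rcases zmod2_cases i with rfl | rfl
  · have h2 : (2 : ℂ) • S.oddProj v = 0 := by
      rw [hp, sgn_zero, one_smul] at h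
      have h3 : S.evenProj v - S.oddProj v = S.evenProj v + S.oddProj v := by rw [h, hs]
      rw [two_smul]
      have := congrArg (fun t => S.evenProj v + S.oddProj v - t) h3
      simpa using this
    have h4 : S.oddProj v = 0 := by simpa using h2
    rw [← hs, h4, add_zero]
    exact S.evenProj_mem v
  · have h2 : (2 : ℂ) • S.evenProj v = 0 := by
      rw [hp, sgn_one, neg_one_smul] at h
      have h3 : S.evenProj v - S.oddProj v + (S.evenProj v + S.oddProj v) = 0 := by
        rw [h, hs, neg_add_cancel]
      rw [two_smul]
      simpa using h3
    have h4 : S.evenProj v = 0 := by simpa using h2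
    rw [← hs, h4, zero_add]
    exact S.oddProj_mem v

/-- The superspace whose parity operator is a given linear involution: the even part consists
of the `v` with `σ v = v`, the odd part of the `v` with `σ v = -v`. -/
def ofInvolution (σ : V →ₗ[ℂ] V) (hσ : ∀ v, σ (σ v) = v) : SuperSpace V where
  part i := LinearMap.ker (σ - sgn i • LinearMap.id)
  isCompl := by
    constructor
    · rw [Submodule.disjoint_def]
      intro v h0 h1
      simp only [LinearMap.mem_ker, LinearMap.sub_apply,
        LinearMap.id_apply, sgn_zero, sgn_one, one_smul, neg_one_smul, sub_neg_eq_add] at h0 h1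
      have h2 : (2 : ℂ) • v = 0 := by
        rw [sub_eq_zero] at h0
        rw [LinearMap.add_apply, h0] at h1
        rw [two_smul]; exact h1
      simpa using h2
    · rw [codisjoint_iff, eq_top_iff]
      intro v _
      have hv : v = (2⁻¹ : ℂ) • (v + σ v) + (2⁻¹ : ℂ) • (v - σ v) := by
        rw [← smul_add]
        have : v + σ v + (v - σ v) = (2 : ℂ) • v := by rw [two_smul]; abel
        rw [this, smul_smul]; norm_num
      rw [hv]
      refine Submodule.add_mem_sup (Submodule.smul_mem _ _ ?_) (Submodule.smul_mem _ _ ?_)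
      · simp [hσ, add_comm]
      · simp [hσ]

theorem mem_ofInvolution {σ : V →ₗ[ℂ] V} {hσ : ∀ v, σ (σ v) = v} {i : ZMod 2} {v : V} :
    v ∈ (ofInvolution σ hσ).part i ↔ σ v = sgn i • v := by
  simp [ofInvolution, sub_eq_zero]

theorem linearMap_ext_parts {M : Type*} [AddCommGroup M] [Module ℂ M] {f f' : V →ₗ[ℂ] M}
    (h : ∀ i, ∀ v ∈ S.part i, f v = f' v) : f = f' := by
  ext v
  rw [← S.evenProj_add_oddProj v, map_add, map_add, h 0 _ (S.evenProj_mem v),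
    h 1 _ (S.oddProj_mem v)]

variable {S}

theorem IsGraded.evenProj_mem {N : Submodule ℂ V} (hN : S.IsGraded N) {v : V} (hv : v ∈ N) :
    S.evenProj v ∈ N := by
  obtain ⟨a, ha, b, hb, rfl⟩ := Submodule.mem_sup.1 (hN hv)
  rw [map_add, S.evenProj_of_even ha.2, S.evenProj_of_odd hb.2, add_zero]
  exact ha.1

theorem IsGraded.oddProj_mem {N : Submodule ℂ V} (hN : S.IsGraded N) {v : V} (hv : v ∈ N) :
    S.oddProj v ∈ N := by
  obtain ⟨a, ha, b, hb, rfl⟩ := Submodule.mem_sup.1 (hN hv)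
  rw [map_add, S.oddProj_of_even ha.2, S.oddProj_of_odd hb.2, zero_add]
  exact hb.1

/-- A graded subspace is itself a superspace. -/
def sub (S : SuperSpace V) (N : Submodule ℂ V) (hN : S.IsGraded N) : SuperSpace N where
  part i := (S.part i).comap N.subtype
  isCompl := by
    constructor
    · rw [Submodule.disjoint_def]
      intro v h0 h1
      exact Subtype.ext (Submodule.disjoint_def.1 S.isCompl.disjoint v h0 h1)
    · rw [codisjoint_iff, eq_top_iff]
      intro v _
      refine Submodule.mem_sup.2 ⟨⟨S.evenProj v, hN.evenProj_mem v.2⟩, S.evenProj_mem _,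
        ⟨S.oddProj v, hN.oddProj_mem v.2⟩, S.oddProj_mem _, Subtype.ext ?_⟩
      exact S.evenProj_add_oddProj v

/-- The quotient of a superspace by a graded subspace is a superspace. -/
def quot (S : SuperSpace V) (N : Submodule ℂ V) (hN : S.IsGraded N) : SuperSpace (V ⧸ N) where
  part i := (S.part i).map N.mkQ
  isCompl := by
    constructor
    · rw [Submodule.disjoint_def]
      rintro _ ⟨a, ha, rfl⟩ ⟨b, hb, hab⟩
      have h : b - a ∈ N := (Submodule.Quotient.eq N).1 hab
      have h' := hN.evenProj_mem h
      rw [map_sub, S.evenProj_of_odd hb, S.evenProj_of_even ha, zero_sub] at h'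
      exact (Submodule.Quotient.mk_eq_zero N).2 (by simpa using h')
    · rw [codisjoint_iff, ← Submodule.map_sup, S.isCompl.sup_eq_top, Submodule.map_top,
        Submodule.range_mkQ]

end SuperSpace

/-! # Lie superalgebras -/

/-- A complex Lie superalgebra structure on the vector space `g`: a superspace with an even
bilinear bracket that is super skew-symmetric and satisfies the super Jacobi identity. -/
structure LieSuperalgebra (g : Type*) [AddCommGroup g] [Module ℂ g] extends SuperSpace g where
  bracket : g →ₗ[ℂ] g →ₗ[ℂ] g
  bracket_mem : ∀ i j : ZMod 2, ∀ x ∈ part i, ∀ y ∈ part j, bracket x y ∈ part (i + j)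
  bracket_skew : ∀ i j : ZMod 2, ∀ x ∈ part i, ∀ y ∈ part j,
    bracket x y = -(sgn (i * j) • bracket y x)
  jacobi : ∀ i j : ZMod 2, ∀ x ∈ part i, ∀ y ∈ part j, ∀ z : g,
    bracket x (bracket y z) = bracket (bracket x y) z + sgn (i * j) • bracket y (bracket x z)

/-- A representation (supermodule) of the Lie superalgebra `L` in the vector space `V`. -/
structure LieSupermodule {g : Type*} [AddCommGroup g] [Module ℂ g] (L : LieSuperalgebra g)
    (V : Type*) [AddCommGroup V] [Module ℂ V] extends SuperSpace V where
  act : g →ₗ[ℂ] Module.End ℂ V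
  act_mem : ∀ i j : ZMod 2, ∀ x ∈ L.part i, ∀ v ∈ part j, act x v ∈ part (i + j)
  act_bracket : ∀ i j : ZMod 2, ∀ x ∈ L.part i, ∀ y ∈ L.part j,
    act (L.bracket x y) = act x * act y - sgn (i * j) • (act y * act x)

namespace LieSuperalgebra

variable {g : Type*} [AddCommGroup g] [Module ℂ g] (L : LieSuperalgebra g)

/-- The span of all brackets of elements of two subspaces. -/
def commutator (A B : Submodule ℂ g) : Submodule ℂ g :=
  Submodule.span ℂ {z | ∃ x ∈ A, ∃ y ∈ B, L.bracket x y = z}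

/-- The derived series `D⁰ = g`, `Dⁿ⁺¹ = [Dⁿ, Dⁿ]`. -/
def derivedSeries : ℕ → Submodule ℂ g
  | 0 => ⊤
  | n + 1 => L.commutator (derivedSeries n) (derivedSeries n)

/-- A Lie superalgebra is solvable if its derived series reaches zero. -/
def IsSolvable : Prop := ∃ n, L.derivedSeries n = ⊥

/-- The space `L` of the functionals on `g` that vanish on the odd part and on the commutators
of even elements. -/
def evenCharacters : Submodule ℂ (Module.Dual ℂ g) where
  carrier := {lam | (∀ x ∈ L.part 1, lam x = 0) ∧
    ∀ x ∈ L.part 0, ∀ y ∈ L.part 0, lam (L.bracket x y) = 0}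
  zero_mem' := by simp
  add_mem' := by
    rintro a b ⟨ha, ha'⟩ ⟨hb, hb'⟩
    exact ⟨fun x hx => by simp [ha x hx, hb x hx],
      fun x hx y hy => by simp [ha' x hx y hy, hb' x hx y hy]⟩
  smul_mem' := by
    rintro c a ⟨ha, ha'⟩
    exact ⟨fun x hx => by simp [ha x hx], fun x hx y hy => by simp [ha' x hx y hy]⟩

/-- A subsuperalgebra: a graded subspace closed under the bracket. -/
structure Sub where
  carrier : Submodule ℂ g
  graded : L.IsGraded carrier
  bracket_mem' : ∀ x ∈ carrier, ∀ y ∈ carrier, L.bracket x y ∈ carrier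

/-- A subsuperalgebra as a Lie superalgebra in its own right. -/
def Sub.toLie {L : LieSuperalgebra g} (h : L.Sub) : LieSuperalgebra h.carrier where
  toSuperSpace := L.sub h.carrier h.graded
  bracket := LinearMap.mk₂ ℂ
    (fun x y => (⟨L.bracket x y, h.bracket_mem' x x.2 y y.2⟩ : h.carrier))
    (fun _ _ _ => Subtype.ext (by simp)) (fun _ _ _ => Subtype.ext (by simp))
    (fun _ _ _ => Subtype.ext (by simp)) (fun _ _ _ => Subtype.ext (by simp))
  bracket_mem := fun i j x hx y hy => L.bracket_mem i j x hx y hy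
  bracket_skew := fun i j x hx y hy => Subtype.ext (L.bracket_skew i j x hx y hy)
  jacobi := fun i j x hx y hy z => Subtype.ext (L.jacobi i j x hx y hy z)

/-! ## The universal enveloping algebra -/

/-- The defining relations `x y - (-1) ^ (p(x) p(y)) y x = [x, y]` of the enveloping algebra. -/
inductive EnvRel : TensorAlgebra ℂ g → TensorAlgebra ℂ g → Prop
  | mk (i j : ZMod 2) (x y : g) (hx : x ∈ L.part i) (hy : y ∈ L.part j) :
      EnvRel (TensorAlgebra.ι ℂ x * TensorAlgebra.ι ℂ y -
          sgn (i * j) • (TensorAlgebra.ι ℂ y * TensorAlgebra.ι ℂ x))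
        (TensorAlgebra.ι ℂ (L.bracket x y))

/-- The universal enveloping algebra `U(g)` of a Lie superalgebra. -/
def Env : Type _ := RingQuot L.EnvRel

instance : Ring L.Env := inferInstanceAs (Ring (RingQuot L.EnvRel))

instance : Algebra ℂ L.Env := inferInstanceAs (Algebra ℂ (RingQuot L.EnvRel))

/-- The quotient map from the tensor algebra to `U(g)`. -/
def mkEnv : TensorAlgebra ℂ g →ₐ[ℂ] L.Env := RingQuot.mkAlgHom ℂ L.EnvRel

/-- The canonical map `g → U(g)`. -/
def ι : g →ₗ[ℂ] L.Env := L.mkEnv.toLinearMap ∘ₗ TensorAlgebra.ι ℂ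

theorem ι_bracket {i j : ZMod 2} {x y : g} (hx : x ∈ L.part i) (hy : y ∈ L.part j) :
    L.ι (L.bracket x y) = L.ι x * L.ι y - sgn (i * j) • (L.ι y * L.ι x) := by
  have h : L.mkEnv _ = L.mkEnv _ :=
    RingQuot.mkAlgHom_rel ℂ (EnvRel.mk (L := L) i j x y hx hy)
  simp only [map_sub, map_mul, map_smul] at h
  exact h.symm

/-- The universal property of `U(g)`: a linear map to an associative algebra that satisfies the
defining relations extends to `U(g)`. -/
def lift {A : Type*} [Ring A] [Algebra ℂ A] (f : g →ₗ[ℂ] A)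
    (hf : ∀ i j : ZMod 2, ∀ x ∈ L.part i, ∀ y ∈ L.part j,
      f (L.bracket x y) = f x * f y - sgn (i * j) • (f y * f x)) : L.Env →ₐ[ℂ] A :=
  RingQuot.liftAlgHom ℂ ⟨TensorAlgebra.lift ℂ f, by
    rintro _ _ ⟨i, j, x, y, hx, hy⟩
    simp [hf i j x hx y hy]⟩

@[simp] theorem lift_ι {A : Type*} [Ring A] [Algebra ℂ A] (f : g →ₗ[ℂ] A)
    (hf : ∀ i j : ZMod 2, ∀ x ∈ L.part i, ∀ y ∈ L.part j,
      f (L.bracket x y) = f x * f y - sgn (i * j) • (f y * f x)) (x : g) :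
    L.lift f hf (L.ι x) = f x := by
  have h := RingQuot.liftAlgHom_mkAlgHom_apply ℂ (s := L.EnvRel) (TensorAlgebra.lift ℂ f)
    (by rintro _ _ ⟨i, j, x, y, hx, hy⟩; simp [hf i j x hx y hy]) (TensorAlgebra.ι ℂ x)
  rw [TensorAlgebra.lift_ι_apply] at h
  exact h

theorem env_induction {P : L.Env → Prop} (hc : ∀ c : ℂ, P (algebraMap ℂ _ c))
    (hι : ∀ x, P (L.ι x)) (hm : ∀ a b, P a → P b → P (a * b))
    (ha : ∀ a b, P a → P b → P (a + b)) (u : L.Env) : P u := by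
  obtain ⟨t, rfl⟩ : ∃ t, L.mkEnv t = u := RingQuot.mkAlgHom_surjective ℂ L.EnvRel u
  induction t using TensorAlgebra.induction with
  | algebraMap r => rw [AlgHom.commutes]; exact hc r
  | ι x => exact hι x
  | mul a b iha ihb => rw [map_mul]; exact hm _ _ iha ihb
  | add a b iha ihb => rw [map_add]; exact ha _ _ iha ihb

/-- The parity operator of `U(g)`: the algebra automorphism that extends the parity operator
of `g`. It is `1` on the products with an even number of odd factors, `-1` on the others. -/
def envParity : L.Env →ₐ[ℂ] L.Env :=
  L.lift (L.ι ∘ₗ L.parity) (by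
    intro i j x hx y hy
    simp only [LinearMap.comp_apply, L.parity_of_mem hx, L.parity_of_mem hy,
      L.parity_of_mem (L.bracket_mem i j x hx y hy), map_smul, L.ι_bracket hx hy, sgn_add,
      smul_mul_smul_comm, smul_sub]
    rw [smul_comm, mul_comm (sgn j)])

@[simp] theorem envParity_ι (x : g) : L.envParity (L.ι x) = L.ι (L.parity x) := by
  simp [envParity]

theorem envParity_envParity (u : L.Env) : L.envParity (L.envParity u) = u := by
  induction u using L.env_induction with
  | hc c => simp
  | hι x => simp [L.parity_parity]
  | hm a b ha hb => simp [ha, hb]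
  | ha a b ha hb => simp [ha, hb]

/-- The canonical homomorphism `U(h) → U(g)` for a subsuperalgebra `h` of `g`. -/
def Sub.envMap {L : LieSuperalgebra g} (h : L.Sub) : h.toLie.Env →ₐ[ℂ] L.Env :=
  h.toLie.lift (L.ι ∘ₗ h.carrier.subtype) (fun _ _ _ hx _ hy => L.ι_bracket hx hy)

theorem Sub.envMap_ι {L : LieSuperalgebra g} (h : L.Sub) (x : h.carrier) :
    h.envMap (h.toLie.ι x) = L.ι (x : g) :=
  h.toLie.lift_ι _ _ x

theorem Sub.parity_coe {L : LieSuperalgebra g} (h : L.Sub) (x : h.carrier) :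
    ((h.toLie.parity x : h.carrier) : g) = L.parity x := by
  have : h.carrier.subtype ∘ₗ h.toLie.parity = L.parity ∘ₗ h.carrier.subtype := by
    refine h.toLie.linearMap_ext_parts fun i v hv => ?_
    have hv' : (v : g) ∈ L.part i := hv
    simp [h.toLie.parity_of_mem hv, L.parity_of_mem hv']
  exact LinearMap.congr_fun this x

theorem Sub.envMap_parity {L : LieSuperalgebra g} (h : L.Sub) (a : h.toLie.Env) :
    L.envParity (h.envMap a) = h.envMap (h.toLie.envParity a) := by
  induction a using h.toLie.env_induction with
  | hc c => simp
  | hι x =>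
    rw [Sub.envMap_ι, envParity_ι, envParity_ι, Sub.envMap_ι, Sub.parity_coe]
  | hm a b ha hb => simp [ha, hb]
  | ha a b ha hb => simp [ha, hb]

end LieSuperalgebra

/-! # Representations -/

namespace LieSupermodule

variable {g : Type*} [AddCommGroup g] [Module ℂ g] {L : LieSuperalgebra g}
variable {V : Type*} [AddCommGroup V] [Module ℂ V]
variable {W : Type*} [AddCommGroup W] [Module ℂ W]

/-- The action of `U(g)` in a representation of `g`. -/
def envAct (M : LieSupermodule L V) : L.Env →ₐ[ℂ] Module.End ℂ V := L.lift M.act M.act_bracket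

/-- Irreducibility of a representation of a Lie superalgebra: it is nonzero and has no
invariant subsuperspaces besides `0` and the whole space. -/
def IsIrreducible (M : LieSupermodule L V) : Prop :=
  Nontrivial V ∧ ∀ N : Submodule ℂ V, M.IsGraded N → (∀ x, ∀ v ∈ N, M.act x v ∈ N) →
    N = ⊥ ∨ N = ⊤

/-- Isomorphism of representations by an even map. -/
def Iso (M : LieSupermodule L V) (M' : LieSupermodule L W) : Prop :=
  ∃ e : V ≃ₗ[ℂ] W, (∀ i, ∀ v ∈ M.part i, e v ∈ M'.part i) ∧
    ∀ x v, e (M.act x v) = M'.act x (e v)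

theorem parity_act (M : LieSupermodule L V) (x : g) (v : V) :
    M.parity (M.act x v) = M.act (L.parity x) (M.parity v) := by
  have hxy : ∀ i, ∀ a ∈ L.part i, ∀ j, ∀ w ∈ M.part j,
      M.parity (M.act a w) = M.act (L.parity a) (M.parity w) := by
    intro i a ha j w hw
    rw [M.parity_of_mem (M.act_mem i j a ha w hw), L.parity_of_mem ha, M.parity_of_mem hw,
      map_smul, map_smul, LinearMap.smul_apply, smul_smul, sgn_add, mul_comm]
  have hv : ∀ i, ∀ a ∈ L.part i, M.parity (M.act a v) = M.act (L.parity a) (M.parity v) := by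
    intro i a ha
    exact LinearMap.congr_fun (M.linearMap_ext_parts (f := M.parity ∘ₗ M.act a)
      (f' := M.act (L.parity a) ∘ₗ M.parity) (hxy i a ha)) v
  have h0 := hv 0 _ (L.evenProj_mem x)
  have h1 := hv 1 _ (L.oddProj_mem x)
  rw [← L.evenProj_add_oddProj x]
  simp only [map_add, LinearMap.add_apply, h0, h1]

theorem parity_envAct (M : LieSupermodule L V) (a : L.Env) (v : V) :
    M.parity (M.envAct a v) = M.envAct (L.envParity a) (M.parity v) := by
  induction a using L.env_induction generalizing v with
  | hc c => simp [Algebra.algebraMap_eq_smul_one]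
  | hι x => simp [envAct, M.parity_act]
  | hm a b ha hb => simp [ha, hb]
  | ha a b ha hb => simp [ha, hb]

/-- The change of parity functor `Π`: the even and odd parts are interchanged, and a
homogeneous `x` acts by `(-1) ^ p(x)` times its action in `M`. -/
def parityShift (M : LieSupermodule L V) : LieSupermodule L V where
  part i := M.part (i + 1)
  isCompl := by simpa [zmod2_one_add_one] using M.isCompl.symm
  act := M.act ∘ₗ L.parity
  act_mem := by
    intro i j x hx v hv
    rw [LinearMap.comp_apply, L.parity_of_mem hx, map_smul, LinearMap.smul_apply, add_assoc]
    exact Submodule.smul_mem _ _ (M.act_mem i (j + 1) x hx v hv)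
  act_bracket := by
    intro i j x hx y hy
    simp only [LinearMap.comp_apply, L.parity_of_mem hx, L.parity_of_mem hy,
      L.parity_of_mem (L.bracket_mem i j x hx y hy), map_smul, M.act_bracket i j x hx y hy,
      sgn_add, smul_mul_smul_comm, smul_sub]
    rw [smul_comm, mul_comm (sgn j)]

/-- Isomorphism up to the change of parity functor. -/
def IsoUpToParity (M : LieSupermodule L V) (M' : LieSupermodule L W) : Prop :=
  M.Iso M' ∨ M.Iso M'.parityShift

/-- The `(1, 0)`-dimensional representation of a Lie superalgebra determined by a character. -/
def ofCharacter (L : LieSuperalgebra g) (χ : Module.Dual ℂ g) (hodd : ∀ x ∈ L.part 1, χ x = 0)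
    (hbr : ∀ x y, χ (L.bracket x y) = 0) : LieSupermodule L ℂ where
  part i := if i = 0 then ⊤ else ⊥
  isCompl := by simpa using isCompl_top_bot
  act := (Algebra.lmul ℂ ℂ).toLinearMap ∘ₗ χ
  act_mem := by
    intro i j x hx v hv
    rcases zmod2_cases i with rfl | rfl
    · rcases zmod2_cases j with rfl | rfl
      · simp
      · have : v = 0 := by simpa using hv
        simp [this]
    · simp [hodd x hx]
  act_bracket := by
    intro i j x hx y hy
    rcases zmod2_cases i with rfl | rfl
    · ext; simp [hbr, mul_comm]
    · simp [hbr, hodd x hx]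

/-! ## Induced representations -/

section Induction

variable (h : L.Sub) (M : LieSupermodule h.toLie W)

/-- The relations `u a ⊗ w = u ⊗ a w`, for `a ∈ U(h)`, in `U(g) ⊗ W`. -/
def balanced : Submodule ℂ (L.Env ⊗[ℂ] W) :=
  Submodule.span ℂ {t | ∃ (u : L.Env) (a : h.toLie.Env) (w : W),
    t = (u * h.envMap a) ⊗ₜ[ℂ] w - u ⊗ₜ[ℂ] (M.envAct a w)}

/-- The space `U(g) ⊗_{U(h)} W`. -/
abbrev IndSpace : Type _ := (L.Env ⊗[ℂ] W) ⧸ balanced h M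

/-- Left multiplication by elements of `U(g)` on `U(g) ⊗_{U(h)} W`. -/
def indMul (b : L.Env) : IndSpace h M →ₗ[ℂ] IndSpace h M :=
  (balanced h M).mapQ (balanced h M) (LinearMap.rTensor W (LinearMap.mulLeft ℂ b)) (by
    rw [balanced, Submodule.span_le]
    rintro _ ⟨u, a, w, rfl⟩
    refine Submodule.subset_span ⟨b * u, a, w, ?_⟩
    simp [mul_assoc])

/-- The parity operator of `U(g) ⊗_{U(h)} W`, with `p(u ⊗ w) = p(u) + p(w)`. -/
def indParity : IndSpace h M →ₗ[ℂ] IndSpace h M :=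
  (balanced h M).mapQ (balanced h M)
    (TensorProduct.map L.envParity.toLinearMap M.parity) (by
    rw [balanced, Submodule.span_le]
    rintro _ ⟨u, a, w, rfl⟩
    refine Submodule.subset_span ⟨L.envParity u, h.toLie.envParity a, M.parity w, ?_⟩
    simp [h.envMap_parity, M.parity_envAct])

@[simp] theorem indMul_mk (b u : L.Env) (w : W) :
    indMul h M b ((balanced h M).mkQ (u ⊗ₜ w)) = (balanced h M).mkQ ((b * u) ⊗ₜ w) := by
  simp [indMul]

@[simp] theorem indParity_mk (u : L.Env) (w : W) :
    indParity h M ((balanced h M).mkQ (u ⊗ₜ w)) =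
      (balanced h M).mkQ (L.envParity u ⊗ₜ M.parity w) := by
  simp [indParity]

variable {h M}

theorem ind_ext {X : Type*} [AddCommGroup X] [Module ℂ X] {f f' : IndSpace h M →ₗ[ℂ] X}
    (H : ∀ u w, f ((balanced h M).mkQ (u ⊗ₜ w)) = f' ((balanced h M).mkQ (u ⊗ₜ w))) : f = f' :=
  Submodule.linearMap_qext _ (TensorProduct.ext' H)

variable (h M)

theorem indParity_indParity (v : IndSpace h M) : indParity h M (indParity h M v) = v := by
  have : indParity h M ∘ₗ indParity h M = LinearMap.id :=
    ind_ext fun u w => by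
      simp only [LinearMap.comp_apply, indParity_mk, L.envParity_envParity, M.parity_parity,
        LinearMap.id_apply]
  exact LinearMap.congr_fun this v

theorem indParity_indMul (b : L.Env) (v : IndSpace h M) :
    indParity h M (indMul h M b v) = indMul h M (L.envParity b) (indParity h M v) := by
  have : indParity h M ∘ₗ indMul h M b = indMul h M (L.envParity b) ∘ₗ indParity h M :=
    ind_ext fun u w => by
      simp only [LinearMap.comp_apply, indParity_mk, indMul_mk, map_mul]
  exact LinearMap.congr_fun this v

/-- The algebra homomorphism `U(g) → End (U(g) ⊗_{U(h)} W)` given by left multiplication. -/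
def indMulHom : L.Env →ₐ[ℂ] Module.End ℂ (IndSpace h M) :=
  AlgHom.ofLinearMap
    { toFun := indMul h M
      map_add' := fun a b => ind_ext fun u w => by
        simp only [LinearMap.add_apply, indMul_mk, add_mul, TensorProduct.add_tmul, map_add]
      map_smul' := fun c a => ind_ext fun u w => by
        simp only [LinearMap.smul_apply, indMul_mk, smul_mul_assoc, RingHom.id_apply,
          ← TensorProduct.smul_tmul', map_smul] }
    (ind_ext fun u w => by
      change indMul h M 1 _ = _
      rw [indMul_mk, one_mul]; rfl)
    (fun a b => ind_ext fun u w => by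
      change indMul h M (a * b) ((balanced h M).mkQ (u ⊗ₜ w)) =
        indMul h M a (indMul h M b ((balanced h M).mkQ (u ⊗ₜ w)))
      rw [indMul_mk, indMul_mk, indMul_mk, mul_assoc])

/-- The induced representation `Ind_h^g W = U(g) ⊗_{U(h)} W`. -/
def ind : LieSupermodule L (IndSpace h M) where
  toSuperSpace := SuperSpace.ofInvolution (indParity h M) (indParity_indParity h M)
  act := (indMulHom h M).toLinearMap ∘ₗ L.ι
  act_mem := by
    intro i j x hx v hv
    rw [SuperSpace.mem_ofInvolution] at hv ⊢
    change indParity h M (indMul h M (L.ι x) v) = sgn (i + j) • (indMulHom h M) (L.ι x) v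
    rw [indParity_indMul, hv, L.envParity_ι, L.parity_of_mem hx, map_smul, sgn_add]
    change sgn j • (indMulHom h M (L.ι (sgn i • x))) v = _
    rw [map_smul, map_smul, LinearMap.smul_apply, smul_smul, mul_comm]
  act_bracket := by
    intro i j x hx y hy
    simp only [LinearMap.comp_apply, L.ι_bracket hx hy, AlgHom.toLinearMap_apply, map_sub,
      map_smul, map_mul]

/-! ## Coinduced representations -/

/-- The space `Hom_{U(h)}(U(g), W)` of the `U(h)`-linear maps. -/
def coindSpace : Submodule ℂ (L.Env →ₗ[ℂ] W) where
  carrier := {f | ∀ (a : h.toLie.Env) (u : L.Env), f (h.envMap a * u) = M.envAct a (f u)}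
  zero_mem' := by simp
  add_mem' := fun hf hf' a u => by simp [hf a u, hf' a u]
  smul_mem' := fun c f hf a u => by simp [hf a u]

/-- The action `(b f)(u) = f (u b)` of `U(g)` on `Hom_{U(h)}(U(g), W)`. -/
def coindMulHom : L.Env →ₐ[ℂ] Module.End ℂ (coindSpace h M) :=
  AlgHom.ofLinearMap
    { toFun := fun b =>
        { toFun := fun f => ⟨f.1 ∘ₗ LinearMap.mulRight ℂ b, fun a u => by
            simp only [LinearMap.comp_apply, LinearMap.mulRight_apply, mul_assoc, f.2 a (u * b)]⟩
          map_add' := fun _ _ => rfl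
          map_smul' := fun _ _ => rfl }
      map_add' := fun a b => by
        ext f u
        simp [mul_add]
      map_smul' := fun c a => by
        ext f u
        simp }
    (by ext f u; simp)
    (fun a b => by ext f u; simp [mul_assoc])

/-- The parity operator of `Hom_{U(h)}(U(g), W)`: the even maps are those that preserve the
parity, the odd ones those that change it. -/
def coindParity : coindSpace h M →ₗ[ℂ] coindSpace h M where
  toFun f := ⟨M.parity ∘ₗ f.1 ∘ₗ L.envParity.toLinearMap, fun a u => by
    simp only [LinearMap.comp_apply, AlgHom.toLinearMap_apply, map_mul, h.envMap_parity]
    rw [f.2, M.parity_envAct, h.toLie.envParity_envParity]⟩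
  map_add' f f' := by ext u; simp
  map_smul' c f := by ext u; simp

theorem coindParity_coindParity (f : coindSpace h M) :
    coindParity h M (coindParity h M f) = f := by
  ext u
  simp [coindParity, M.parity_parity, L.envParity_envParity]

theorem coindParity_coindMulHom (b : L.Env) (f : coindSpace h M) :
    coindParity h M (coindMulHom h M b f) =
      coindMulHom h M (L.envParity b) (coindParity h M f) := by
  ext u
  simp [coindParity, coindMulHom, L.envParity_envParity]

/-- The coinduced representation `Coind_h^g W = Hom_{U(h)}(U(g), W)`. -/
def coind : LieSupermodule L (coindSpace h M) where
  toSuperSpace := SuperSpace.ofInvolution (coindParity h M) (coindParity_coindParity h M)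
  act := (coindMulHom h M).toLinearMap ∘ₗ L.ι
  act_mem := by
    intro i j x hx f hf
    rw [SuperSpace.mem_ofInvolution] at hf ⊢
    simp only [LinearMap.comp_apply, AlgHom.toLinearMap_apply]
    rw [coindParity_coindMulHom, hf, L.envParity_ι, L.parity_of_mem hx, map_smul, sgn_add,
      map_smul, map_smul, LinearMap.smul_apply, smul_smul, mul_comm]
  act_bracket := by
    intro i j x hx y hy
    simp only [LinearMap.comp_apply, L.ι_bracket hx hy, AlgHom.toLinearMap_apply, map_sub,
      map_smul, map_mul]

end Induction

end LieSupermodule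

/-! # Polarizations and twisted representations -/

namespace LieSuperalgebra

variable {g : Type*} [AddCommGroup g] [Module ℂ g] {L : LieSuperalgebra g}

/-- The adjoint action of a subsuperalgebra `h` in `g / h`. -/
def Sub.adQuot (h : L.Sub) : h.carrier →ₗ[ℂ] Module.End ℂ (g ⧸ h.carrier) where
  toFun x := h.carrier.mapQ h.carrier (L.bracket x) (fun y hy => h.bracket_mem' x x.2 y hy)
  map_add' x y := by
    apply Submodule.linearMap_qext; ext z; simp
  map_smul' c x := by
    apply Submodule.linearMap_qext; ext z; simp

/-- The functional `θ_h` on `g`, for a subsuperalgebra `h` that contains the even part of `g`: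
`θ_h(x)` is half the supertrace of `ad x` in `g / h` for even `x`, and `0` for odd `x`. -/
def Sub.theta (h : L.Sub) (hev : L.part 0 ≤ h.carrier) : Module.Dual ℂ g where
  toFun x := (1 / 2 : ℂ) * (L.quot h.carrier h.graded).str
    (h.adQuot ⟨L.evenProj x, hev (L.evenProj_mem x)⟩)
  map_add' x y := by
    rw [← mul_add]
    have : (⟨L.evenProj (x + y), hev (L.evenProj_mem (x + y))⟩ : h.carrier) =
        ⟨L.evenProj x, hev (L.evenProj_mem x)⟩ + ⟨L.evenProj y, hev (L.evenProj_mem y)⟩ :=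
      Subtype.ext (map_add _ _ _)
    rw [this, map_add, SuperSpace.str, LinearMap.comp_add, map_add]; rfl
  map_smul' c x := by
    have : (⟨L.evenProj (c • x), hev (L.evenProj_mem (c • x))⟩ : h.carrier) =
        c • ⟨L.evenProj x, hev (L.evenProj_mem x)⟩ :=
      Subtype.ext (map_smul _ _ _)
    rw [this, map_smul, SuperSpace.str, LinearMap.comp_smul, map_smul, smul_eq_mul,
      smul_eq_mul, RingHom.id_apply, SuperSpace.str]; ring

theorem Sub.theta_odd (h : L.Sub) (hev : L.part 0 ≤ h.carrier) {x : g} (hx : x ∈ L.part 1) :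
    h.theta hev x = 0 := by
  change (1 / 2 : ℂ) * (L.quot h.carrier h.graded).str
    (h.adQuot ⟨L.evenProj x, hev (L.evenProj_mem x)⟩) = 0
  have : (⟨L.evenProj x, hev (L.evenProj_mem x)⟩ : h.carrier) = 0 :=
    Subtype.ext (L.evenProj_of_odd hx)
  rw [this, map_zero, SuperSpace.str, LinearMap.comp_zero, map_zero, mul_zero]

theorem Sub.theta_even (h : L.Sub) (hev : L.part 0 ≤ h.carrier) {x : g} (hx : x ∈ L.part 0) :
    h.theta hev x = (1 / 2 : ℂ) * (L.quot h.carrier h.graded).str (h.adQuot ⟨x, hev hx⟩) := by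
  change (1 / 2 : ℂ) * (L.quot h.carrier h.graded).str
    (h.adQuot ⟨L.evenProj x, hev (L.evenProj_mem x)⟩) = _
  simp only [L.evenProj_of_even hx]

theorem Sub.parity_quot (h : L.Sub) (hev : L.part 0 ≤ h.carrier) (q : g ⧸ h.carrier) :
    (L.quot h.carrier h.graded).parity q = -q := by
  obtain ⟨v, rfl⟩ := h.carrier.mkQ_surjective q
  have hv : h.carrier.mkQ v = h.carrier.mkQ (L.oddProj v) := by
    conv_lhs => rw [← L.evenProj_add_oddProj v]
    rw [map_add]
    have : h.carrier.mkQ (L.evenProj v) = 0 :=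
      (Submodule.Quotient.mk_eq_zero _).2 (hev (L.evenProj_mem v))
    rw [this, zero_add]
  have hm : h.carrier.mkQ (L.oddProj v) ∈ (L.quot h.carrier h.graded).part 1 :=
    Submodule.mem_map_of_mem (L.oddProj_mem v)
  rw [hv, SuperSpace.parity_of_mem _ hm, sgn_one, neg_one_smul]

theorem Sub.str_quot (h : L.Sub) (hev : L.part 0 ≤ h.carrier) (T : Module.End ℂ (g ⧸ h.carrier)) :
    (L.quot h.carrier h.graded).str T = -LinearMap.trace ℂ _ T := by
  rw [SuperSpace.str, ← map_neg]
  congr 1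
  ext q
  simp [h.parity_quot hev]

/-- The functional `θ_h` vanishes on `[h, h]`. -/
theorem Sub.theta_bracket (h : L.Sub) (hev : L.part 0 ≤ h.carrier) {x y : g}
    (hx : x ∈ h.carrier) (hy : y ∈ h.carrier) : h.theta hev (L.bracket x y) = 0 := by
  have h00 : ∀ a ∈ L.part 0, ∀ b ∈ L.part 0, h.theta hev (L.bracket a b) = 0 := by
    intro a ha b hb
    have hab : L.bracket a b ∈ L.part 0 := by simpa using L.bracket_mem 0 0 a ha b hb
    rw [h.theta_even hev hab, h.str_quot hev]
    have : h.adQuot ⟨L.bracket a b, hev hab⟩ =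
        h.adQuot ⟨a, hev ha⟩ * h.adQuot ⟨b, hev hb⟩ -
          h.adQuot ⟨b, hev hb⟩ * h.adQuot ⟨a, hev ha⟩ := by
      apply Submodule.linearMap_qext
      ext z
      have := L.jacobi 0 0 a ha b hb z
      simp only [mul_zero, sgn_zero, one_smul] at this
      simp [Sub.adQuot, this]
    rw [this, map_sub, LinearMap.trace_mul_comm, sub_self]; simp
  have h11 : ∀ a ∈ L.part 1, a ∈ h.carrier → ∀ b ∈ L.part 1, b ∈ h.carrier →
      h.theta hev (L.bracket a b) = 0 := by
    intro a ha ha' b hb hb'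
    have hab : L.bracket a b ∈ L.part 0 := by
      simpa [zmod2_one_add_one] using L.bracket_mem 1 1 a ha b hb
    rw [h.theta_even hev hab]
    have : h.adQuot ⟨L.bracket a b, hev hab⟩ = 0 := by
      apply Submodule.linearMap_qext
      ext z
      suffices hz : L.bracket (L.bracket a b) z ∈ h.carrier by
        simpa [Sub.adQuot] using hz
      rw [← L.evenProj_add_oddProj z, map_add]
      refine add_mem (h.bracket_mem' _ (hev hab) _ (hev (L.evenProj_mem z))) ?_
      have hz := L.oddProj_mem z
      have hj := L.jacobi 1 1 a ha b hb (L.oddProj z)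
      rw [← sub_eq_iff_eq_add] at hj
      rw [← hj]
      have hodd : ∀ c ∈ L.part 1, L.bracket c (L.oddProj z) ∈ h.carrier := fun c hc =>
        hev (by simpa [zmod2_one_add_one] using L.bracket_mem 1 1 c hc _ hz)
      exact sub_mem (h.bracket_mem' _ ha' _ (hodd b hb))
        (Submodule.smul_mem _ _ (h.bracket_mem' _ hb' _ (hodd a ha)))
    rw [this, SuperSpace.str, LinearMap.comp_zero, map_zero, mul_zero]
  have h01 : ∀ a ∈ L.part 0, ∀ b ∈ L.part 1, h.theta hev (L.bracket a b) = 0 :=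
    fun a ha b hb => h.theta_odd hev (by simpa using L.bracket_mem 0 1 a ha b hb)
  have h10 : ∀ a ∈ L.part 1, ∀ b ∈ L.part 0, h.theta hev (L.bracket a b) = 0 :=
    fun a ha b hb => h.theta_odd hev (by simpa using L.bracket_mem 1 0 a ha b hb)
  rw [← L.evenProj_add_oddProj x, ← L.evenProj_add_oddProj y]
  simp only [map_add, LinearMap.add_apply]
  rw [h00 _ (L.evenProj_mem x) _ (L.evenProj_mem y), h01 _ (L.evenProj_mem x) _ (L.oddProj_mem y),
    h10 _ (L.oddProj_mem x) _ (L.evenProj_mem y),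
    h11 _ (L.oddProj_mem x) (h.graded.oddProj_mem hx) _ (L.oddProj_mem y)
      (h.graded.oddProj_mem hy)]
  simp

/-- A subspace `P` of the odd part of `g` is isotropic for the symmetric form
`f_λ(ξ, η) = λ([ξ, η])` on the odd part. -/
def IsIsotropic (L : LieSuperalgebra g) (lam : Module.Dual ℂ g) (P : Submodule ℂ g) : Prop :=
  P ≤ L.part 1 ∧ ∀ x ∈ P, ∀ y ∈ P, lam (L.bracket x y) = 0

/-- A polarization for `λ`: a subsuperalgebra `h` that contains the even part of `g`, with
`λ([h, h]) = 0`, whose odd part is a maximal isotropic subspace for `f_λ`. -/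
structure Polarization (lam : L.evenCharacters) extends L.Sub where
  even_le : L.part 0 ≤ carrier
  vanish : ∀ x ∈ carrier, ∀ y ∈ carrier, (lam : Module.Dual ℂ g) (L.bracket x y) = 0
  maximal : Maximal (L.IsIsotropic lam) (carrier ⊓ L.part 1)

namespace Polarization

variable {lam : L.evenCharacters} (h : L.Polarization lam)

/-- The `(1, 0)`-dimensional representation of `h` given by the character `λ + c θ_h`. -/
def character (c : ℂ) : LieSupermodule h.toSub.toLie ℂ :=
  LieSupermodule.ofCharacter h.toSub.toLie
    (((lam : Module.Dual ℂ g) + c • h.toSub.theta h.even_le) ∘ₗ h.carrier.subtype)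
    (fun x hx => by
      have hx' : (x : g) ∈ L.part 1 := hx
      simp [lam.2.1 x hx', h.toSub.theta_odd h.even_le hx'])
    (fun x y => by
      have h1 := h.vanish x x.2 y y.2
      have h2 := h.toSub.theta_bracket h.even_le x.2 y.2
      change (lam : Module.Dual ℂ g) (L.bracket x y) +
        c • h.toSub.theta h.even_le (L.bracket x y) = 0
      rw [h1, h2]; simp)

/-- The twisted induced representation `I(λ) = U(g) ⊗_{U(h)} (λ + θ_h)`. -/
def twistedInd : LieSupermodule L (LieSupermodule.IndSpace h.toSub (h.character 1)) :=
  LieSupermodule.ind h.toSub (h.character 1)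

/-- The twisted coinduced representation `CI(λ) = Hom_{U(h)}(U(g), λ - θ_h)`. -/
def twistedCoind : LieSupermodule L (LieSupermodule.coindSpace h.toSub (h.character (-1))) :=
  LieSupermodule.coind h.toSub (h.character (-1))

end Polarization

end LieSuperalgebra

end SolvSuper

end

noncomputable section

namespace SolvSuper

namespace LieSuperalgebra

variable {g : Type*} [AddCommGroup g] [Module ℂ g] (L : LieSuperalgebra g)

/-! # Elementary bracket identities -/

/-! The representations `I` and `CI` are compared with one model `V` that is built without choosing
a polarization. For an odd subspace `C` stable under the even part `g₀`, the sum `g₀ ⊕ C` is a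
subsuperalgebra. A good representation of it (`RelRep.IsGood`) is irreducible; for every
polarization `P` inside `C` it contains a homogeneous vector of weight `λ + θ_P` killed by `P`, it
carries a homogeneous functional of weight `λ - θ_P` that vanishes on `P V`, and `dim V = 2 ^ (dim C
- dim P)`. For `C = g₁`, Frobenius reciprocity turns the vector into a map `I → V`, onto by
irreducibility, and the functional into an injective map `V → CI`. Adjoining odd directions one at a
time bounds `dim I` and `dim CI` by the same power of two, so both maps are bijective. They are even
or odd, whence the ambiguity by `Π`.

The model is found by induction on `dim C` (`exists_isGood`). If the form vanishes on `C`, then `λ`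
itself is a character. Otherwise `exists_isotropic_weight` leaves two cases. Either the radical is a
hyperplane and the model is `1|1`-dimensional, or there is an isotropic weight vector `ξ` outside
the radical with `[C, ξ]` in `M`, the largest invariant subspace orthogonal to `C`. In the second
case `B = C ∩ ξ^⊥` is a stable hyperplane, and inducing a good `S` from `B`, with a half-supertrace
twist, gives `S ⊕ ζ S`. Here `ξ` kills `S` and `[ξ, ζ]` acts by `λ([ξ, ζ]) = 1`, so `ξ` is an
annihilation operator and irreducibility is inherited. Polarizations through `ξ` lie in `B`. Any
other `P` is exchanged for `P ∩ ξ^⊥ + ℂ ξ`; this shifts `θ_P` by the weight of `ξ`, and the shift is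
undone by applying an element of `P` dual to `ξ`.

Solvability enters in finding `ξ`. Take a minimal invariant `I` not orthogonal to `C`. Lie's theorem
for `g₀` supplies weights, and `IsInvariant.le_orth_of_eigenvalue` excludes that a commutator of two
odd elements has a single nonzero eigenvalue on `I` modulo `M`. Going up the derived series from
zero, first the derived algebra and then all of `C` is seen to map `I` into `M`; an odd weight
vector of `I` outside `M` is the one sought. -/

theorem bracket_even_even {x y : g} (hx : x ∈ L.part 0) (hy : y ∈ L.part 0) :
    L.bracket x y ∈ L.part 0 := by
  simpa using L.bracket_mem 0 0 x hx y hy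

theorem bracket_even_odd {x y : g} (hx : x ∈ L.part 0) (hy : y ∈ L.part 1) :
    L.bracket x y ∈ L.part 1 := by
  simpa using L.bracket_mem 0 1 x hx y hy

theorem bracket_odd_even {x y : g} (hx : x ∈ L.part 1) (hy : y ∈ L.part 0) :
    L.bracket x y ∈ L.part 1 := by
  simpa using L.bracket_mem 1 0 x hx y hy

theorem bracket_odd_odd {x y : g} (hx : x ∈ L.part 1) (hy : y ∈ L.part 1) :
    L.bracket x y ∈ L.part 0 := by
  simpa [zmod2_one_add_one] using L.bracket_mem 1 1 x hx y hy

theorem parity_even {x : g} (hx : x ∈ L.part 0) : L.parity x = x := by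
  simpa using L.parity_of_mem hx

theorem parity_odd {x : g} (hx : x ∈ L.part 1) : L.parity x = -x := by
  simpa using L.parity_of_mem hx

/-- Linear functions on `g` that agree on the homogeneous elements agree. -/
theorem homogeneous_ext {M : Type*} [AddCommGroup M] [Module ℂ M] {f f' : g →ₗ[ℂ] M}
    (h0 : ∀ x ∈ L.part 0, f x = f' x) (h1 : ∀ x ∈ L.part 1, f x = f' x) (x : g) : f x = f' x := by
  rw [← L.evenProj_add_oddProj x, map_add, map_add, h0 _ (L.evenProj_mem x),
    h1 _ (L.oddProj_mem x)]

theorem parity_bracket (x y : g) :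
    L.parity (L.bracket x y) = L.bracket (L.parity x) (L.parity y) := by
  have key : ∀ i, ∀ a ∈ L.part i, ∀ b, L.parity (L.bracket a b) = L.bracket (sgn i • a) (L.parity b) := by
    intro i a ha b
    refine LinearMap.congr_fun (f := L.parity ∘ₗ L.bracket a)
      (g := L.bracket (sgn i • a) ∘ₗ L.parity) (L.linearMap_ext_parts fun j b hb => ?_) b
    simp [L.parity_of_mem hb, L.parity_of_mem (L.bracket_mem i j a ha b hb), sgn_add, smul_smul]
  refine L.homogeneous_ext (f := L.parity ∘ₗ L.bracket.flip y)
    (f' := L.bracket.flip (L.parity y) ∘ₗ L.parity) (fun x hx => ?_) (fun x hx => ?_) x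
  · simpa [L.parity_of_mem hx] using key 0 x hx y
  · simpa [L.parity_of_mem hx] using key 1 x hx y

theorem skew_even_left {x : g} (hx : x ∈ L.part 0) (y : g) : L.bracket x y = -L.bracket y x := by
  refine L.homogeneous_ext (f := L.bracket x) (f' := -L.bracket.flip x)
    (fun y hy => ?_) (fun y hy => ?_) y
  · simpa using L.bracket_skew 0 0 x hx y hy
  · simpa using L.bracket_skew 0 1 x hx y hy

theorem symm_odd {x y : g} (hx : x ∈ L.part 1) (hy : y ∈ L.part 1) :
    L.bracket x y = L.bracket y x := by
  simpa using L.bracket_skew 1 1 x hx y hy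

theorem jacobi_even {x : g} (hx : x ∈ L.part 0) (y z : g) :
    L.bracket x (L.bracket y z) = L.bracket (L.bracket x y) z + L.bracket y (L.bracket x z) := by
  refine L.homogeneous_ext (f := L.bracket x ∘ₗ L.bracket.flip z)
    (f' := L.bracket.flip z ∘ₗ L.bracket x + L.bracket.flip (L.bracket x z))
    (fun y hy => ?_) (fun y hy => ?_) y
  · simpa using L.jacobi 0 0 x hx y hy z
  · simpa using L.jacobi 0 1 x hx y hy z

theorem jacobi_odd_odd {x y : g} (hx : x ∈ L.part 1) (hy : y ∈ L.part 1) (z : g) :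
    L.bracket (L.bracket x y) z = L.bracket x (L.bracket y z) + L.bracket y (L.bracket x z) := by
  have := L.jacobi 1 1 x hx y hy z
  simp only [mul_one, sgn_one, neg_smul, one_smul] at this
  rw [this]; abel

theorem jacobi_odd_even {x y : g} (hx : x ∈ L.part 1) (hy : y ∈ L.part 0) (z : g) :
    L.bracket x (L.bracket y z) = L.bracket (L.bracket x y) z + L.bracket y (L.bracket x z) := by
  simpa using L.jacobi 1 0 x hx y hy z

variable {L} in
theorem evenCharacters_odd (lam : L.evenCharacters) {x : g} (hx : x ∈ L.part 1) :
    (lam : Module.Dual ℂ g) x = 0 := lam.2.1 x hx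

variable {L} in
theorem evenCharacters_bracket_even (lam : L.evenCharacters) {x : g} (hx : x ∈ L.part 0) (y : g) :
    (lam : Module.Dual ℂ g) (L.bracket x y) = 0 := by
  refine L.homogeneous_ext (f := (lam : Module.Dual ℂ g) ∘ₗ L.bracket x) (f' := 0)
    (fun y hy => ?_) (fun y hy => ?_) y
  · exact lam.2.2 x hx y hy
  · exact lam.2.1 _ (L.bracket_even_odd hx hy)

variable {L} in
theorem evenCharacters_bracket_even' (lam : L.evenCharacters) {x : g} (hx : x ∈ L.part 0) (y : g) :
    (lam : Module.Dual ℂ g) (L.bracket y x) = 0 := by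
  have h := L.skew_even_left hx y
  have h2 := evenCharacters_bracket_even lam hx y
  rw [h, map_neg, neg_eq_zero] at h2
  exact h2

variable {L} in
/-- The form `(y, z) ↦ λ([y, z])` is invariant under the even part. -/
theorem evenCharacters_invariant (lam : L.evenCharacters) {x : g} (hx : x ∈ L.part 0) (y z : g) :
    (lam : Module.Dual ℂ g) (L.bracket (L.bracket x y) z) =
      -(lam : Module.Dual ℂ g) (L.bracket y (L.bracket x z)) := by
  have h := evenCharacters_bracket_even lam hx (L.bracket y z)
  rw [L.jacobi_even hx, map_add] at h
  exact eq_neg_of_add_eq_zero_left h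

/-! # Lie's theorem for the even part -/

/-- The even part of a Lie superalgebra is a Lie ring. -/
abbrev evenLieRing : LieRing (L.part 0) where
  bracket x y := ⟨L.bracket x y, L.bracket_even_even x.2 y.2⟩
  add_lie x y z := Subtype.ext (by simp)
  lie_add x y z := Subtype.ext (by simp)
  lie_self x := Subtype.ext (by
    have h := eq_neg_iff_add_eq_zero.1 (L.skew_even_left x.2 (x : g))
    rw [← two_smul ℂ] at h
    simpa using h)
  leibniz_lie x y z := Subtype.ext (L.jacobi_even x.2 y z)

/-- The even part of a Lie superalgebra is a Lie algebra. -/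
abbrev evenLieAlgebra : @LieAlgebra ℂ (L.part 0) _ L.evenLieRing :=
  letI := L.evenLieRing
  { lie_smul := fun c x y => Subtype.ext (by
      change L.bracket (x : g) (c • (y : g)) = c • L.bracket (x : g) y
      simp) }

theorem commutator_mono {A A' B B' : Submodule ℂ g} (hA : A ≤ A') (hB : B ≤ B') :
    L.commutator A B ≤ L.commutator A' B' :=
  Submodule.span_mono fun _ ⟨x, hx, y, hy, h⟩ => ⟨x, hA hx, y, hB hy, h⟩

theorem bracket_mem_commutator {A B : Submodule ℂ g} {x y : g} (hx : x ∈ A) (hy : y ∈ B) :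
    L.bracket x y ∈ L.commutator A B :=
  Submodule.subset_span ⟨x, hx, y, hy, rfl⟩

variable {L} in
theorem IsSolvable.even (hL : L.IsSolvable) :
    letI := L.evenLieRing
    letI := L.evenLieAlgebra
    LieAlgebra.IsSolvable (L.part 0) := by
  let := L.evenLieRing
  let := L.evenLieAlgebra
  obtain ⟨n, hn⟩ := hL
  have key : ∀ n, (LieAlgebra.derivedSeries ℂ (L.part 0) n).toSubmodule.map (L.part 0).subtype ≤
      L.derivedSeries n := by
    intro n
    induction n with
    | zero => exact le_top
    | succ n ih =>
      rw [LieAlgebra.derivedSeries_def, LieAlgebra.derivedSeriesOfIdeal_succ,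
        LieSubmodule.lieIdeal_oper_eq_linear_span, Submodule.map_span, Submodule.span_le]
      rintro _ ⟨_, ⟨x, y, rfl⟩, rfl⟩
      exact L.bracket_mem_commutator (ih ⟨x.1, x.2, rfl⟩) (ih ⟨y.1, y.2, rfl⟩)
  rw [LieAlgebra.isSolvable_iff ℂ]
  refine ⟨n, ?_⟩
  have h := key n
  rw [hn, le_bot_iff] at h
  rw [← LieSubmodule.toSubmodule_eq_bot]
  refine (Submodule.eq_bot_iff _).2 fun x hx => Subtype.ext ?_
  exact (Submodule.eq_bot_iff _).1 h x ⟨x, hx, rfl⟩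

variable {L} in
/-- Lie's theorem for representations of the even part of a solvable Lie superalgebra. -/
theorem IsSolvable.exists_eigenvector (hL : L.IsSolvable) {W : Type*} [AddCommGroup W] [Module ℂ W]
    [FiniteDimensional ℂ W] [Nontrivial W] (ρ : L.part 0 →ₗ[ℂ] Module.End ℂ W)
    (hρ : ∀ x y : L.part 0, ρ ⟨L.bracket x y, L.bracket_even_even x.2 y.2⟩ =
      ρ x * ρ y - ρ y * ρ x) :
    ∃ w ≠ (0 : W), ∃ γ : Module.Dual ℂ (L.part 0), ∀ x, ρ x w = γ x • w := by
  let := L.evenLieRing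
  let := L.evenLieAlgebra
  let : LieRingModule (L.part 0) W :=
    { bracket := fun x w => ρ x w
      add_lie := fun x y w => by change ρ (x + y) w = ρ x w + ρ y w; simp
      lie_add := fun x v w => map_add (ρ x) v w
      leibniz_lie := fun x y w => by
        change ρ x (ρ y w) = ρ ⟨L.bracket x y, L.bracket_even_even x.2 y.2⟩ w + ρ y (ρ x w)
        rw [hρ]; simp }
  let : LieModule ℂ (L.part 0) W :=
    { smul_lie := fun c x w => by change ρ (c • x) w = c • ρ x w; simp
      lie_smul := fun c x w => map_smul (ρ x) c w }
  have := hL.even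
  obtain ⟨γ, hγ⟩ := LieModule.exists_nontrivial_weightSpace_of_isSolvable ℂ (L.part 0) W
  obtain ⟨⟨w, hw⟩, hw0⟩ := exists_ne (0 : LieModule.weightSpace W γ)
  refine ⟨w, fun h => hw0 (Subtype.ext h), γ, fun x => ?_⟩
  exact (LieModule.mem_weightSpace _ _).1 hw x

variable {L} in
/-- Lie's theorem for subquotients of `g`: if `A` and `C` are stable under the even part and `C` is
not contained in `A`, then `C` contains a weight vector modulo `A` outside of `A`. -/
theorem IsSolvable.exists_weight [FiniteDimensional ℂ g] (hL : L.IsSolvable) {A C : Submodule ℂ g}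
    (hA : ∀ x ∈ L.part 0, ∀ a ∈ A, L.bracket x a ∈ A)
    (hC : ∀ x ∈ L.part 0, ∀ a ∈ C, L.bracket x a ∈ C) (hCA : ¬ C ≤ A) :
    ∃ e ∈ C, e ∉ A ∧ ∃ γ : Module.Dual ℂ g, (∀ x ∈ L.part 1, γ x = 0) ∧
      ∀ x ∈ L.part 0, L.bracket x e - γ x • e ∈ A := by
  let A' : Submodule ℂ C := A.comap C.subtype
  let ad : L.part 0 →ₗ[ℂ] Module.End ℂ C :=
    { toFun := fun x => (L.bracket x).restrict (hC x x.2)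
      map_add' := fun x y => by ext; simp
      map_smul' := fun c x => by ext; simp }
  have had : ∀ x, A' ≤ A'.comap (ad x) := fun x a ha => hA x x.2 _ ha
  let ρ : L.part 0 →ₗ[ℂ] Module.End ℂ (C ⧸ A') :=
    { toFun := fun x => A'.mapQ A' (ad x) (had x)
      map_add' := fun x y => by
        apply Submodule.linearMap_qext; ext z; simp
      map_smul' := fun c x => by
        apply Submodule.linearMap_qext; ext z; simp }
  have hn : Nontrivial (C ⧸ A') := by
    rw [Submodule.Quotient.nontrivial_iff]
    intro h
    refine hCA fun c hc => ?_
    have : (⟨c, hc⟩ : C) ∈ A' := h ▸ Submodule.mem_top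
    exact this
  obtain ⟨w, hw, γ, hγ⟩ := hL.exists_eigenvector ρ (by
    intro x y
    apply Submodule.linearMap_qext
    ext z
    have : ad ⟨L.bracket x y, L.bracket_even_even x.2 y.2⟩ z = ad x (ad y z) - ad y (ad x z) :=
      Subtype.ext (eq_sub_of_add_eq (L.jacobi_even x.2 y z).symm)
    simp [ρ, this])
  obtain ⟨e, rfl⟩ := A'.mkQ_surjective w
  have he : (e : g) ∉ A := fun h => hw ((Submodule.Quotient.mk_eq_zero _).2 h)
  refine ⟨e, e.2, he, γ ∘ₗ L.evenProj.codRestrict (L.part 0) L.evenProj_mem, ?_, ?_⟩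
  · intro x hx
    have : L.evenProj.codRestrict (L.part 0) L.evenProj_mem x = 0 :=
      Subtype.ext (L.evenProj_of_odd hx)
    simp [this]
  · intro x hx
    have h1 : L.evenProj.codRestrict (L.part 0) L.evenProj_mem x = ⟨x, hx⟩ :=
      Subtype.ext (L.evenProj_of_even hx)
    have h2 := hγ ⟨x, hx⟩
    change A'.mkQ (ad ⟨x, hx⟩ e) = γ ⟨x, hx⟩ • A'.mkQ e at h2
    rw [← map_smul] at h2
    have h3 := (Submodule.Quotient.eq A').1 h2
    rw [LinearMap.comp_apply, h1]
    exact h3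

end LieSuperalgebra

/-! # Generalized eigenvectors modulo a subspace -/

section GeneralizedEigenvectors

variable {V : Type*} [AddCommGroup V] [Module ℂ V]

theorem pow_apply_mem_of_le {T : Module.End ℂ V} {M : Submodule ℂ V} (hM : ∀ m ∈ M, T m ∈ M)
    {n n' : ℕ} (h : n ≤ n') {m : V} (hm : (T ^ n) m ∈ M) : (T ^ n') m ∈ M := by
  induction n', h using Nat.le_induction with
  | base => exact hm
  | succ k _ ih => rw [pow_succ', Module.End.mul_apply]; exact hM _ ih

theorem pow_apply_mem {T : Module.End ℂ V} {M : Submodule ℂ V} (hM : ∀ m ∈ M, T m ∈ M)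
    (n : ℕ) {m : V} (hm : m ∈ M) : (T ^ n) m ∈ M :=
  pow_apply_mem_of_le hM (Nat.zero_le n) (by simpa using hm)

/-- The elements of `I` that are mapped into `M` by a power of `T`. -/
def genKer (T : Module.End ℂ V) (I M : Submodule ℂ V) (hM : ∀ m ∈ M, T m ∈ M) :
    Submodule ℂ V where
  carrier := {m | m ∈ I ∧ ∃ n, (T ^ n) m ∈ M}
  zero_mem' := ⟨I.zero_mem, 0, by simp⟩
  add_mem' := by
    rintro a b ⟨ha, n, hn⟩ ⟨hb, k, hk⟩
    refine ⟨I.add_mem ha hb, max n k, ?_⟩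
    rw [map_add]
    exact M.add_mem (pow_apply_mem_of_le hM (le_max_left _ _) hn)
      (pow_apply_mem_of_le hM (le_max_right _ _) hk)
  smul_mem' := by
    rintro c a ⟨ha, n, hn⟩
    exact ⟨I.smul_mem c ha, n, by rw [map_smul]; exact M.smul_mem c hn⟩

theorem pow_apply_mem_of_commute {T Z : Module.End ℂ V} {I M : Submodule ℂ V}
    (hTM : ∀ m ∈ M, T m ∈ M) (hTI : ∀ m ∈ I, T m ∈ I) (hZM : ∀ m ∈ M, Z m ∈ M)
    (hTZ : ∀ m ∈ I, T (Z m) - Z (T m) ∈ M) (n : ℕ) :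
    ∀ m ∈ I, (T ^ n) m ∈ M → (T ^ n) (Z m) ∈ M := by
  induction n with
  | zero => intro m _ hm; exact hZM m hm
  | succ n ih =>
    intro m hI hm
    rw [pow_succ, Module.End.mul_apply] at hm ⊢
    have h := M.add_mem (pow_apply_mem hTM n (hTZ m hI)) (ih (T m) (hTI m hI) hm)
    rwa [← map_add, sub_add_cancel] at h

/-- If the commutator `Z` of `T` and `Y` commutes with `T`, then `Y` preserves the generalized
kernel of `T`. -/
theorem pow_succ_apply_mem {T Y Z : Module.End ℂ V} {I M : Submodule ℂ V}
    (hTM : ∀ m ∈ M, T m ∈ M) (hTI : ∀ m ∈ I, T m ∈ I) (hYM : ∀ m ∈ M, Y m ∈ M)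
    (hZM : ∀ m ∈ M, Z m ∈ M) (hTY : ∀ m, T (Y m) = Z m + Y (T m))
    (hTZ : ∀ m ∈ I, T (Z m) - Z (T m) ∈ M) (n : ℕ) :
    ∀ m ∈ I, (T ^ n) m ∈ M → (T ^ (n + 1)) (Y m) ∈ M := by
  induction n with
  | zero => intro m _ hm; exact pow_apply_mem hTM 1 (hYM m hm)
  | succ n ih =>
    intro m hI hm
    rw [pow_succ, Module.End.mul_apply, hTY, map_add]
    refine M.add_mem (pow_apply_mem_of_commute hTM hTI hZM hTZ (n + 1) m hI hm) ?_
    rw [pow_succ, Module.End.mul_apply] at hm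
    exact ih (T m) (hTI m hI) hm

/-- Generalized eigenspaces for the eigenvalues `0` and `c ≠ 0` are independent. -/
theorem mem_of_pow_apply_mem {X : Module.End ℂ V} {M : Submodule ℂ V} (hM : ∀ m ∈ M, X m ∈ M)
    {c : ℂ} (hc : c ≠ 0) (s : ℕ) : ∀ r : ℕ, ∀ z : V, (X ^ r) z ∈ M →
      ((X - algebraMap ℂ _ c) ^ s) z ∈ M → z ∈ M := by
  -- The case `r = 1`: modulo `M` the operator `X - c` acts on `z` as the nonzero scalar `-c`.
  have one : ∀ s : ℕ, ∀ z : V, X z ∈ M → ((X - algebraMap ℂ _ c) ^ s) z ∈ M → z ∈ M := by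
    intro s
    induction s with
    | zero => intro z _ h; simpa using h
    | succ s ih =>
      intro z hz h
      rw [pow_succ, Module.End.mul_apply] at h
      have hw : X ((X - algebraMap ℂ _ c) z) ∈ M := by
        have : X ((X - algebraMap ℂ _ c) z) = X (X z) - c • X z := by
          simp [Module.algebraMap_end_apply]
        rw [this]
        exact M.sub_mem (hM _ hz) (M.smul_mem c hz)
      have h2 := M.sub_mem hz (ih _ hw h)
      have h3 : X z - (X - algebraMap ℂ _ c) z = c • z := by simp [Module.algebraMap_end_apply]
      rw [h3] at h2
      exact (M.smul_mem_iff hc).1 h2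
  intro r
  induction r with
  | zero => intro z h _; simpa using h
  | succ r ih =>
    intro z h h'
    rw [pow_succ, Module.End.mul_apply] at h
    refine one s z (ih (X z) h ?_) h'
    have hcomm : Commute ((X - algebraMap ℂ _ c) ^ s) X :=
      ((Commute.refl X).sub_left (Algebra.commutes c X)).pow_left s
    have : ((X - algebraMap ℂ _ c) ^ s) (X z) = X (((X - algebraMap ℂ _ c) ^ s) z) :=
      LinearMap.congr_fun hcomm.eq z
    rw [this]
    exact hM _ h'

end GeneralizedEigenvectors

/-! ### Invariant subspaces and orthogonality to an odd subspace -/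

namespace LieSuperalgebra

variable {g : Type*} [AddCommGroup g] [Module ℂ g] (L : LieSuperalgebra g)

/-- The parity operator absorbs the sign, so the identity is linear in `a` and applies in graded
subspaces without splitting into homogeneous parts. -/
theorem jacobi_odd {c : g} (hc : c ∈ L.part 1) (a z : g) :
    L.bracket c (L.bracket a z) = L.bracket (L.bracket c a) z +
      L.bracket (L.parity a) (L.bracket c z) := by
  refine L.homogeneous_ext (f := L.bracket c ∘ₗ L.bracket.flip z)
    (f' := L.bracket.flip z ∘ₗ L.bracket c + L.bracket.flip (L.bracket c z) ∘ₗ L.parity)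
    (fun y hy => ?_) (fun y hy => ?_) a
  · simpa [L.parity_even hy] using L.jacobi_odd_even hc hy z
  · simpa [L.parity_odd hy] using L.jacobi 1 1 c hc y hy z

/-- An odd subspace stable under the even part; together with the even part it forms a
subsuperalgebra. -/
structure IsStableOdd (C : Submodule ℂ g) : Prop where
  le : C ≤ L.part 1
  bracket_mem : ∀ x ∈ L.part 0, ∀ c ∈ C, L.bracket x c ∈ C

/-- A graded subspace stable under the subsuperalgebra generated by the even part and `C`. -/
structure IsInvariant (C I : Submodule ℂ g) : Prop where
  parity : ∀ m ∈ I, L.parity m ∈ I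
  even : ∀ x ∈ L.part 0, ∀ m ∈ I, L.bracket x m ∈ I
  odd : ∀ c ∈ C, ∀ m ∈ I, L.bracket c m ∈ I

/-- The elements orthogonal to `C` with respect to the form `λ([y, z])`. -/
def orth (lam : Module.Dual ℂ g) (C : Submodule ℂ g) : Submodule ℂ g where
  carrier := {m | ∀ y ∈ C, lam (L.bracket y m) = 0}
  zero_mem' := by simp
  add_mem' := fun ha hb y hy => by simp [ha y hy, hb y hy]
  smul_mem' := fun c a ha y hy => by simp [ha y hy]

/-- The largest invariant subspace orthogonal to `C`. -/
def maxInvariant (lam : Module.Dual ℂ g) (C : Submodule ℂ g) : Submodule ℂ g :=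
  sSup {I | L.IsInvariant C I ∧ I ≤ L.orth lam C}

variable {L} {lam : L.evenCharacters} {C : Submodule ℂ g}

theorem IsInvariant.oddProj_mem {I : Submodule ℂ g} (hI : L.IsInvariant C I) {m : g}
    (hm : m ∈ I) : L.oddProj m ∈ I := by
  have h := I.sub_mem hm (hI.parity m hm)
  have h2 : m - L.parity m = (2 : ℂ) • L.oddProj m := by
    conv_lhs => rw [← L.evenProj_add_oddProj m]
    rw [map_add, L.parity_even (L.evenProj_mem m), L.parity_odd (L.oddProj_mem m), two_smul]
    abel
  rw [h2] at h
  exact (I.smul_mem_iff two_ne_zero).1 h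

theorem IsInvariant.evenProj_mem {I : Submodule ℂ g} (hI : L.IsInvariant C I) {m : g}
    (hm : m ∈ I) : L.evenProj m ∈ I := by
  rw [eq_sub_of_add_eq (L.evenProj_add_oddProj m)]
  exact I.sub_mem hm (hI.oddProj_mem hm)

theorem IsInvariant.bracket_mem {I : Submodule ℂ g} (hI : L.IsInvariant C I) {a m : g}
    (ha : a ∈ L.part 0 ⊔ C) (hm : m ∈ I) : L.bracket a m ∈ I := by
  obtain ⟨x, hx, c, hc, rfl⟩ := Submodule.mem_sup.1 ha
  rw [map_add, LinearMap.add_apply]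
  exact I.add_mem (hI.even x hx m hm) (hI.odd c hc m hm)

theorem maxInvariant_invariant (lam : Module.Dual ℂ g) (C : Submodule ℂ g) :
    L.IsInvariant C (L.maxInvariant lam C) := by
  have key : ∀ T : Module.End ℂ g, (∀ I, L.IsInvariant C I → ∀ m ∈ I, T m ∈ I) →
      ∀ m ∈ L.maxInvariant lam C, T m ∈ L.maxInvariant lam C := by
    intro T hT
    have : L.maxInvariant lam C ≤ (L.maxInvariant lam C).comap T :=
      sSup_le fun I hI m hm => (le_sSup hI : I ≤ L.maxInvariant lam C) (hT I hI.1 m hm)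
    exact this
  exact ⟨key L.parity fun I hI => hI.parity, fun x hx => key _ fun I hI => hI.even x hx,
    fun c hc => key _ fun I hI => hI.odd c hc⟩

theorem maxInvariant_le (lam : Module.Dual ℂ g) (C : Submodule ℂ g) :
    L.maxInvariant lam C ≤ L.orth lam C :=
  sSup_le fun _ hI => hI.2

theorem le_maxInvariant {lam : Module.Dual ℂ g} {I : Submodule ℂ g} (hI : L.IsInvariant C I)
    (h : I ≤ L.orth lam C) : I ≤ L.maxInvariant lam C :=
  le_sSup ⟨hI, h⟩

theorem even_le_orth : L.part 0 ≤ L.orth lam C := fun _ hx y _ =>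
  evenCharacters_bracket_even' lam hx y

variable (L) in
/-- The derived series of the subsuperalgebra generated by the even part and `C`. -/
def relDerived (C : Submodule ℂ g) : ℕ → Submodule ℂ g
  | 0 => L.part 0 ⊔ C
  | n + 1 => L.commutator (relDerived C n) (relDerived C n)

theorem relDerived_le_derivedSeries (n : ℕ) : L.relDerived C n ≤ L.derivedSeries n := by
  induction n with
  | zero => exact le_top
  | succ n ih => exact L.commutator_mono ih ih

theorem IsStableOdd.sup_invariant (hC : L.IsStableOdd C) : L.IsInvariant C (L.part 0 ⊔ C) where
  parity m hm := by
    obtain ⟨x, hx, c, hc, rfl⟩ := Submodule.mem_sup.1 hm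
    rw [map_add, L.parity_even hx, L.parity_odd (hC.le hc)]
    exact Submodule.add_mem_sup hx (C.neg_mem hc)
  even y hy m hm := by
    obtain ⟨x, hx, c, hc, rfl⟩ := Submodule.mem_sup.1 hm
    rw [map_add]
    exact Submodule.add_mem_sup (L.bracket_even_even hy hx) (hC.bracket_mem y hy c hc)
  odd y hy m hm := by
    obtain ⟨x, hx, c, hc, rfl⟩ := Submodule.mem_sup.1 hm
    have h := L.skew_even_left hx y
    rw [map_add, add_comm]
    refine Submodule.add_mem_sup (L.bracket_odd_odd (hC.le hy) (hC.le hc)) ?_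
    rw [← neg_eq_iff_eq_neg.2 h]
    exact C.neg_mem (hC.bracket_mem x hx y hy)

theorem relDerived_invariant (hC : L.IsStableOdd C) (n : ℕ) :
    L.IsInvariant C (L.relDerived C n) ∧ L.relDerived C n ≤ L.part 0 ⊔ C := by
  induction n with
  | zero => exact ⟨hC.sup_invariant, le_rfl⟩
  | succ n ih =>
    obtain ⟨ih, hle⟩ := ih
    have key : ∀ T : Module.End ℂ g, (∀ a ∈ L.relDerived C n, ∀ b ∈ L.relDerived C n,
        T (L.bracket a b) ∈ L.relDerived C (n + 1)) → ∀ m ∈ L.relDerived C (n + 1),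
        T m ∈ L.relDerived C (n + 1) := by
      intro T hT
      have : L.relDerived C (n + 1) ≤ (L.relDerived C (n + 1)).comap T :=
        Submodule.span_le.2 (by rintro _ ⟨a, ha, b, hb, rfl⟩; exact hT a ha b hb)
      exact this
    refine ⟨⟨key _ fun a ha b hb => ?_, fun x hx => key _ fun a ha b hb => ?_,
      fun c hc => key _ fun a ha b hb => ?_⟩, ?_⟩
    · rw [L.parity_bracket]
      exact L.bracket_mem_commutator (ih.parity a ha) (ih.parity b hb)
    · rw [L.jacobi_even hx]
      exact Submodule.add_mem _ (L.bracket_mem_commutator (ih.even x hx a ha) hb)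
        (L.bracket_mem_commutator ha (ih.even x hx b hb))
    · rw [L.jacobi_odd (hC.le hc)]
      exact Submodule.add_mem _ (L.bracket_mem_commutator (ih.odd c hc a ha) hb)
        (L.bracket_mem_commutator (ih.parity a ha) (ih.odd c hc b hb))
    · refine le_trans (Submodule.span_le.2 ?_) hle
      rintro _ ⟨a, ha, b, hb, rfl⟩
      exact ih.bracket_mem (hle ha) hb

theorem mem_of_mem_sup_of_odd (hC : L.IsStableOdd C) {b : g} (hb : b ∈ L.part 0 ⊔ C)
    (hb1 : b ∈ L.part 1) : b ∈ C := by
  obtain ⟨x, hx, c, hc, rfl⟩ := Submodule.mem_sup.1 hb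
  have : x ∈ L.part 1 := by
    have := (L.part 1).sub_mem hb1 (hC.le hc)
    simpa using this
  rw [Submodule.disjoint_def.1 L.isCompl.disjoint x hx this, zero_add]
  exact hc

/-- An even commutator `[a, b]` of odd elements of `C` that has a single nonzero generalized
eigenvalue on `I` modulo `M` forces `I` to be orthogonal to `C`. -/
theorem IsInvariant.le_orth_of_eigenvalue [FiniteDimensional ℂ g] (hC : L.IsStableOdd C)
    {I M : Submodule ℂ g} (hI : L.IsInvariant C I) (hM : L.IsInvariant C M)
    (hMo : M ≤ L.orth lam C) {a b : g} (ha : a ∈ C) (hb : b ∈ C) {c : ℂ} (hc : c ≠ 0)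
    (hx : ∀ m ∈ I, ∃ n, ((L.bracket (L.bracket a b) - algebraMap ℂ (Module.End ℂ g) c) ^ n) m ∈ M) :
    I ≤ L.orth lam C := by
  set x := L.bracket a b with hxdef
  have hx0 : x ∈ L.part 0 := L.bracket_odd_odd (hC.le ha) (hC.le hb)
  -- Modulo `M`, `ad x` has the eigenvalue `c` on `I`. By invariance of the form such elements can
  -- pair only with the eigenvalue `-c` in `C`, which `S` detects.
  set T : Module.End ℂ g := L.bracket x - algebraMap ℂ (Module.End ℂ g) c with hT
  set S : Module.End ℂ g := L.bracket x + algebraMap ℂ (Module.End ℂ g) c with hS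
  have hTa : ∀ m, T m = L.bracket x m - c • m := fun m => by simp [hT, Module.algebraMap_end_apply]
  have hSa : ∀ m, S m = L.bracket x m + c • m := fun m => by simp [hS, Module.algebraMap_end_apply]
  have hTM : ∀ m ∈ M, T m ∈ M := fun m hm => by
    rw [hTa]; exact M.sub_mem (hM.even x hx0 m hm) (M.smul_mem c hm)
  have hTI : ∀ m ∈ I, T m ∈ I := fun m hm => by
    rw [hTa]; exact I.sub_mem (hI.even x hx0 m hm) (I.smul_mem c hm)
  have hXM : ∀ m ∈ M, L.bracket x m ∈ M := fun m hm => hM.even x hx0 m hm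
  have hSC : ∀ m ∈ C, S m ∈ C := fun m hm => by
    rw [hSa]; exact C.add_mem (hC.bracket_mem x hx0 m hm) (C.smul_mem c hm)
  -- Eigenvalues add under the bracket: `-c` on `y` and `c` on `u` give the generalized eigenvalue
  -- `0` on `[y, u]` modulo `M`. The induction is on the sum of the exponents, by the Leibniz rule
  -- `[x, [y, u]] = [S y, u] + [y, T u]`.
  have prod : ∀ s n k : ℕ, n + k ≤ s → ∀ y ∈ C, ∀ u ∈ I, (S ^ n) y = 0 → (T ^ k) u ∈ M →
      ∃ r, (L.bracket x ^ r) (L.bracket y u) ∈ M := by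
    intro s
    induction s with
    | zero =>
      intro n k hnk y hy u hu hn _
      obtain rfl : n = 0 := by omega
      simp only [pow_zero, Module.End.one_apply] at hn
      exact ⟨0, by simp [hn]⟩
    | succ s ih =>
      intro n k hnk y hy u hu hn hk
      rcases n with _ | n
      · simp only [pow_zero, Module.End.one_apply] at hn
        exact ⟨0, by simp [hn]⟩
      rcases k with _ | k
      · exact ⟨0, hM.odd y hy u hk⟩
      obtain ⟨r, hr⟩ := ih n (k + 1) (by omega) (S y) (hSC y hy) u hu
        (by rwa [pow_succ, Module.End.mul_apply] at hn) hk
      obtain ⟨r', hr'⟩ := ih (n + 1) k (by omega) y hy (T u) (hTI u hu) hn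
        (by rwa [pow_succ, Module.End.mul_apply] at hk)
      refine ⟨max r r' + 1, ?_⟩
      rw [pow_succ, Module.End.mul_apply]
      have : L.bracket x (L.bracket y u) = L.bracket (S y) u + L.bracket y (T u) := by
        rw [L.jacobi_even hx0, hSa, hTa]; simp
      rw [this, map_add]
      exact M.add_mem (pow_apply_mem_of_le hXM (le_max_left _ _) hr)
        (pow_apply_mem_of_le hXM (le_max_right _ _) hr')
  -- Elements `y` of generalized eigenvalue `-c`. By `prod`, `[y, u]` has eigenvalue `0`, but it
  -- lies in `I`, where only `c ≠ 0` occurs, so it lies in `M`. Since `λ` kills brackets with even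
  -- elements, `λ([y, [a, u]]) = -λ([a, [y, u]]) = 0`. As `ad x` is `[a, [b, ·]] + [b, [a, ·]]`,
  -- also `λ([y, [x, m]]) = 0`; so passing from `m` to `T m` only multiplies the pairing by `-c`.
  have F : ∀ y ∈ C, (∃ n, (S ^ n) y = 0) → ∀ m ∈ I, (lam : Module.Dual ℂ g) (L.bracket y m) = 0 := by
    rintro y hy ⟨n, hn⟩
    have mem : ∀ u ∈ I, L.bracket y u ∈ M := by
      intro u hu
      obtain ⟨k, hk⟩ := hx u hu
      obtain ⟨r, hr⟩ := prod _ n k le_rfl y hy u hu hn hk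
      obtain ⟨s, hs⟩ := hx _ (hI.odd y hy u hu)
      exact mem_of_pow_apply_mem hXM hc s r _ hr hs
    have half : ∀ a ∈ C, ∀ u ∈ I, (lam : Module.Dual ℂ g) (L.bracket y (L.bracket a u)) = 0 := by
      intro a ha u hu
      have h1 := L.jacobi_odd_odd (hC.le hy) (hC.le ha) u
      have h2 := congrArg (lam : Module.Dual ℂ g) h1
      rw [map_add, evenCharacters_bracket_even lam (L.bracket_odd_odd (hC.le hy) (hC.le ha)),
        hMo (mem u hu) a ha, add_zero] at h2
      exact h2.symm
    have hxm : ∀ m ∈ I, (lam : Module.Dual ℂ g) (L.bracket y (L.bracket x m)) = 0 := by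
      intro m hm
      rw [hxdef, L.jacobi_odd_odd (hC.le ha) (hC.le hb), map_add, map_add,
        half a ha _ (hI.odd b hb m hm), half b hb _ (hI.odd a ha m hm), add_zero]
    have ind : ∀ k : ℕ, ∀ m ∈ I, (T ^ k) m ∈ M → (lam : Module.Dual ℂ g) (L.bracket y m) = 0 := by
      intro k
      induction k with
      | zero => intro m _ hm; exact hMo hm y hy
      | succ k ih =>
        intro m hm hk
        have h := ih (T m) (hTI m hm) (by rwa [pow_succ, Module.End.mul_apply] at hk)
        rw [hTa, map_sub, map_sub, hxm m hm, map_smul, map_smul, zero_sub, neg_eq_zero,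
          smul_eq_mul] at h
        exact (mul_eq_zero.1 h).resolve_left hc
    intro m hm
    obtain ⟨k, hk⟩ := hx m hm
    exact ind k m hm hk
  -- Elements in the image of `S ^ k`. By invariance `S` is minus the adjoint of `T`, so `S ^ k` can
  -- be moved to the other side, where `T ^ k` sends `m` into `M`.
  have G : ∀ k : ℕ, ∀ m, ∀ y ∈ C, (T ^ k) m ∈ M →
      (lam : Module.Dual ℂ g) (L.bracket ((S ^ k) y) m) = 0 := by
    intro k
    induction k with
    | zero => intro m y hy hm; exact hMo hm y hy
    | succ k ih =>
      intro m y hy hm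
      rw [pow_succ, Module.End.mul_apply] at hm
      have h := ih (T m) y hy hm
      rw [pow_succ', Module.End.mul_apply, hSa, map_add, LinearMap.add_apply, map_add,
        evenCharacters_invariant lam hx0]
      rw [hTa] at h
      simp only [map_sub, map_smul] at h
      simp only [map_smul, LinearMap.smul_apply]
      linear_combination -h
  intro m hm y hy
  obtain ⟨k, hk⟩ := hx m hm
  let SC : Module.End ℂ C := S.restrict hSC
  have hpow : ∀ n (z : C), (((SC ^ n) z : C) : g) = (S ^ n) z := by
    intro n
    induction n with
    | zero => intro z; rfl
    | succ n ih => intro z; rw [pow_succ, pow_succ, Module.End.mul_apply, ih]; rfl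
  -- Fitting decomposition of `C` under `S`: every `y` is a sum of elements of the two kinds. The
  -- exponent is taken at least `k` so that `G` applies to `m`.
  obtain ⟨n, hn, hkn⟩ := (SC.eventually_isCompl_ker_pow_range_pow.and
    (Filter.eventually_ge_atTop k)).exists
  have hy' : (⟨y, hy⟩ : C) ∈ LinearMap.ker (SC ^ n) ⊔ LinearMap.range (SC ^ n) := by
    rw [hn.sup_eq_top]; trivial
  obtain ⟨y1, hy1, _, ⟨z, rfl⟩, hsum⟩ := Submodule.mem_sup.1 hy'
  have hsum' : (y1 : g) + (S ^ n) z = y := by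
    rw [← hpow]; exact congrArg Subtype.val hsum
  rw [← hsum', map_add, LinearMap.add_apply, map_add,
    F y1 y1.2 ⟨n, by rw [← hpow, LinearMap.mem_ker.1 hy1]; rfl⟩ m hm,
    G n m z z.2 (pow_apply_mem_of_le hTM hkn hk), add_zero]

end LieSuperalgebra

/-! ### Minimal invariant subspaces and the derived series -/

namespace LieSuperalgebra

variable {g : Type*} [AddCommGroup g] [Module ℂ g] {L : LieSuperalgebra g}
variable {lam : L.evenCharacters} {C : Submodule ℂ g}

/-- The elements of `I` that a set of odd and even elements of `g` maps into `M`. -/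
def annihilatorIn (L : LieSuperalgebra g) (E I M : Submodule ℂ g) : Submodule ℂ g where
  carrier := {m | m ∈ I ∧ ∀ a ∈ E, L.bracket a m ∈ M}
  zero_mem' := ⟨I.zero_mem, by simp⟩
  add_mem' := fun ha hb => ⟨I.add_mem ha.1 hb.1, fun e he => by
    rw [map_add]; exact M.add_mem (ha.2 e he) (hb.2 e he)⟩
  smul_mem' := fun c a ha => ⟨I.smul_mem c ha.1, fun e he => by
    rw [map_smul]; exact M.smul_mem c (ha.2 e he)⟩

/-- By the Jacobi identity `[a, [x, m]]` differs from `± [x, [a, m]]` by a bracket of `m` with an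
element of `[x, E] ⊆ E`. -/
theorem annihilatorIn_invariant (hC : L.IsStableOdd C) {E I M : Submodule ℂ g}
    (hE : L.IsInvariant C E) (hI : L.IsInvariant C I) (hM : L.IsInvariant C M) :
    L.IsInvariant C (L.annihilatorIn E I M) where
  parity := fun m ⟨hm, h⟩ => ⟨hI.parity m hm, fun a ha => by
    rw [← L.parity_parity a, ← L.parity_bracket]
    exact hM.parity _ (h _ (hE.parity a ha))⟩
  even := fun x hx m ⟨hm, h⟩ => ⟨hI.even x hx m hm, fun a ha => by
    rw [eq_sub_of_add_eq' (L.jacobi_even hx a m).symm]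
    exact M.sub_mem (hM.even x hx _ (h a ha)) (h _ (hE.even x hx a ha))⟩
  odd := fun c hc m ⟨hm, h⟩ => ⟨hI.odd c hc m hm, fun a ha => by
    have h1 := L.jacobi_odd (hC.le hc) (L.parity a) m
    rw [L.parity_parity] at h1
    rw [eq_sub_of_add_eq' h1.symm]
    exact M.sub_mem (hM.odd c hc _ (h _ (hE.parity a ha)))
      (h _ (hE.odd c hc _ (hE.parity a ha)))⟩

theorem annihilatorIn_le (E I M : Submodule ℂ g) : L.annihilatorIn E I M ≤ I := fun _ h => h.1

/-- The genuine weight of the even part on a weight vector modulo `M` vanishes on commutators. -/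
theorem weight_bracket {M : Submodule ℂ g} (hM : ∀ x ∈ L.part 0, ∀ m ∈ M, L.bracket x m ∈ M)
    {e : g} (he : e ∉ M) {γ : Module.Dual ℂ g}
    (hγ : ∀ x ∈ L.part 0, L.bracket x e - γ x • e ∈ M) {x y : g} (hx : x ∈ L.part 0)
    (hy : y ∈ L.part 0) : γ (L.bracket x y) = 0 := by
  have two : ∀ x ∈ L.part 0, ∀ y ∈ L.part 0,
      L.bracket x (L.bracket y e) - (γ x * γ y) • e ∈ M := by
    intro x hx y hy
    have h1 := M.add_mem (hM x hx _ (hγ y hy)) (M.smul_mem (γ y) (hγ x hx))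
    convert h1 using 1
    simp only [map_sub, map_smul, smul_sub, smul_smul, mul_comm (γ x)]
    abel
  have h := hγ _ (L.bracket_even_even hx hy)
  rw [eq_sub_of_add_eq (L.jacobi_even hx y e).symm] at h
  have h2 := M.sub_mem (M.sub_mem (two x hx y hy) (two y hy x hx)) h
  have h3 : γ (L.bracket x y) • e ∈ M := by
    convert h2 using 1
    rw [mul_comm (γ y)]
    abel
  by_contra h0
  exact he ((M.smul_mem_iff h0).1 h3)

/-- If the next term of the derived series kills `I` modulo `M`, and the even part of this term
kills a vector of `I` outside of `M`, then so does the whole term. -/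
theorem exists_common_null [FiniteDimensional ℂ g] (hC : L.IsStableOdd C) {I M : Submodule ℂ g}
    (hI : L.IsInvariant C I) (hM : L.IsInvariant C M) {n : ℕ}
    (hkill : ∀ a ∈ L.relDerived C (n + 1), ∀ m ∈ I, L.bracket a m ∈ M) {e : g} (heI : e ∈ I)
    (heM : e ∉ M) (he : ∀ x ∈ L.relDerived C n, x ∈ L.part 0 → L.bracket x e ∈ M) :
    ∃ m ∈ I, m ∉ M ∧ ∀ a ∈ L.relDerived C n, L.bracket a m ∈ M := by
  classical
  obtain ⟨hE, hEle⟩ := relDerived_invariant hC n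
  obtain ⟨S, hS⟩ : (L.relDerived C n ⊓ L.part 1).FG := IsNoetherian.noetherian _
  -- The odd elements are treated one at a time: if `b` does not kill `m` modulo `M`, replace `m` by
  -- `[b, m]`. Commutators lie in the next derived term, which kills `I` modulo `M`; so `b` squares
  -- to zero and the elements already treated kill the new vector as well.
  have key : ∀ F : Finset g, F ⊆ S → ∃ m ∈ I, m ∉ M ∧
      (∀ x ∈ L.relDerived C n, x ∈ L.part 0 → L.bracket x m ∈ M) ∧
      ∀ b ∈ F, L.bracket b m ∈ M := by
    intro F
    induction F using Finset.induction_on with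
    | empty => exact fun _ => ⟨e, heI, heM, he, by simp⟩
    | insert b F _ ih =>
      intro hF
      rw [Finset.insert_subset_iff] at hF
      obtain ⟨m, hmI, hmM, hm0, hm1⟩ := ih hF.2
      by_cases hbm : L.bracket b m ∈ M
      · exact ⟨m, hmI, hmM, hm0, by simpa using ⟨hbm, hm1⟩⟩
      have hSmem : ∀ s ∈ S, s ∈ L.relDerived C n ∧ s ∈ L.part 1 := fun s hs => by
        have : s ∈ L.relDerived C n ⊓ L.part 1 := hS ▸ Submodule.subset_span hs
        exact this
      obtain ⟨hbE, hb1⟩ := hSmem b hF.1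
      have hbC := mem_of_mem_sup_of_odd hC (hEle hbE) hb1
      have comm : ∀ f ∈ F, L.bracket f (L.bracket b m) ∈ M := by
        intro f hf
        obtain ⟨hfE, hf1⟩ := hSmem f (hF.2 hf)
        rw [eq_sub_of_add_eq (L.jacobi_odd_odd hf1 hb1 m).symm]
        exact M.sub_mem (hkill _ (L.bracket_mem_commutator hfE hbE) m hmI)
          (hM.odd b hbC _ (hm1 f hf))
      refine ⟨L.bracket b m, hI.odd b hbC m hmI, hbm, fun x hx hx0 => ?_, fun f hf => ?_⟩
      · rw [L.jacobi_even hx0]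
        exact M.add_mem (hkill _ (L.bracket_mem_commutator hx hbE) m hmI)
          (hM.odd b hbC _ (hm0 x hx hx0))
      · rcases Finset.mem_insert.1 hf with rfl | hf
        · have h := hkill _ (L.bracket_mem_commutator hbE hbE) m hmI
          rw [L.jacobi_odd_odd hb1 hb1, ← two_smul ℂ] at h
          exact (M.smul_mem_iff two_ne_zero).1 h
        · exact comm f hf
  obtain ⟨m, hmI, hmM, hm0, hm1⟩ := key S subset_rfl
  refine ⟨m, hmI, hmM, fun a ha => ?_⟩
  rw [← L.evenProj_add_oddProj a, map_add, LinearMap.add_apply]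
  refine M.add_mem (hm0 _ (hE.evenProj_mem ha) (L.evenProj_mem a)) ?_
  have h1 : L.relDerived C n ⊓ L.part 1 ≤ M.comap (L.bracket.flip m) := by
    rw [← hS, Submodule.span_le]
    exact fun b hb => hm1 b hb
  exact h1 ⟨hE.oddProj_mem ha, L.oddProj_mem a⟩

/-- Let `I` be an invariant subspace, not orthogonal to `C`, all of whose invariant subspaces are
contained in `M` or equal to `I`. Then the derived subsuperalgebra maps `I` into `M`. -/
theorem relDerived_one_bracket_mem [FiniteDimensional ℂ g] (hL : L.IsSolvable)
    (hC : L.IsStableOdd C) {I M : Submodule ℂ g} (hI : L.IsInvariant C I)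
    (hM : L.IsInvariant C M) (hMo : M ≤ L.orth lam C) (hIo : ¬ I ≤ L.orth lam C)
    (hmin : ∀ I', L.IsInvariant C I' → I' ≤ I → ¬ I' ≤ M → I' = I) :
    ∀ a ∈ L.relDerived C 1, ∀ m ∈ I, L.bracket a m ∈ M := by
  have hIM : ¬ I ≤ M := fun h => hIo (h.trans hMo)
  obtain ⟨e, heI, heM, γ, hγ1, hγ⟩ := hL.exists_weight hM.even hI.even hIM
  have step : ∀ n, (∀ a ∈ L.relDerived C (n + 2), ∀ m ∈ I, L.bracket a m ∈ M) →
      ∀ a ∈ L.relDerived C (n + 1), ∀ m ∈ I, L.bracket a m ∈ M := by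
    intro n hkill
    obtain ⟨hE, hEle⟩ := relDerived_invariant hC n
    obtain ⟨hE', hEle'⟩ := relDerived_invariant hC (n + 1)
    -- If `γ` vanishes on this derived term, the term has a common null vector modulo `M`, and its
    -- annihilator is all of `I` by minimality. A nonzero value of `γ` will contradict that `I` is
    -- not orthogonal to `C`.
    by_cases hz : ∀ x ∈ L.relDerived C (n + 1), γ x = 0
    · obtain ⟨m, hmI, hmM, hm⟩ := exists_common_null hC hI hM hkill heI heM (fun x hx hx0 => by
        simpa [hz x hx] using hγ x hx0)
      have := hmin _ (annihilatorIn_invariant hC hE' hI hM) (annihilatorIn_le _ _ _)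
        (fun h => hmM (h ⟨hmI, hm⟩))
      intro a ha m hm
      rw [← this] at hm
      exact hm.2 a ha
    · exfalso
      -- A weight vanishes on odd elements and on commutators of even ones, so a nonzero value must
      -- come from a bracket of two odd elements.
      obtain ⟨a, ha, ha1, b, hb, hb1, hc⟩ : ∃ a ∈ L.relDerived C n, a ∈ L.part 1 ∧
          ∃ b ∈ L.relDerived C n, b ∈ L.part 1 ∧ γ (L.bracket a b) ≠ 0 := by
        by_contra hcon
        push Not at hcon
        refine hz fun x hx => ?_
        have : L.relDerived C (n + 1) ≤ LinearMap.ker γ := by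
          refine Submodule.span_le.2 ?_
          rintro _ ⟨a, ha, b, hb, rfl⟩
          change γ (L.bracket a b) = 0
          rw [← L.evenProj_add_oddProj a, ← L.evenProj_add_oddProj b]
          simp only [map_add, LinearMap.add_apply]
          rw [weight_bracket hM.even heM hγ (L.evenProj_mem a) (L.evenProj_mem b),
            hγ1 _ (L.bracket_even_odd (L.evenProj_mem a) (L.oddProj_mem b)),
            hγ1 _ (L.bracket_odd_even (L.oddProj_mem a) (L.evenProj_mem b)),
            hcon _ (hE.oddProj_mem ha) (L.oddProj_mem a) _ (hE.oddProj_mem hb) (L.oddProj_mem b)]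
          simp
        exact this hx
      have haC := mem_of_mem_sup_of_odd hC (hEle ha) ha1
      have hbC := mem_of_mem_sup_of_odd hC (hEle hb) hb1
      set x := L.bracket a b with hxdef
      have hx0 : x ∈ L.part 0 := L.bracket_odd_odd ha1 hb1
      have hxE : x ∈ L.relDerived C (n + 1) := L.bracket_mem_commutator ha hb
      set T : Module.End ℂ g := L.bracket x - algebraMap ℂ (Module.End ℂ g) (γ x) with hT
      have hTa : ∀ m, T m = L.bracket x m - γ x • m := fun m => by
        simp [hT, Module.algebraMap_end_apply]
      have hTM : ∀ m ∈ M, T m ∈ M := fun m hm => by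
        rw [hTa]; exact M.sub_mem (hM.even x hx0 m hm) (M.smul_mem _ hm)
      have hTI : ∀ m ∈ I, T m ∈ I := fun m hm => by
        rw [hTa]; exact I.sub_mem (hI.even x hx0 m hm) (I.smul_mem _ hm)
      have hTY : ∀ y m, T (L.bracket y m) = L.bracket (L.bracket x y) m + L.bracket y (T m) := by
        intro y m
        rw [hTa, hTa, L.jacobi_even hx0, map_sub, map_smul]
        abel
      have hstab : ∀ y ∈ L.part 0 ⊔ C, (∀ m ∈ M, L.bracket y m ∈ M) →
          (∀ m ∈ M, L.bracket (L.bracket x y) m ∈ M) → L.bracket x y ∈ L.relDerived C (n + 1) →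
          ∀ k : ℕ, ∀ m ∈ I, (T ^ k) m ∈ M → (T ^ (k + 1)) (L.bracket y m) ∈ M := by
        intro y _ hyM hzM hzE
        refine pow_succ_apply_mem hTM hTI hyM hzM (hTY y) fun m hm => ?_
        rw [hTY, add_sub_cancel_right]
        exact hkill _ (L.bracket_mem_commutator hxE hzE) m hm
      -- For `y` in `g₀ ⊕ C` the bracket `[x, y]` lies in the same derived term as `x`, hence
      -- commutes with `x` on `I` modulo `M` by `hkill`. So `y` preserves the generalized eigenspace
      -- of `x` for `γ x`, raising the exponent by one. This eigenspace contains `e` and equals `I`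
      -- by minimality.
      have hinv : L.IsInvariant C (genKer T I M hTM) := by
        refine ⟨?_, ?_, ?_⟩
        · rintro m ⟨hm, k, hk⟩
          refine ⟨hI.parity m hm, k, ?_⟩
          have hcomm : Commute (T ^ k) L.parity := by
            refine Commute.pow_left ?_ k
            ext z
            simp [hTa, L.parity_bracket, L.parity_even hx0]
          have : (T ^ k) (L.parity m) = L.parity ((T ^ k) m) := LinearMap.congr_fun hcomm.eq m
          rw [this]
          exact hM.parity _ hk
        · rintro y hy m ⟨hm, k, hk⟩
          refine ⟨hI.even y hy m hm, k + 1, hstab y (Submodule.mem_sup_left hy) (hM.even y hy)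
            (hM.even _ (L.bracket_even_even hx0 hy)) ?_ k m hm hk⟩
          rw [L.skew_even_left hx0]
          exact Submodule.neg_mem _ (hE'.even y hy x hxE)
        · rintro y hy m ⟨hm, k, hk⟩
          refine ⟨hI.odd y hy m hm, k + 1, hstab y (Submodule.mem_sup_right hy) (hM.odd y hy)
            (hM.odd _ (hC.bracket_mem x hx0 y hy)) ?_ k m hm hk⟩
          rw [L.skew_even_left hx0]
          exact Submodule.neg_mem _ (hE'.odd y hy x hxE)
      have heq := hmin _ hinv (fun m hm => hm.1) (fun h => heM (h ⟨heI, 1, by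
        rw [pow_one, hTa]; exact hγ x hx0⟩))
      refine hIo (hI.le_orth_of_eigenvalue hC hM hMo haC hbC hc fun m hm => ?_)
      rw [← heq] at hm
      exact hm.2
  obtain ⟨N, hN⟩ := hL
  -- The index is shifted by one so that the induction ends at the first derived term and not at the
  -- whole subsuperalgebra.
  have hbot : ∀ a ∈ L.relDerived C (N + 1), ∀ m ∈ I, L.bracket a m ∈ M := by
    intro a ha m _
    have hle : L.relDerived C (N + 1) ≤ L.relDerived C N := by
      obtain ⟨hE, hEle⟩ := relDerived_invariant hC N
      refine Submodule.span_le.2 ?_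
      rintro _ ⟨a, ha, b, hb, rfl⟩
      exact hE.bracket_mem (hEle ha) hb
    have := relDerived_le_derivedSeries N (hle ha)
    rw [hN, Submodule.mem_bot] at this
    simp [this]
  clear hN
  induction N with
  | zero => exact hbot
  | succ N ih => exact ih (step N hbot)

theorem IsInvariant.sup_span {M : Submodule ℂ g} (hM : L.IsInvariant C M) {ξ : g}
    (hξ : ξ ∈ L.part 1) (hodd : ∀ c ∈ C, L.bracket c ξ ∈ M) {α : Module.Dual ℂ g}
    (hα : ∀ x ∈ L.part 0, L.bracket x ξ - α x • ξ ∈ M) : L.IsInvariant C (M ⊔ ℂ ∙ ξ) := by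
  have key : ∀ T : Module.End ℂ g, (∀ m ∈ M, T m ∈ M) → T ξ ∈ M ⊔ ℂ ∙ ξ →
      ∀ m ∈ M ⊔ ℂ ∙ ξ, T m ∈ M ⊔ ℂ ∙ ξ := by
    intro T hT hTξ
    have : M ⊔ ℂ ∙ ξ ≤ (M ⊔ ℂ ∙ ξ).comap T :=
      sup_le (fun m hm => Submodule.mem_sup_left (hT m hm))
        ((Submodule.span_singleton_le_iff_mem _ _).2 hTξ)
    exact this
  have hself : ξ ∈ M ⊔ ℂ ∙ ξ := Submodule.mem_sup_right (Submodule.mem_span_singleton_self ξ)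
  refine ⟨key _ hM.parity ?_, fun x hx => key _ (hM.even x hx) ?_,
    fun c hc => key _ (hM.odd c hc) (Submodule.mem_sup_left (hodd c hc))⟩
  · rw [L.parity_odd hξ]; exact Submodule.neg_mem _ hself
  · rw [← sub_add_cancel (L.bracket x ξ) (α x • ξ)]
    exact Submodule.add_mem _ (Submodule.mem_sup_left (hα x hx)) (Submodule.smul_mem _ _ hself)

/-- An invariant subspace `A` that is not orthogonal to `C` contains an odd weight vector, outside
of the orthogonal complement of `C`, that `C` maps into the largest invariant subspace orthogonal
to `C`. -/
theorem exists_odd_weight [FiniteDimensional ℂ g] (hL : L.IsSolvable) (hC : L.IsStableOdd C)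
    {A : Submodule ℂ g} (hA : L.IsInvariant C A) (hAo : ¬ A ≤ L.orth lam C)
    (hAC : ∀ a ∈ A, a ∈ L.part 1 → a ∈ C) :
    ∃ ξ ∈ A, ξ ∈ C ∧ ξ ∉ L.orth lam C ∧ (∀ c ∈ C, L.bracket c ξ ∈ L.maxInvariant lam C) ∧
      ∃ α : Module.Dual ℂ g, ∀ x ∈ L.part 0, L.bracket x ξ - α x • ξ ∈ L.maxInvariant lam C := by
  set M := L.maxInvariant lam C with hMdef
  have hM : L.IsInvariant C M := maxInvariant_invariant _ _
  have hMo : M ≤ L.orth lam C := maxInvariant_le _ _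
  obtain ⟨I, ⟨hI, hIA, hIo⟩, hImin⟩ := IsArtinian.set_has_minimal
    {I : Submodule ℂ g | L.IsInvariant C I ∧ I ≤ A ∧ ¬ I ≤ L.orth lam C} ⟨A, hA, le_rfl, hAo⟩
  have hmin : ∀ I', L.IsInvariant C I' → I' ≤ I → ¬ I' ≤ M → I' = I := by
    intro I' hI' hle hnot
    by_contra hne
    refine hImin I' ⟨hI', hle.trans hIA, fun h => hnot (le_maxInvariant hI' h)⟩
      (lt_of_le_of_ne hle hne)
  have hkill := relDerived_one_bracket_mem hL hC hI hM hMo hIo hmin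
  have hIM : ¬ I ≤ M := fun h => hIo (h.trans hMo)
  -- Modulo the derived algebra `c` supercommutes with `g₀ ⊕ C`, so its kernel on `I` modulo `M` is
  -- invariant. As `[c, [c, m]] = ½ [[c, c], m]` lies in `M`, a kernel inside `M` would force `I ≤
  -- M`. By minimality the kernel is `I`.
  have hcI : ∀ c ∈ C, ∀ m ∈ I, L.bracket c m ∈ M := by
    intro c hc
    have hc' : c ∈ L.part 0 ⊔ C := Submodule.mem_sup_right hc
    have hinv : L.IsInvariant C (L.annihilatorIn (ℂ ∙ c) I M) := by
      have mem : ∀ m, m ∈ L.annihilatorIn (ℂ ∙ c) I M ↔ m ∈ I ∧ L.bracket c m ∈ M := by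
        refine fun m => and_congr_right fun _ => ⟨fun h => h c (Submodule.mem_span_singleton_self c),
          fun h a ha => ?_⟩
        obtain ⟨t, rfl⟩ := Submodule.mem_span_singleton.1 ha
        rw [map_smul, LinearMap.smul_apply]
        exact M.smul_mem t h
      refine ⟨?_, ?_, ?_⟩
      · intro m hm
        rw [mem] at hm ⊢
        refine ⟨hI.parity m hm.1, ?_⟩
        have h := hM.parity _ hm.2
        rw [L.parity_bracket, L.parity_odd (hC.le hc), map_neg, LinearMap.neg_apply] at h
        simpa using h
      · intro x hx m hm
        rw [mem] at hm ⊢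
        refine ⟨hI.even x hx m hm.1, ?_⟩
        rw [eq_sub_of_add_eq' (L.jacobi_even hx c m).symm]
        exact M.sub_mem (hM.even x hx _ hm.2)
          (hkill _ (L.bracket_mem_commutator (Submodule.mem_sup_left hx) hc') m hm.1)
      · intro y hy m hm
        rw [mem] at hm ⊢
        refine ⟨hI.odd y hy m hm.1, ?_⟩
        rw [eq_sub_of_add_eq (L.jacobi_odd_odd (hC.le hc) (hC.le hy) m).symm]
        exact M.sub_mem (hkill _ (L.bracket_mem_commutator hc' (Submodule.mem_sup_right hy)) m hm.1)
          (hM.odd y hy _ hm.2)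
    have heq := hmin _ hinv (annihilatorIn_le _ _ _) (by
      intro hle
      refine hIM fun m hm => ?_
      refine hle ⟨hm, fun a ha => ?_⟩
      obtain ⟨t, rfl⟩ := Submodule.mem_span_singleton.1 ha
      rw [map_smul, LinearMap.smul_apply]
      refine M.smul_mem t (hle ⟨hI.odd c hc m hm, fun a ha => ?_⟩)
      obtain ⟨t, rfl⟩ := Submodule.mem_span_singleton.1 ha
      rw [map_smul, LinearMap.smul_apply]
      refine M.smul_mem t ?_
      have h := hkill _ (L.bracket_mem_commutator hc' hc') m hm
      rw [L.jacobi_odd_odd (hC.le hc) (hC.le hc), ← two_smul ℂ] at h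
      exact (M.smul_mem_iff two_ne_zero).1 h)
    intro m hm
    rw [← heq] at hm
    exact hm.2 c (Submodule.mem_span_singleton_self c)
  have hI1 : ¬ I ⊓ L.part 1 ≤ M := by
    intro h
    refine hIo fun m hm => ?_
    rw [← L.evenProj_add_oddProj m]
    exact (L.orth lam C).add_mem (even_le_orth (L.evenProj_mem m))
      (hMo (h ⟨hI.oddProj_mem hm, L.oddProj_mem m⟩))
  obtain ⟨ξ, ⟨hξI, hξ1⟩, hξM, α, -, hα⟩ := hL.exists_weight hM.even
    (C := I ⊓ L.part 1) (fun x hx a ha => ⟨hI.even x hx a ha.1, L.bracket_even_odd hx ha.2⟩) hI1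
  -- If `ξ` were orthogonal to `C`, then `M + ℂ ξ` would be an invariant subspace orthogonal to `C`,
  -- against the maximality of `M`.
  refine ⟨ξ, hIA hξI, hAC ξ (hIA hξI) hξ1, fun hξo => hξM ?_, fun c hc => hcI c hc ξ hξI, α, hα⟩
  have hinv := hM.sup_span hξ1 (fun c hc => hcI c hc ξ hξI) hα
  exact le_maxInvariant hinv (sup_le hMo ((Submodule.span_singleton_le_iff_mem _ _).2 hξo))
    (Submodule.mem_sup_right (Submodule.mem_span_singleton_self ξ))

end LieSuperalgebra

/-! ### Existence of an isotropic weight vector -/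

namespace LieSuperalgebra

variable {g : Type*} [AddCommGroup g] [Module ℂ g] {L : LieSuperalgebra g}
variable {lam : L.evenCharacters} {C : Submodule ℂ g}

theorem form_symm_odd {x : g} (hx : x ∈ L.part 1) (y : g) :
    (lam : Module.Dual ℂ g) (L.bracket x y) = (lam : Module.Dual ℂ g) (L.bracket y x) := by
  refine L.homogeneous_ext (f := (lam : Module.Dual ℂ g) ∘ₗ L.bracket x)
    (f' := (lam : Module.Dual ℂ g) ∘ₗ L.bracket.flip x) (fun y hy => ?_) (fun y hy => ?_) y
  · simp [evenCharacters_bracket_even lam hy, evenCharacters_bracket_even' lam hy]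
  · simp [L.symm_odd hx hy]

/-- A weight vector that is not isotropic has weight zero. -/
theorem weight_eq_zero_of_anisotropic (hC : L.IsStableOdd C) {ξ : g} (hξ : ξ ∈ C)
    (hne : (lam : Module.Dual ℂ g) (L.bracket ξ ξ) ≠ 0) {α : Module.Dual ℂ g}
    (hα : ∀ x ∈ L.part 0, L.bracket x ξ - α x • ξ ∈ L.orth lam C) {x : g} (hx : x ∈ L.part 0) :
    α x = 0 := by
  have h1 := hα x hx ξ hξ
  -- Invariance and symmetry make `λ([ξ, [x, ξ]])` its own negative, while `h1` makes it equal to `α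
  -- x * λ([ξ, ξ])`.
  have h2 := evenCharacters_invariant lam hx ξ ξ
  rw [← form_symm_odd (hC.le hξ)] at h2
  have h3 : (lam : Module.Dual ℂ g) (L.bracket ξ (L.bracket x ξ)) = 0 := self_eq_neg.1 h2
  rw [map_sub, map_sub, h3, map_smul, map_smul, zero_sub, neg_eq_zero, smul_eq_mul] at h1
  exact (mul_eq_zero.1 h1).resolve_right hne

/-- The orthogonal complement of a weight vector of weight zero that `C` maps into the largest
invariant subspace is invariant. -/
theorem orth_singleton_invariant (hC : L.IsStableOdd C) {ξ : g} (hξ : ξ ∈ C)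
    (hev : ∀ x ∈ L.part 0, L.bracket x ξ ∈ L.maxInvariant lam C)
    (hodd : ∀ c ∈ C, L.bracket c ξ ∈ L.maxInvariant lam C) :
    L.IsInvariant C ((L.part 0 ⊔ C) ⊓ L.orth lam (ℂ ∙ ξ)) := by
  have hM := maxInvariant_invariant (L := L) lam C
  have hk := hC.sup_invariant
  have mem : ∀ m, m ∈ L.orth (lam : Module.Dual ℂ g) (ℂ ∙ ξ) ↔
      (lam : Module.Dual ℂ g) (L.bracket ξ m) = 0 := by
    refine fun m => ⟨fun h => h ξ (Submodule.mem_span_singleton_self ξ), fun h a ha => ?_⟩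
    obtain ⟨t, rfl⟩ := Submodule.mem_span_singleton.1 ha
    simp [h]
  have hzero : ∀ u ∈ L.maxInvariant lam C, u ∈ L.part 1 → ∀ m ∈ L.part 0 ⊔ C,
      (lam : Module.Dual ℂ g) (L.bracket u m) = 0 := by
    intro u hu hu1 m hm
    obtain ⟨x, hx, c, hc, rfl⟩ := Submodule.mem_sup.1 hm
    rw [map_add, map_add, evenCharacters_bracket_even' lam hx, zero_add, form_symm_odd hu1]
    exact maxInvariant_le _ _ hu c hc
  refine ⟨?_, ?_, ?_⟩
  · rintro m ⟨hm, ho⟩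
    refine ⟨hk.parity m hm, (mem _).2 ?_⟩
    obtain ⟨x, hx, c, hc, rfl⟩ := Submodule.mem_sup.1 hm
    have ho := (mem _).1 ho
    rw [map_add, map_add, evenCharacters_bracket_even' lam hx, zero_add] at ho
    rw [map_add, L.parity_even hx, L.parity_odd (hC.le hc), map_add, map_add, map_neg, map_neg,
      evenCharacters_bracket_even' lam hx, ho]
    simp
  · rintro x hx m ⟨hm, ho⟩
    refine ⟨hk.even x hx m hm, (mem _).2 ?_⟩
    have h := evenCharacters_invariant lam hx ξ m
    rw [hzero _ (hev x hx) (L.bracket_even_odd hx (hC.le hξ)) m hm] at h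
    exact neg_eq_zero.1 h.symm
  · rintro c hc m ⟨hm, ho⟩
    refine ⟨hk.odd c hc m hm, (mem _).2 ?_⟩
    have h := congrArg (lam : Module.Dual ℂ g) (L.jacobi_odd_odd (hC.le hξ) (hC.le hc) m)
    rw [evenCharacters_bracket_even lam (L.bracket_odd_odd (hC.le hξ) (hC.le hc)), map_add] at h
    obtain ⟨x, hx, d, hd, rfl⟩ := Submodule.mem_sup.1 hm
    have h2 : L.bracket ξ (x + d) ∈ L.maxInvariant lam C := by
      rw [map_add, L.symm_odd (hC.le hξ) (hC.le hd), ← neg_eq_iff_eq_neg.2 (L.skew_even_left hx ξ)]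
      exact Submodule.add_mem _ (Submodule.neg_mem _ (hev x hx)) (hodd d hd)
    rw [maxInvariant_le _ _ h2 c hc, add_zero] at h
    exact h.symm

/-- Either the form has rank at most one on `C`, or there is an isotropic weight vector outside of
the radical that `C` maps into the largest invariant subspace orthogonal to `C`. -/
theorem exists_isotropic_weight [FiniteDimensional ℂ g] (hL : L.IsSolvable) (hC : L.IsStableOdd C)
    (hCo : ¬ C ≤ L.orth lam C) :
    (∃ ζ ∈ C, (lam : Module.Dual ℂ g) (L.bracket ζ ζ) ≠ 0 ∧
      ∀ c ∈ C, (lam : Module.Dual ℂ g) (L.bracket ζ c) = 0 → c ∈ L.orth lam C) ∨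
    ∃ ξ ∈ C, ξ ∉ L.orth lam C ∧ (lam : Module.Dual ℂ g) (L.bracket ξ ξ) = 0 ∧
      (∀ c ∈ C, L.bracket c ξ ∈ L.maxInvariant lam C) ∧
      ∃ α : Module.Dual ℂ g, ∀ x ∈ L.part 0, L.bracket x ξ - α x • ξ ∈ L.maxInvariant lam C := by
  have hk1 : ∀ a ∈ L.part 0 ⊔ C, a ∈ L.part 1 → a ∈ C := fun a => mem_of_mem_sup_of_odd hC
  obtain ⟨ξ₀, -, hξ₀, hξ₀o, hodd₀, α₀, hα₀⟩ := exists_odd_weight hL hC hC.sup_invariant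
    (fun h => hCo (le_sup_right.trans h)) hk1
  by_cases h0 : (lam : Module.Dual ℂ g) (L.bracket ξ₀ ξ₀) = 0
  · exact Or.inr ⟨ξ₀, hξ₀, hξ₀o, h0, hodd₀, α₀, hα₀⟩
  have hev : ∀ ξ ∈ C, (lam : Module.Dual ℂ g) (L.bracket ξ ξ) ≠ 0 → ∀ α : Module.Dual ℂ g,
      (∀ x ∈ L.part 0, L.bracket x ξ - α x • ξ ∈ L.maxInvariant lam C) →
      ∀ x ∈ L.part 0, L.bracket x ξ ∈ L.maxInvariant lam C := by
    intro ξ hξ hne α hα x hx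
    have h := weight_eq_zero_of_anisotropic hC hξ hne (fun x hx => maxInvariant_le _ _ (hα x hx)) hx
    simpa [h] using hα x hx
  have hev₀ := hev ξ₀ hξ₀ h0 α₀ hα₀
  -- An anisotropic weight vector has weight zero, so its orthogonal complement is invariant. Either
  -- this complement is orthogonal to `C`, and the form has rank one, or it contains a second weight
  -- vector.
  by_cases hA : (L.part 0 ⊔ C) ⊓ L.orth lam (ℂ ∙ ξ₀) ≤ L.orth lam C
  · refine Or.inl ⟨ξ₀, hξ₀, h0, fun c hc h => hA ⟨Submodule.mem_sup_right hc, fun a ha => ?_⟩⟩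
    obtain ⟨t, rfl⟩ := Submodule.mem_span_singleton.1 ha
    simp [h]
  right
  obtain ⟨ξ₁, ⟨-, hξ₁A⟩, hξ₁, hξ₁o, hodd₁, α₁, hα₁⟩ := exists_odd_weight hL hC
    (orth_singleton_invariant hC hξ₀ hev₀ hodd₀) hA (fun a ha => hk1 a ha.1)
  by_cases h1 : (lam : Module.Dual ℂ g) (L.bracket ξ₁ ξ₁) = 0
  · exact ⟨ξ₁, hξ₁, hξ₁o, h1, hodd₁, α₁, hα₁⟩
  have hev₁ := hev ξ₁ hξ₁ h1 α₁ hα₁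
  have h01 : (lam : Module.Dual ℂ g) (L.bracket ξ₀ ξ₁) = 0 :=
    hξ₁A ξ₀ (Submodule.mem_span_singleton_self ξ₀)
  have h10 : (lam : Module.Dual ℂ g) (L.bracket ξ₁ ξ₀) = 0 := by
    rw [form_symm_odd (hC.le hξ₁), h01]
  -- Two orthogonal anisotropic vectors of weight zero: with this `t`, the combination `ξ₀ + t ξ₁`
  -- is isotropic and still has weight zero.
  obtain ⟨t, ht⟩ := IsAlgClosed.exists_pow_nat_eq (-(lam : Module.Dual ℂ g) (L.bracket ξ₀ ξ₀) /
    (lam : Module.Dual ℂ g) (L.bracket ξ₁ ξ₁)) (n := 2) two_pos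
  refine ⟨ξ₀ + t • ξ₁, C.add_mem hξ₀ (C.smul_mem t hξ₁), fun h => h0 ?_, ?_, fun c hc => ?_, 0,
    fun x hx => ?_⟩
  · have := h ξ₀ hξ₀
    simpa [h01] using this
  · have : (lam : Module.Dual ℂ g) (L.bracket ξ₀ ξ₀) +
        t ^ 2 * (lam : Module.Dual ℂ g) (L.bracket ξ₁ ξ₁) = 0 := by
      rw [ht]; field_simp; ring
    simp only [map_add, map_smul, LinearMap.add_apply, LinearMap.smul_apply, smul_eq_mul, h01, h10]
    linear_combination this
  · rw [map_add, map_smul]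
    exact Submodule.add_mem _ (hodd₀ c hc) (Submodule.smul_mem _ _ (hodd₁ c hc))
  · simp only [LinearMap.zero_apply, zero_smul, sub_zero, map_add, map_smul]
    exact Submodule.add_mem _ (hev₀ x hx) (Submodule.smul_mem _ _ (hev₁ x hx))

/-! # Traces on stable subspaces -/

theorem exists_isProj (A : Submodule ℂ g) : ∃ p : Module.End ℂ g, LinearMap.IsProj A p := by
  obtain ⟨q, hq⟩ := A.subtype.exists_leftInverse_of_injective A.ker_subtype
  exact ⟨A.subtype ∘ₗ q, fun x => (q x).2, fun x hx =>
    congrArg Subtype.val (LinearMap.congr_fun hq ⟨x, hx⟩)⟩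

/-- The trace of `ad x` on a subspace `A`, as a functional of `x`. -/
def adTrace (L : LieSuperalgebra g) (A : Submodule ℂ g) : Module.Dual ℂ g :=
  LinearMap.trace ℂ g ∘ₗ LinearMap.lcomp ℂ g (exists_isProj A).choose ∘ₗ L.bracket

/-- Both sides are the trace of `T` on `A`, since `C / A` contributes nothing when `T` maps `C` into
`A`. For `A = C` this makes the trace independent of the projection chosen in `adTrace`. -/
theorem trace_comp_isProj [FiniteDimensional ℂ g] {A C : Submodule ℂ g} (hAC : A ≤ C)
    {T p q : Module.End ℂ g} (hT : ∀ c ∈ C, T c ∈ A) (hp : LinearMap.IsProj A p)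
    (hq : LinearMap.IsProj C q) : LinearMap.trace ℂ g (T * q) = LinearMap.trace ℂ g (T * p) := by
  have h1 : T * q = p * (T * q) := by
    ext v; exact (hp.map_id _ (hT _ (hq.map_mem v))).symm
  have h2 : T * q * p = T * p := by
    ext v; exact congrArg T (hq.map_id _ (hAC (hp.map_mem v)))
  rw [h1, LinearMap.trace_mul_comm, h2]

theorem adTrace_apply [FiniteDimensional ℂ g] {A C : Submodule ℂ g} (hAC : A ≤ C) {x : g}
    (hx : ∀ c ∈ C, L.bracket x c ∈ A) {p : Module.End ℂ g} (hp : LinearMap.IsProj A p) :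
    L.adTrace C x = LinearMap.trace ℂ g (L.bracket x * p) :=
  trace_comp_isProj hAC hx hp (exists_isProj C).choose_spec

theorem adTrace_eq_of_bracket_mem [FiniteDimensional ℂ g] {A C : Submodule ℂ g} (hAC : A ≤ C)
    {x : g} (hx : ∀ c ∈ C, L.bracket x c ∈ A) : L.adTrace C x = L.adTrace A x := by
  obtain ⟨p, hp⟩ := exists_isProj A
  rw [adTrace_apply hAC hx hp, adTrace_apply le_rfl (fun c hc => hx c (hAC hc)) hp]

/-- The line of `ξ` modulo `A` contributes its eigenvalue `a`. Since `φ` is the coordinate along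
`ξ`, a projection onto `C` is one onto `A` plus a rank-one operator, whose trace is explicit. -/
theorem adTrace_extend [FiniteDimensional ℂ g] {A C : Submodule ℂ g} (hAC : A ≤ C) {x ξ : g}
    {φ : Module.Dual ℂ g} {a : ℂ} (hξ : ξ ∈ C) (hφA : ∀ v ∈ A, φ v = 0) (hφξ : φ ξ = 1)
    (hC : ∀ c ∈ C, c - φ c • ξ ∈ A) (hx : ∀ c ∈ A, L.bracket x c ∈ A)
    (hxξ : L.bracket x ξ - a • ξ ∈ A) : L.adTrace C x = L.adTrace A x + a := by
  obtain ⟨p, hp⟩ := exists_isProj A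
  have hxC : ∀ c ∈ C, L.bracket x c ∈ C := by
    intro c hc
    have h1 := hx _ (hC c hc)
    rw [map_sub, map_smul] at h1
    have h2 : L.bracket x ξ ∈ C := by
      rw [← sub_add_cancel (L.bracket x ξ) (a • ξ)]
      exact C.add_mem (hAC hxξ) (C.smul_mem _ hξ)
    rw [← sub_add_cancel (L.bracket x c) (φ c • L.bracket x ξ)]
    exact C.add_mem (hAC h1) (C.smul_mem _ h2)
  have hq : LinearMap.IsProj C (p + LinearMap.smulRight φ (ξ - p ξ)) := by
    refine ⟨fun v => ?_, fun c hc => ?_⟩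
    · exact C.add_mem (hAC (hp.map_mem v)) (C.smul_mem _ (C.sub_mem hξ (hAC (hp.map_mem ξ))))
    · have h := hp.map_id _ (hC c hc)
      rw [map_sub, map_smul] at h
      simp only [LinearMap.add_apply, LinearMap.smulRight_apply, smul_sub]
      rw [← sub_eq_zero] at h ⊢
      rw [← h]; abel
  rw [adTrace_apply le_rfl hxC hq, adTrace_apply le_rfl hx hp, mul_add, map_add]
  congr 1
  have : L.bracket x * LinearMap.smulRight φ (ξ - p ξ) =
      LinearMap.smulRight φ (L.bracket x (ξ - p ξ)) := by
    ext v; simp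
  rw [this, LinearMap.trace_smulRight, map_sub, map_sub, hφA _ (hx _ (hp.map_mem ξ)), sub_zero]
  have h := hφA _ hxξ
  rw [map_sub, map_smul, hφξ, smul_eq_mul, mul_one] at h
  exact sub_eq_zero.1 h

/-- The map `1 - p` descends to a section of the quotient map; cyclicity of the trace carries the
operator on `g ⧸ A` to `T (1 - p)` on `g`. -/
theorem trace_mapQ [FiniteDimensional ℂ g] {A : Submodule ℂ g} {T p : Module.End ℂ g}
    (hT : A ≤ A.comap T) (hp : LinearMap.IsProj A p) :
    LinearMap.trace ℂ (g ⧸ A) (A.mapQ A T hT) =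
      LinearMap.trace ℂ g T - LinearMap.trace ℂ g (T * p) := by
  have hker : A ≤ LinearMap.ker (LinearMap.id - p) := fun v hv => by
    simp [hp.map_id v hv]
  have h1 : A.mapQ A T hT = A.mkQ ∘ₗ (T ∘ₗ A.liftQ (LinearMap.id - p) hker) := by
    apply Submodule.linearMap_qext
    ext v
    have : A.mkQ (T (p v)) = 0 := (Submodule.Quotient.mk_eq_zero _).2 (hT (hp.map_mem v))
    simp only [LinearMap.comp_apply, Submodule.mapQ_apply, Submodule.liftQ_apply,
      LinearMap.sub_apply, LinearMap.id_apply, map_sub, this, sub_zero, Submodule.mkQ_apply]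
  have h2 : (T ∘ₗ A.liftQ (LinearMap.id - p) hker) ∘ₗ A.mkQ = T - T * p := by
    ext v; simp
  rw [h1, LinearMap.trace_comp_comm', h2, map_sub]

end LieSuperalgebra

namespace LieSuperalgebra

variable {g : Type*} [AddCommGroup g] [Module ℂ g]

/-! # Representations of the subsuperalgebra generated by the even part and an odd subspace -/

/-- A representation in `V` of the subsuperalgebra of `L` formed by the even part and the odd
subspace `B`. The values of `act` on the other elements of `g` are irrelevant. -/
structure RelRep (L : LieSuperalgebra g) (B : Submodule ℂ g) (V : Type*) [AddCommGroup V]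
    [Module ℂ V] where
  parity : V →ₗ[ℂ] V
  parity_parity : ∀ v, parity (parity v) = v
  act : g →ₗ[ℂ] Module.End ℂ V
  parity_even : ∀ x ∈ L.part 0, ∀ v, parity (act x v) = act x (parity v)
  parity_odd : ∀ b ∈ B, ∀ v, parity (act b v) = -act b (parity v)
  even_even : ∀ x ∈ L.part 0, ∀ y ∈ L.part 0, ∀ v,
    act (L.bracket x y) v = act x (act y v) - act y (act x v)
  even_odd : ∀ x ∈ L.part 0, ∀ b ∈ B, ∀ v,
    act (L.bracket x b) v = act x (act b v) - act b (act x v)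
  odd_odd : ∀ b ∈ B, ∀ c ∈ B, ∀ v,
    act (L.bracket b c) v = act b (act c v) + act c (act b v)

/-- The data for the induction from `B` to an odd subspace `C` in which `B` is a hyperplane. -/
structure Extension (L : LieSuperalgebra g) (B C : Submodule ℂ g) (ζ : g) (φ : Module.Dual ℂ g) :
    Prop where
  stableB : L.IsStableOdd B
  stableC : L.IsStableOdd C
  le : B ≤ C
  mem : ζ ∈ C
  even : ∀ x ∈ L.part 0, φ x = 0
  zero : ∀ b ∈ B, φ b = 0
  one : φ ζ = 1
  sub_mem : ∀ c ∈ C, c - φ c • ζ ∈ B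
  -- Even commutators of odd elements have weight zero on `C / B`, so the half-trace twist of the
  -- induced representation does not disturb the relations between odd operators.
  weight : ∀ c ∈ C, ∀ d ∈ C, φ (L.bracket (L.bracket c d) ζ) = 0

variable {L : LieSuperalgebra g} {B C : Submodule ℂ g} {ζ : g} {φ : Module.Dual ℂ g}
variable {S : Type*} [AddCommGroup S] [Module ℂ S]

namespace RelRep

variable (R : RelRep L B S)

/-- The operators of the twisted induced representation in `S × S = S ⊕ ζ S`. -/
def extendAct (ζ : g) (φ : Module.Dual ℂ g) : g →ₗ[ℂ] Module.End ℂ (S × S) :=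
  -- A pair `(s, t)` stands for `s + ζ t`. The element `y` is split into its even part, a part in
  -- `B` and `φ y • ζ`, and each is moved past `ζ`, with `ζ ζ = ½ [ζ, ζ]`. Half the weight of `ζ` is
  -- subtracted on `S`; moving past `ζ` adds the full weight, which leaves `+ ½` on `ζ S`.
  LinearMap.mk₂ ℂ (fun y v =>
    (R.act (L.evenProj y) v.1 - ((1 / 2 : ℂ) * φ (L.bracket (L.evenProj y) ζ)) • v.1 +
      R.act (L.oddProj y - φ y • ζ) v.1 +
      R.act (L.bracket (L.evenProj y) ζ - φ (L.bracket (L.evenProj y) ζ) • ζ) v.2 +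
      R.act (L.bracket (L.oddProj y - φ y • ζ) ζ) v.2 +
      ((1 / 2 : ℂ) * φ y) • R.act (L.bracket ζ ζ) v.2,
     R.act (L.evenProj y) v.2 + ((1 / 2 : ℂ) * φ (L.bracket (L.evenProj y) ζ)) • v.2 -
      R.act (L.oddProj y - φ y • ζ) v.2 + φ y • v.1))
    (fun y y' v => by
      ext <;> simp only [map_add, LinearMap.add_apply, map_sub, LinearMap.sub_apply, map_smul,
        LinearMap.smul_apply, Prod.fst_add, Prod.snd_add, add_smul, mul_add] <;> abel)
    (fun c y v => by
      ext <;> simp only [map_sub, LinearMap.sub_apply, map_smul,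
        LinearMap.smul_apply, Prod.smul_fst, Prod.smul_snd, smul_eq_mul] <;> module)
    (fun y v v' => by
      ext <;> simp only [map_add, Prod.fst_add, Prod.snd_add, smul_add] <;> abel)
    (fun c y v => by
      ext <;> simp only [map_smul, Prod.smul_fst, Prod.smul_snd] <;> module)

variable {R}

theorem extendAct_even (h : Extension L B C ζ φ) {x : g} (hx : x ∈ L.part 0) (v : S × S) :
    R.extendAct ζ φ x v = (R.act x v.1 - ((1 / 2 : ℂ) * φ (L.bracket x ζ)) • v.1 +
      R.act (L.bracket x ζ - φ (L.bracket x ζ) • ζ) v.2,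
      R.act x v.2 + ((1 / 2 : ℂ) * φ (L.bracket x ζ)) • v.2) := by
  simp [extendAct, L.evenProj_of_even hx, L.oddProj_of_even hx, h.even x hx]

theorem extendAct_odd (h : Extension L B C ζ φ) {b : g} (hb : b ∈ B) (v : S × S) :
    R.extendAct ζ φ b v = (R.act b v.1 + R.act (L.bracket b ζ) v.2, -R.act b v.2) := by
  have hb1 := h.stableB.le hb
  simp [extendAct, L.evenProj_of_odd hb1, L.oddProj_of_odd hb1, h.zero b hb]

theorem extendAct_self (h : Extension L B C ζ φ) (v : S × S) :
    R.extendAct ζ φ ζ v = ((1 / 2 : ℂ) • R.act (L.bracket ζ ζ) v.2, v.1) := by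
  have hb1 := h.stableC.le h.mem
  simp [extendAct, L.evenProj_of_odd hb1, L.oddProj_of_odd hb1, h.one]

end RelRep

theorem Extension.decomp (h : Extension L B C ζ φ) {c : g} (hc : c ∈ C) :
    ∃ b ∈ B, c = b + φ c • ζ := ⟨_, h.sub_mem c hc, by simp⟩

/-- Modulo `B` the bracket `[y, ζ]` is `φ([y, ζ]) ζ`, and `φ` kills `[x, B] ⊆ B`. -/
theorem Extension.weight_even (h : Extension L B C ζ φ) {x y : g} (hx : x ∈ L.part 0)
    (hy : y ∈ L.part 0) : φ (L.bracket x (L.bracket y ζ)) =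
      φ (L.bracket y ζ) * φ (L.bracket x ζ) := by
  obtain ⟨b, hb, hbe⟩ := h.decomp (h.stableC.bracket_mem y hy ζ h.mem)
  conv_lhs => rw [hbe]
  rw [map_add, map_add, h.zero _ (h.stableB.bracket_mem x hx b hb)]
  simp

namespace RelRep

variable (R : RelRep L B S)

/-- The twisted induced representation. -/
def extend (h : Extension L B C ζ φ) : RelRep L C (S × S) where
  parity := LinearMap.prodMap R.parity (-R.parity)
  parity_parity v := by ext <;> simp [R.parity_parity]
  act := R.extendAct ζ φ
  parity_even x hx v := by
    have hb := h.sub_mem _ (h.stableC.bracket_mem x hx ζ h.mem)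
    rw [extendAct_even h hx, extendAct_even h hx]
    ext
    · simp only [LinearMap.prodMap_apply, LinearMap.neg_apply, map_add, map_sub (R.parity),
        R.parity_even x hx, R.parity_odd _ hb, map_smul, map_neg]
    · simp only [LinearMap.prodMap_apply, LinearMap.neg_apply, map_add (R.parity),
        R.parity_even x hx, map_smul, map_neg]
      module
  parity_odd c hc v := by
    have key : ∀ b ∈ B, LinearMap.prodMap R.parity (-R.parity) (R.extendAct ζ φ b v) =
        -R.extendAct ζ φ b (LinearMap.prodMap R.parity (-R.parity) v) := by
      intro b hb
      have hbζ := L.bracket_odd_odd (h.stableB.le hb) (h.stableC.le h.mem)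
      rw [extendAct_odd h hb, extendAct_odd h hb]
      ext
      · simp only [LinearMap.prodMap_apply, LinearMap.neg_apply, map_add,
          R.parity_odd b hb, R.parity_even _ hbζ, map_neg, Prod.fst_neg]
        abel
      · simp only [LinearMap.prodMap_apply, LinearMap.neg_apply,
          R.parity_odd b hb, map_neg, Prod.snd_neg]
    have key2 : LinearMap.prodMap R.parity (-R.parity) (R.extendAct ζ φ ζ v) =
        -R.extendAct ζ φ ζ (LinearMap.prodMap R.parity (-R.parity) v) := by
      have hζζ := L.bracket_odd_odd (h.stableC.le h.mem) (h.stableC.le h.mem)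
      rw [extendAct_self h, extendAct_self h]
      ext
      · simp [R.parity_even _ hζζ]
      · simp
    obtain ⟨b, hb, hbe⟩ := h.decomp hc
    rw [hbe, map_add, map_smul, LinearMap.add_apply, LinearMap.smul_apply, map_add, map_smul,
      key b hb, key2, LinearMap.add_apply, LinearMap.smul_apply]
    module
  even_even x hx y hy v := by
    have hbx := h.sub_mem _ (h.stableC.bracket_mem x hx ζ h.mem)
    have hby := h.sub_mem _ (h.stableC.bracket_mem y hy ζ h.mem)
    have hw : φ (L.bracket (L.bracket x y) ζ) = 0 := by
      rw [eq_sub_of_add_eq (L.jacobi_even hx y ζ).symm, map_sub, h.weight_even hx hy,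
        h.weight_even hy hx]
      ring
    have e1 : L.bracket (L.bracket x y) ζ =
        (L.bracket x (L.bracket y ζ - φ (L.bracket y ζ) • ζ) -
        L.bracket y (L.bracket x ζ - φ (L.bracket x ζ) • ζ)) +
        φ (L.bracket y ζ) • (L.bracket x ζ - φ (L.bracket x ζ) • ζ) -
        φ (L.bracket x ζ) • (L.bracket y ζ - φ (L.bracket y ζ) • ζ) := by
      rw [eq_sub_of_add_eq (L.jacobi_even hx y ζ).symm]
      simp only [map_sub, map_smul]
      module
    have e2 := R.even_odd x hx _ hby v.2
    have e3 := R.even_odd y hy _ hbx v.2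
    rw [extendAct_even h (L.bracket_even_even hx hy), extendAct_even h hx, extendAct_even h hy,
      extendAct_even h hx, extendAct_even h hy, hw, e1]
    ext
    · simp only [R.even_even x hx y hy, Prod.fst_sub, map_add, map_sub (R.act _), map_smul (R.act _),
        mul_zero, zero_smul, sub_zero]
      rw [map_sub R.act, map_add R.act, map_sub R.act, map_smul R.act, map_smul R.act]
      simp only [LinearMap.sub_apply, LinearMap.add_apply, LinearMap.smul_apply]
      rw [e2, e3]
      module
    · simp only [R.even_even x hx y hy, Prod.snd_sub, map_add, map_smul (R.act _),
        mul_zero, zero_smul, add_zero]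
      module
  even_odd x hx c hc v := by
    have hx' := h.sub_mem _ (h.stableC.bracket_mem x hx ζ h.mem)
    have key : ∀ b ∈ B, R.extendAct ζ φ (L.bracket x b) v =
        R.extendAct ζ φ x (R.extendAct ζ φ b v) - R.extendAct ζ φ b (R.extendAct ζ φ x v) := by
      intro b hb
      have hxb := h.stableB.bracket_mem x hx b hb
      have hbζ := L.bracket_odd_odd (h.stableB.le hb) (h.stableC.le h.mem)
      have e1 : L.bracket (L.bracket x b) ζ = L.bracket x (L.bracket b ζ) -
          L.bracket b (L.bracket x ζ - φ (L.bracket x ζ) • ζ) - φ (L.bracket x ζ) • L.bracket b ζ := by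
        rw [eq_sub_of_add_eq (L.jacobi_even hx b ζ).symm]
        simp only [map_sub, map_smul]
        abel
      rw [extendAct_odd h hxb, extendAct_even h hx, extendAct_odd h hb, extendAct_odd h hb,
        extendAct_even h hx, e1]
      ext
      · simp only [Prod.fst_sub, map_add, map_sub (R.act _), map_smul (R.act _), map_neg]
        rw [map_sub R.act, map_sub R.act, map_smul R.act]
        simp only [LinearMap.sub_apply, LinearMap.smul_apply]
        rw [R.even_even x hx _ hbζ, R.even_odd x hx b hb, R.odd_odd b hb _ hx']
        module
      · simp only [Prod.snd_sub, map_add, map_smul (R.act _), map_neg]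
        rw [R.even_odd x hx b hb]
        module
    have key2 : R.extendAct ζ φ (L.bracket x ζ) v =
        R.extendAct ζ φ x (R.extendAct ζ φ ζ v) - R.extendAct ζ φ ζ (R.extendAct ζ φ x v) := by
      have hζ1 := h.stableC.le h.mem
      have hζζ := L.bracket_odd_odd hζ1 hζ1
      have hdec : L.bracket x ζ = (L.bracket x ζ - φ (L.bracket x ζ) • ζ) + φ (L.bracket x ζ) • ζ := by
        abel
      have e1 : L.bracket x (L.bracket ζ ζ) =
          (2 : ℂ) • L.bracket (L.bracket x ζ - φ (L.bracket x ζ) • ζ) ζ +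
            (2 * φ (L.bracket x ζ)) • L.bracket ζ ζ := by
        rw [L.jacobi_even hx, L.symm_odd hζ1 (L.bracket_even_odd hx hζ1)]
        simp only [map_sub, map_smul, LinearMap.sub_apply, LinearMap.smul_apply]
        module
      have e2 := R.even_even x hx _ hζζ v.2
      rw [e1, map_add R.act, map_smul R.act, map_smul R.act] at e2
      simp only [LinearMap.add_apply, LinearMap.smul_apply] at e2
      conv_lhs => rw [hdec]
      rw [map_add (R.extendAct ζ φ), map_smul (R.extendAct ζ φ), LinearMap.add_apply,
        LinearMap.smul_apply, extendAct_odd h hx',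
        extendAct_self h, extendAct_even h hx, extendAct_even h hx, extendAct_self h]
      ext
      · simp only [Prod.fst_sub, Prod.fst_add, Prod.smul_fst, map_add (R.act _), map_smul (R.act _)]
        rw [eq_add_of_sub_eq e2.symm]
        module
      · simp only [Prod.snd_sub, Prod.snd_add, Prod.smul_snd]
        module
    obtain ⟨b, hb, hbe⟩ := h.decomp hc
    rw [hbe]
    simp only [map_add, map_smul, LinearMap.add_apply, LinearMap.smul_apply]
    rw [key b hb, key2]
    module
  odd_odd c hc d hd v := by
    have hζ1 := h.stableC.le h.mem
    have hζζ := L.bracket_odd_odd hζ1 hζ1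
    have key : ∀ b ∈ B, ∀ b' ∈ B, R.extendAct ζ φ (L.bracket b b') v =
        R.extendAct ζ φ b (R.extendAct ζ φ b' v) + R.extendAct ζ φ b' (R.extendAct ζ φ b v) := by
      intro b hb b' hb'
      have hb1 := h.stableB.le hb
      have hb1' := h.stableB.le hb'
      have hw := h.weight b (h.le hb) b' (h.le hb')
      have hbb := L.bracket_odd_odd hb1 hb1'
      have hbζ := L.bracket_odd_odd hb1 hζ1
      have hbζ' := L.bracket_odd_odd hb1' hζ1
      have e1 : L.bracket (L.bracket b b') ζ =
          -L.bracket (L.bracket b' ζ) b - L.bracket (L.bracket b ζ) b' := by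
        rw [L.jacobi_odd_odd hb1 hb1', L.skew_even_left hbζ, L.skew_even_left hbζ']
        abel
      rw [extendAct_even h hbb, extendAct_odd h hb, extendAct_odd h hb', extendAct_odd h hb,
        extendAct_odd h hb', hw, zero_smul, sub_zero, e1]
      ext
      · simp only [Prod.fst_add, map_add (R.act _), map_neg (R.act _), R.odd_odd b hb b' hb']
        rw [map_sub R.act, map_neg R.act]
        simp only [LinearMap.sub_apply, LinearMap.neg_apply]
        rw [R.even_odd _ hbζ b' hb', R.even_odd _ hbζ' b hb]
        module
      · simp only [Prod.snd_add, map_neg (R.act _), R.odd_odd b hb b' hb']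
        module
    have key2 : ∀ b ∈ B, R.extendAct ζ φ (L.bracket b ζ) v =
        R.extendAct ζ φ b (R.extendAct ζ φ ζ v) + R.extendAct ζ φ ζ (R.extendAct ζ φ b v) := by
      intro b hb
      have hb1 := h.stableB.le hb
      have hw := h.weight b (h.le hb) ζ h.mem
      have hbζ := L.bracket_odd_odd hb1 hζ1
      have e1 : L.bracket (L.bracket b ζ) ζ = -((1 / 2 : ℂ) • L.bracket (L.bracket ζ ζ) b) := by
        rw [L.jacobi_odd_odd hζ1 hζ1, L.skew_even_left hbζ, L.symm_odd hb1 hζ1]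
        module
      rw [extendAct_even h hbζ, extendAct_self h, extendAct_self h, extendAct_odd h hb,
        extendAct_odd h hb, hw, zero_smul, sub_zero, e1]
      ext
      · simp only [Prod.fst_add, map_smul (R.act _), map_neg (R.act _)]
        rw [map_neg R.act, map_smul R.act]
        simp only [LinearMap.neg_apply, LinearMap.smul_apply]
        rw [R.even_odd _ hζζ b hb]
        module
      · simp only [Prod.snd_add]
        module
    have key3 : R.extendAct ζ φ (L.bracket ζ ζ) v = (2 : ℂ) • R.extendAct ζ φ ζ (R.extendAct ζ φ ζ v) := by
      have hw := h.weight ζ h.mem ζ h.mem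
      -- The Jacobi identity gives `2 [ζ, [ζ, ζ]]` for this bracket and skew-symmetry gives `-[ζ,
      -- [ζ, ζ]]`, so three times it is zero.
      have e1 : L.bracket (L.bracket ζ ζ) ζ = 0 := by
        have h1 := L.jacobi_odd_odd hζ1 hζ1 ζ
        have h2 := L.skew_even_left hζζ ζ
        have h3 : (3 : ℂ) • L.bracket (L.bracket ζ ζ) ζ = 0 := by
          have h4 : (3 : ℂ) • L.bracket (L.bracket ζ ζ) ζ =
            (L.bracket (L.bracket ζ ζ) ζ - (L.bracket ζ (L.bracket ζ ζ) +
              L.bracket ζ (L.bracket ζ ζ))) +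
            (2 : ℂ) • (L.bracket (L.bracket ζ ζ) ζ - -L.bracket ζ (L.bracket ζ ζ)) := by module
          rw [h4, sub_eq_zero.2 h1, sub_eq_zero.2 h2, smul_zero, add_zero]
        simpa using h3
      rw [extendAct_even h hζζ, extendAct_self h, extendAct_self h, hw, zero_smul, sub_zero, e1]
      ext
      · simp
      · simp
    obtain ⟨b, hb, hbe⟩ := h.decomp hc
    obtain ⟨b', hb', hbe'⟩ := h.decomp hd
    rw [hbe, hbe']
    simp only [map_add, map_smul, LinearMap.add_apply, LinearMap.smul_apply]
    rw [key b hb b' hb', key2 b hb, L.symm_odd hζ1 (h.stableB.le hb'), key2 b' hb', key3]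
    module

end RelRep

end LieSuperalgebra

/-! ### Polarizations in an odd subspace and the representations attached to them -/

namespace LieSuperalgebra

variable {g : Type*} [AddCommGroup g] [Module ℂ g]

/-- The subspace `P` of the odd subspace `C` is stable under the even part and maximal isotropic
in `C` for the form `λ([y, z])`. -/
structure IsPolarizing (L : LieSuperalgebra g) (lam : Module.Dual ℂ g) (C P : Submodule ℂ g) :
    Prop where
  le : P ≤ C
  bracket_mem : ∀ x ∈ L.part 0, ∀ p ∈ P, L.bracket x p ∈ P
  isotropic : ∀ p ∈ P, ∀ q ∈ P, lam (L.bracket p q) = 0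
  maximal : ∀ q ∈ C, lam (L.bracket q q) = 0 → (∀ p ∈ P, lam (L.bracket p q) = 0) → q ∈ P

/-- Half the supertrace of `ad x` on the quotient of the odd spaces `C` and `P`. -/
def relTheta (L : LieSuperalgebra g) (C P : Submodule ℂ g) : Module.Dual ℂ g :=
  -- The quotient is purely odd, so its supertrace is minus the trace.
  (-(1 / 2 : ℂ)) • (L.adTrace C - L.adTrace P)

theorem relTheta_apply (L : LieSuperalgebra g) (C P : Submodule ℂ g) (x : g) :
    L.relTheta C P x = -(1 / 2 : ℂ) * (L.adTrace C x - L.adTrace P x) := rfl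

/-- The properties that characterize the irreducible representation attached to `lam`. -/
structure RelRep.IsGood {L : LieSuperalgebra g} {C : Submodule ℂ g} {V : Type*} [AddCommGroup V]
    [Module ℂ V] (R : RelRep L C V) (lam : Module.Dual ℂ g) : Prop where
  nontrivial : Nontrivial V
  irreducible : ∀ N : Submodule ℂ V, (∀ v ∈ N, R.parity v ∈ N) →
    (∀ x ∈ L.part 0, ∀ v ∈ N, R.act x v ∈ N) → (∀ c ∈ C, ∀ v ∈ N, R.act c v ∈ N) →
    N = ⊥ ∨ N = ⊤
  -- Together with `act_even`: invariant subspaces orthogonal to `C` act through `lam`. In the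
  -- induction step this makes `ξ` kill `S` and `[ξ, ζ]` act as a scalar.
  act_odd : ∀ J, L.IsInvariant C J → J ≤ L.orth lam C → ∀ b ∈ J, b ∈ C → ∀ v, R.act b v = 0
  act_even : ∀ J, L.IsInvariant C J → J ≤ L.orth lam C → ∀ x ∈ J, x ∈ L.part 0 →
    ∀ v, R.act x v = lam x • v
  -- The vector yields a map from the induced representation, the covector a map to the coinduced
  -- one, and the dimension makes both bijective.
  exists_vector : ∀ P, L.IsPolarizing lam C P → ∃ v ≠ 0, ∃ i, R.parity v = sgn i • v ∧
    (∀ x ∈ L.part 0, R.act x v = (lam x + L.relTheta C P x) • v) ∧ ∀ p ∈ P, R.act p v = 0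
  exists_covector : ∀ P, L.IsPolarizing lam C P → ∃ f : Module.Dual ℂ V, f ≠ 0 ∧
    ∃ i, (∀ v, f (R.parity v) = sgn i • f v) ∧
    (∀ x ∈ L.part 0, ∀ v, f (R.act x v) = (lam x - L.relTheta C P x) * f v) ∧
    ∀ p ∈ P, ∀ v, f (R.act p v) = 0
  finrank_eq : ∀ P, L.IsPolarizing lam C P →
    Module.finrank ℂ V * 2 ^ Module.finrank ℂ P = 2 ^ Module.finrank ℂ C

variable {L : LieSuperalgebra g} {lam : L.evenCharacters} {B C P : Submodule ℂ g}

theorem IsInvariant.mono {J : Submodule ℂ g} (hJ : L.IsInvariant C J) (h : B ≤ C) :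
    L.IsInvariant B J := ⟨hJ.parity, hJ.even, fun c hc => hJ.odd c (h hc)⟩

theorem orth_anti {f : Module.Dual ℂ g} (h : B ≤ C) : L.orth f C ≤ L.orth f B :=
  fun _ hm y hy => hm y (h hy)

namespace IsPolarizing

theorem mem_of_orth (hP : L.IsPolarizing lam C P) {b : g} (hb : b ∈ C) (ho : b ∈ L.orth lam C) :
    b ∈ P :=
  hP.maximal b hb (ho b hb) fun p hp => ho p (hP.le hp)

theorem of_le (hP : L.IsPolarizing lam C P) (hB : P ≤ B) (h : B ≤ C) : L.IsPolarizing lam B P :=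
  ⟨hB, hP.bracket_mem, hP.isotropic, fun q hq => hP.maximal q (h hq)⟩

theorem relTheta_eq_zero [FiniteDimensional ℂ g] (hP : L.IsPolarizing lam C P) {x : g}
    (hx : ∀ c ∈ C, L.bracket x c ∈ P) : L.relTheta C P x = 0 := by
  rw [relTheta_apply, adTrace_eq_of_bracket_mem hP.le hx, sub_self, mul_zero]

/-- The bracket maps `C` into `P`, because `[a, [b, c]]` is the bracket of `a ∈ P` with an even
element. So its traces on `C` and on `P` agree. -/
theorem relTheta_bracket [FiniteDimensional ℂ g] (hC : L.IsStableOdd C)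
    (hP : L.IsPolarizing lam C P) {a b : g} (ha : a ∈ P) (hb : b ∈ P) :
    L.relTheta C P (L.bracket a b) = 0 := by
  have key : ∀ p ∈ P, ∀ x ∈ L.part 0, L.bracket p x ∈ P := fun p hp x hx => by
    rw [← neg_eq_iff_eq_neg.2 (L.skew_even_left hx p)]
    exact P.neg_mem (hP.bracket_mem x hx p hp)
  have odd : ∀ p ∈ P, p ∈ L.part 1 := fun p hp => hC.le (hP.le hp)
  refine hP.relTheta_eq_zero fun c hc => ?_
  rw [L.jacobi_odd_odd (odd a ha) (odd b hb)]
  exact P.add_mem (key a ha _ (L.bracket_odd_odd (odd b hb) (hC.le hc)))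
    (key b hb _ (L.bracket_odd_odd (odd a ha) (hC.le hc)))

/-- Here `[x, C]` lies in `J ∩ C`, which is orthogonal to `C` and therefore contained in `P`. -/
theorem relTheta_invariant [FiniteDimensional ℂ g] (hC : L.IsStableOdd C)
    (hP : L.IsPolarizing lam C P) {J : Submodule ℂ g} (hJ : L.IsInvariant C J)
    (hJo : J ≤ L.orth lam C) {x : g} (hx : x ∈ J) (hx0 : x ∈ L.part 0) :
    L.relTheta C P x = 0 := by
  refine hP.relTheta_eq_zero fun c hc => hP.mem_of_orth (hC.bracket_mem x hx0 c hc) (hJo ?_)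
  rw [L.skew_even_left hx0]
  exact J.neg_mem (hJ.odd c hc x hx)

end IsPolarizing

/-! ## The case of the zero form -/

variable (lam) in
/-- The one-dimensional representation given by `lam`. -/
def charRep (hC : L.IsStableOdd C) (ho : C ≤ L.orth lam C) : RelRep L C ℂ where
  parity := LinearMap.id
  parity_parity _ := rfl
  act := LinearMap.smulRight (lam : Module.Dual ℂ g) (1 : Module.End ℂ ℂ)
  parity_even _ _ _ := rfl
  parity_odd b hb v := by simp [evenCharacters_odd lam (hC.le hb)]
  even_even x hx y _ v := by
    simp [evenCharacters_bracket_even lam hx y]; ring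
  even_odd x hx b hb v := by
    simp [evenCharacters_bracket_even lam hx b, evenCharacters_odd lam (hC.le hb)]
  odd_odd b hb c hc v := by
    simp [ho hc b hb, evenCharacters_odd lam (hC.le hb), evenCharacters_odd lam (hC.le hc)]

theorem charRep_act (hC : L.IsStableOdd C) (ho : C ≤ L.orth lam C) (x : g) (v : ℂ) :
    (charRep lam hC ho).act x v = (lam : Module.Dual ℂ g) x • v := rfl

theorem charRep_isGood (hC : L.IsStableOdd C) (ho : C ≤ L.orth lam C) :
    (charRep lam hC ho).IsGood lam := by
  have hP : ∀ P, L.IsPolarizing lam C P → P = C := fun P hP =>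
    le_antisymm hP.le fun c hc => hP.mem_of_orth hc (ho hc)
  have hθ : ∀ x, L.relTheta C C x = 0 := fun x => by rw [relTheta_apply, sub_self, mul_zero]
  have h0 : ∀ b ∈ C, ∀ v, (charRep lam hC ho).act b v = 0 := fun b hb v => by
    rw [charRep_act, evenCharacters_odd lam (hC.le hb), zero_smul]
  refine ⟨inferInstance, fun N _ _ _ => eq_bot_or_eq_top N, fun J _ _ b _ hb v => h0 b hb v,
    fun J _ _ x _ _ v => rfl, fun P h => ?_, fun P h => ?_, fun P h => ?_⟩
  · obtain rfl := hP P h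
    exact ⟨1, one_ne_zero, 0, by simp [charRep], fun x _ => by rw [hθ, add_zero, charRep_act],
      fun p hp => h0 p hp 1⟩
  · obtain rfl := hP P h
    exact ⟨LinearMap.id, fun h => one_ne_zero (LinearMap.congr_fun h 1), 0, by simp [charRep],
      fun x _ v => by rw [hθ, sub_zero]; rfl, fun p hp v => h0 p hp v⟩
  · obtain rfl := hP P h
    simp

/-! ## The induction step -/

variable {ζ : g} {φ : Module.Dual ℂ g} {S : Type*} [AddCommGroup S] [Module ℂ S]

theorem finrank_eq_succ [FiniteDimensional ℂ g] (hle : B ≤ C) (hφ : ∀ b ∈ B, φ b = 0) (hζ : ζ ∈ C)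
    (h1 : φ ζ = 1) (hsub : ∀ c ∈ C, c - φ c • ζ ∈ B) :
    Module.finrank ℂ C = Module.finrank ℂ B + 1 := by
  have h := (φ.domRestrict C).finrank_range_add_finrank_ker
  have hr : LinearMap.range (φ.domRestrict C) = ⊤ :=
    LinearMap.range_eq_top.2 fun t => ⟨t • ⟨ζ, hζ⟩, by simp [h1]⟩
  have hk : LinearMap.ker (φ.domRestrict C) = B.comap C.subtype := by
    ext c
    refine ⟨fun hc => ?_, fun hc => hφ c hc⟩
    have h2 := hsub c c.2
    have h3 : φ c = 0 := hc
    rwa [h3, zero_smul, sub_zero] at h2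
  rw [hr, finrank_top, Module.finrank_self, hk,
    (Submodule.comapSubtypeEquivOfLe hle).finrank_eq] at h
  omega

/-- Hence passing from `B` to `C` changes `relTheta` by minus half the weight of `ζ`, which is the
twist built into `extendAct`. -/
theorem Extension.adTrace_eq [FiniteDimensional ℂ g] (h : Extension L B C ζ φ) {x : g}
    (hx : x ∈ L.part 0) : L.adTrace C x = L.adTrace B x + φ (L.bracket x ζ) :=
  adTrace_extend h.le h.mem h.zero h.one h.sub_mem (h.stableB.bracket_mem x hx)
    (h.sub_mem _ (h.stableC.bracket_mem x hx ζ h.mem))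

namespace RelRep

variable {R : RelRep L B S}

theorem extend_act_fst (h : Extension L B C ζ φ) {x : g} (hx : x ∈ L.part 0) (s : S) :
    (R.extend h).act x (s, 0) = (R.act x s - ((1 / 2 : ℂ) * φ (L.bracket x ζ)) • s, 0) := by
  change R.extendAct ζ φ x (s, 0) = _
  rw [extendAct_even h hx]
  simp

/-- Brackets with `ζ` stay in `J`, so `extendAct` only involves the action of `J` on `S`. No twist
appears for even `x ∈ J`, since `[x, ζ]` is orthogonal to `C` and so lies in `B`. -/
theorem IsGood.extend_ideal (hR : R.IsGood lam) (h : Extension L B C ζ φ)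
    (hB : ∀ c ∈ C, c ∈ L.orth lam C → c ∈ B) {J : Submodule ℂ g} (hJ : L.IsInvariant C J)
    (hJo : J ≤ L.orth lam C) :
    (∀ b ∈ J, b ∈ C → ∀ v, (R.extend h).act b v = 0) ∧
    ∀ x ∈ J, x ∈ L.part 0 → ∀ v, (R.extend h).act x v = (lam : Module.Dual ℂ g) x • v := by
  have hJB := hJ.mono h.le
  have hJBo := hJo.trans (orth_anti h.le)
  constructor
  · intro b hb hbC v
    have hbB := hB b hbC (hJo hb)
    have hbζ : L.bracket b ζ ∈ J := by
      rw [L.symm_odd (h.stableC.le hbC) (h.stableC.le h.mem)]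
      exact hJ.odd ζ h.mem b hb
    change R.extendAct ζ φ b v = 0
    rw [extendAct_odd h hbB, hR.act_odd J hJB hJBo b hb hbB, hR.act_odd J hJB hJBo b hb hbB,
      hR.act_even J hJB hJBo _ hbζ (L.bracket_odd_odd (h.stableC.le hbC) (h.stableC.le h.mem)),
      L.symm_odd (h.stableC.le hbC) (h.stableC.le h.mem), hJo hb ζ h.mem]
    simp
  · intro x hx hx0 v
    have hxJ : L.bracket x ζ ∈ J := by
      rw [L.skew_even_left hx0]
      exact J.neg_mem (hJ.odd ζ h.mem x hx)
    have hxB := hB _ (h.stableC.bracket_mem x hx0 ζ h.mem) (hJo hxJ)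
    change R.extendAct ζ φ x v = _
    rw [extendAct_even h hx0, h.zero _ hxB, zero_smul, sub_zero,
      hR.act_odd J hJB hJBo _ hxJ hxB, hR.act_even J hJB hJBo x hx hx0,
      hR.act_even J hJB hJBo x hx hx0]
    ext <;> simp

/-- The vector is placed in the first summand, where the twist is minus half the weight of `ζ`. -/
theorem IsGood.extend_vector [FiniteDimensional ℂ g] (hR : R.IsGood lam)
    (h : Extension L B C ζ φ) (hP : L.IsPolarizing lam C P) (hPB : P ≤ B) :
    ∃ v ≠ 0, ∃ i, (R.extend h).parity v = sgn i • v ∧ (∀ x ∈ L.part 0, (R.extend h).act x v =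
      ((lam : Module.Dual ℂ g) x + L.relTheta C P x) • v) ∧ ∀ p ∈ P, (R.extend h).act p v = 0 := by
  obtain ⟨v, hv, i, hi, hx, hp⟩ := hR.exists_vector P (hP.of_le hPB h.le)
  refine ⟨(v, 0), by simpa using hv, i, ?_, fun x hx0 => ?_, fun p hpP => ?_⟩
  · change (R.parity v, -R.parity 0) = _
    simp [hi]
  · rw [extend_act_fst h hx0, hx x hx0, relTheta_apply, relTheta_apply, h.adTrace_eq hx0]
    ext
    · simp only [Prod.smul_fst]
      module
    · simp
  · change R.extendAct ζ φ p (v, 0) = _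
    rw [extendAct_odd h (hPB hpP)]
    simp [hp p hpP]

/-- The functional is read off the second summand: the opposite twist there fits `λ - θ`, and the
odd `ζ` changes its parity. -/
theorem IsGood.extend_covector [FiniteDimensional ℂ g] (hR : R.IsGood lam)
    (h : Extension L B C ζ φ) (hP : L.IsPolarizing lam C P) (hPB : P ≤ B) :
    ∃ f : Module.Dual ℂ (S × S), f ≠ 0 ∧ ∃ i, (∀ v, f ((R.extend h).parity v) = sgn i • f v) ∧
    (∀ x ∈ L.part 0, ∀ v, f ((R.extend h).act x v) =
      ((lam : Module.Dual ℂ g) x - L.relTheta C P x) * f v) ∧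
    ∀ p ∈ P, ∀ v, f ((R.extend h).act p v) = 0 := by
  obtain ⟨f, hf, i, hi, hx, hp⟩ := hR.exists_covector P (hP.of_le hPB h.le)
  refine ⟨f ∘ₗ LinearMap.snd ℂ S S, fun h0 => hf ?_, i + 1, fun v => ?_, fun x hx0 v => ?_,
    fun p hpP v => ?_⟩
  · ext s
    exact LinearMap.congr_fun h0 (0, s)
  · change f (-R.parity v.2) = sgn (i + 1) • f v.2
    rw [map_neg, hi, sgn_add]
    simp
  · change f ((R.extendAct ζ φ x v).2) = _ * f v.2
    rw [extendAct_even h hx0, map_add, map_smul, hx x hx0, relTheta_apply, relTheta_apply,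
      h.adTrace_eq hx0, smul_eq_mul]
    ring
  · change f ((R.extendAct ζ φ p v).2) = 0
    rw [extendAct_odd h (hPB hpP), map_neg, hp p hpP, neg_zero]

/-- By irreducibility of `S`, an invariant `N` contains all of `S` or meets it in zero. In the first
case `ζ` carries `S` onto the second summand. The second case is left to `hbot`, where the rank-one
and the isotropic situation need different arguments. -/
theorem IsGood.extend_irreducible (hR : R.IsGood lam) (h : Extension L B C ζ φ)
    (hbot : ∀ N : Submodule ℂ (S × S), (∀ v ∈ N, (R.extend h).parity v ∈ N) →
      (∀ c ∈ C, ∀ v ∈ N, (R.extend h).act c v ∈ N) → (∀ s, (s, 0) ∈ N → s = 0) → N = ⊥)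
    (N : Submodule ℂ (S × S)) (hN : ∀ v ∈ N, (R.extend h).parity v ∈ N)
    (hN0 : ∀ x ∈ L.part 0, ∀ v ∈ N, (R.extend h).act x v ∈ N)
    (hN1 : ∀ c ∈ C, ∀ v ∈ N, (R.extend h).act c v ∈ N) : N = ⊥ ∨ N = ⊤ := by
  have key : N.comap (LinearMap.inl ℂ S S) = ⊥ ∨ N.comap (LinearMap.inl ℂ S S) = ⊤ := by
    refine hR.irreducible _ ?_ ?_ ?_
    · intro s hs
      have := hN _ hs
      change (R.parity s, -R.parity 0) ∈ N at this
      simpa using this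
    · intro x hx s hs
      have h1 := hN0 x hx _ hs
      rw [LinearMap.inl_apply, extend_act_fst h hx] at h1
      have h2 := N.add_mem h1 (N.smul_mem ((1 / 2 : ℂ) * φ (L.bracket x ζ)) hs)
      simpa using h2
    · intro b hb s hs
      have h1 := hN1 b (h.le hb) _ hs
      change R.extendAct ζ φ b (s, 0) ∈ N at h1
      rw [extendAct_odd h hb] at h1
      simpa using h1
  rcases key with hs | hs
  · refine Or.inl (hbot N hN hN1 fun s hsN => ?_)
    have : s ∈ N.comap (LinearMap.inl ℂ S S) := hsN
    rwa [hs] at this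
  · refine Or.inr (eq_top_iff.2 fun v _ => ?_)
    have h1 : ∀ s : S, (s, (0 : S)) ∈ N := fun s => by
      have : s ∈ N.comap (LinearMap.inl ℂ S S) := hs ▸ Submodule.mem_top
      exact this
    have h2 : ∀ s : S, ((0 : S), s) ∈ N := fun s => by
      have := hN1 ζ h.mem _ (h1 s)
      change R.extendAct ζ φ ζ (s, 0) ∈ N at this
      rw [extendAct_self h] at this
      simpa using this
    have := N.add_mem (h1 v.1) (h2 v.2)
    simpa using this

end RelRep

/-- The extension data when the radical of the form is a hyperplane in `C`. -/
theorem extension_of_anisotropic (hC : L.IsStableOdd C) (hζ : ζ ∈ C)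
    (hne : (lam : Module.Dual ℂ g) (L.bracket ζ ζ) ≠ 0)
    (hrad : ∀ c ∈ C, (lam : Module.Dual ℂ g) (L.bracket ζ c) = 0 → c ∈ L.orth lam C) :
    Extension L (C ⊓ L.orth lam C) C ζ
      (((lam : Module.Dual ℂ g) (L.bracket ζ ζ))⁻¹ • ((lam : Module.Dual ℂ g) ∘ₗ L.bracket ζ)) where
  stableB := ⟨inf_le_left.trans hC.le, fun x hx b hb => ⟨hC.bracket_mem x hx b hb.1, fun y hy => by
    have h := evenCharacters_invariant lam hx y b
    rw [hb.2 _ (hC.bracket_mem x hx y hy)] at h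
    exact neg_eq_zero.1 h.symm⟩⟩
  stableC := hC
  le := inf_le_left
  mem := hζ
  even x hx := by simp [evenCharacters_bracket_even' lam hx]
  zero b hb := by simp [hb.2 ζ hζ]
  one := by simp [hne]
  sub_mem c hc := by
    refine ⟨C.sub_mem hc (C.smul_mem _ hζ), hrad _ (C.sub_mem hc (C.smul_mem _ hζ)) ?_⟩
    simp [mul_right_comm, hne]
  weight c hc d hd := by
    have h := evenCharacters_invariant lam (L.bracket_odd_odd (hC.le hc) (hC.le hd)) ζ ζ
    rw [← form_symm_odd (hC.le hζ)] at h
    simp [self_eq_neg.1 h]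

end LieSuperalgebra

/-! ### The form of rank one, and the exchange of polarizations -/

namespace LieSuperalgebra

variable {g : Type*} [AddCommGroup g] [Module ℂ g]
variable {L : LieSuperalgebra g} {lam : L.evenCharacters} {B C P : Submodule ℂ g}
variable {S : Type*} [AddCommGroup S] [Module ℂ S]

/-- Induction of the character `λ` from the radical. The square of `ζ` acts by the nonzero scalar `½
λ([ζ, ζ])`; the eigenlines of `ζ` are not graded, so irreducibility depends on the parity operator.
-/
theorem exists_isGood_of_anisotropic [FiniteDimensional ℂ g] (hC : L.IsStableOdd C) {ζ : g}
    (hζ : ζ ∈ C) (hne : (lam : Module.Dual ℂ g) (L.bracket ζ ζ) ≠ 0)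
    (hrad : ∀ c ∈ C, (lam : Module.Dual ℂ g) (L.bracket ζ c) = 0 → c ∈ L.orth lam C) :
    ∃ R : RelRep L C (ℂ × ℂ), R.IsGood lam := by
  have h := extension_of_anisotropic hC hζ hne hrad
  have hBo : C ⊓ L.orth lam C ≤ L.orth lam (C ⊓ L.orth lam C) :=
    inf_le_right.trans (orth_anti inf_le_left)
  have hR := charRep_isGood h.stableB hBo
  set R := charRep lam h.stableB hBo
  -- For `p = b + t ζ` with `b` in the radical, isotropy reads `t² λ([ζ, ζ]) = 0`.
  have hPB : ∀ P, L.IsPolarizing lam C P → P ≤ C ⊓ L.orth lam C := by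
    intro P hP p hp
    obtain ⟨b, hb, hbe⟩ := h.decomp (hP.le hp)
    set t := (((lam : Module.Dual ℂ g) (L.bracket ζ ζ))⁻¹ •
      ((lam : Module.Dual ℂ g) ∘ₗ L.bracket ζ)) p
    have h1 := hP.isotropic p hp p hp
    have h2 : ∀ c ∈ C, (lam : Module.Dual ℂ g) (L.bracket b c) = 0 := fun c hc => by
      rw [form_symm_odd (hC.le hb.1)]
      exact hb.2 c hc
    rw [hbe] at h1
    simp only [map_add, map_smul, LinearMap.add_apply, LinearMap.smul_apply, smul_eq_mul,
      h2 b hb.1, h2 ζ hζ, hb.2 ζ hζ] at h1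
    have ht : t = 0 := by simpa [hne] using h1
    rw [hbe, ht, zero_smul, add_zero]
    exact hb
  have hdim := finrank_eq_succ h.le h.zero h.mem h.one h.sub_mem
  refine ⟨R.extend h, inferInstance, hR.extend_irreducible h ?_, ?_, ?_, ?_, ?_, ?_⟩
  · intro N hN hN1 h0
    refine (Submodule.eq_bot_iff _).2 fun v hv => ?_
    have h1 : v.1 = 0 := by
      have h2 := N.add_mem hv (hN v hv)
      have h3 : v + (R.extend h).parity v = (2 * v.1, 0) := by
        change v + (v.1, -v.2) = _
        ext
        · simp [two_mul]
        · simp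
      rw [h3] at h2
      simpa using h0 _ h2
    have h4 := hN1 ζ hζ v hv
    change R.extendAct ζ _ ζ v ∈ N at h4
    rw [RelRep.extendAct_self h, h1, charRep_act] at h4
    have h5 := h0 _ h4
    have h6 : v.2 = 0 := by simpa [hne] using h5
    exact Prod.ext h1 h6
  · exact fun J hJ hJo => (hR.extend_ideal h (fun c hc ho => ⟨hc, ho⟩) hJ hJo).1
  · exact fun J hJ hJo => (hR.extend_ideal h (fun c hc ho => ⟨hc, ho⟩) hJ hJo).2
  · exact fun P hP => hR.extend_vector h hP (hPB P hP)
  · exact fun P hP => hR.extend_covector h hP (hPB P hP)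
  · intro P hP
    have := hR.finrank_eq P (hP.of_le (hPB P hP) h.le)
    rw [Module.finrank_self, one_mul] at this
    rw [Module.finrank_prod, Module.finrank_self, hdim, pow_succ, ← this]
    ring

/-! ## Isotropic weight vectors -/

variable (L lam C) in
/-- An isotropic weight vector outside of the radical of the form that `C` maps into the largest
invariant subspace orthogonal to `C`. -/
structure IsIsotropicWeight (ξ : g) (α : Module.Dual ℂ g) : Prop where
  mem : ξ ∈ C
  notMem : ξ ∉ L.orth lam C
  isotropic : (lam : Module.Dual ℂ g) (L.bracket ξ ξ) = 0
  odd : ∀ c ∈ C, L.bracket c ξ ∈ L.maxInvariant lam C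
  even : ∀ x ∈ L.part 0, L.bracket x ξ - α x • ξ ∈ L.maxInvariant lam C

variable {ξ : g} {α : Module.Dual ℂ g}

namespace IsIsotropicWeight

/-- By the Jacobi identity `[[c, d], ξ]` lies in `L.maxInvariant lam C`. A nonzero weight would put
`ξ` there too, hence into the orthogonal complement of `C`. -/
theorem weight_bracket (hC : L.IsStableOdd C) (h : L.IsIsotropicWeight lam C ξ α) {c d : g}
    (hc : c ∈ C) (hd : d ∈ C) : α (L.bracket c d) = 0 := by
  have hM := maxInvariant_invariant (L := L) lam C
  have h1 := h.even _ (L.bracket_odd_odd (hC.le hc) (hC.le hd))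
  have h2 : L.bracket (L.bracket c d) ξ ∈ L.maxInvariant lam C := by
    rw [L.jacobi_odd_odd (hC.le hc) (hC.le hd)]
    exact Submodule.add_mem _ (hM.odd c hc _ (h.odd d hd)) (hM.odd d hd _ (h.odd c hc))
  have h3 := Submodule.sub_mem _ h2 h1
  rw [sub_sub_cancel] at h3
  by_contra h0
  exact h.notMem (maxInvariant_le _ _ ((Submodule.smul_mem_iff _ h0).1 h3))

theorem form_bracket (hC : L.IsStableOdd C) (h : L.IsIsotropicWeight lam C ξ α) {x c : g}
    (hx : x ∈ L.part 0) (hc : c ∈ C) : (lam : Module.Dual ℂ g) (L.bracket ξ (L.bracket x c)) =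
      -(α x * (lam : Module.Dual ℂ g) (L.bracket ξ c)) := by
  have h1 := evenCharacters_invariant lam hx ξ c
  have h2 := maxInvariant_le _ _ (h.even x hx) c hc
  rw [← form_symm_odd (hC.le hc)] at h1
  rw [map_sub, map_sub, map_smul, map_smul, form_symm_odd (hC.le hc) ξ, smul_eq_mul,
    sub_eq_zero] at h2
  rw [← neg_eq_iff_eq_neg.2 h1, h2]

theorem stable (hC : L.IsStableOdd C) (h : L.IsIsotropicWeight lam C ξ α) {P : Submodule ℂ g}
    (hPC : P ≤ C) (hP : ∀ x ∈ L.part 0, ∀ p ∈ P, L.bracket x p ∈ P) :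
    L.IsStableOdd (P ⊓ L.orth lam (ℂ ∙ ξ)) := by
  refine ⟨inf_le_left.trans (hPC.trans hC.le), fun x hx b hb => ⟨hP x hx b hb.1, fun y hy => ?_⟩⟩
  obtain ⟨t, rfl⟩ := Submodule.mem_span_singleton.1 hy
  rw [map_smul, LinearMap.smul_apply, map_smul, h.form_bracket hC hx (hPC hb.1),
    hb.2 ξ (Submodule.mem_span_singleton_self ξ)]
  simp

theorem mem_orth_span {f : Module.Dual ℂ g} {m : g} :
    m ∈ L.orth f (ℂ ∙ ξ) ↔ f (L.bracket ξ m) = 0 := by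
  refine ⟨fun h => h ξ (Submodule.mem_span_singleton_self ξ), fun h a ha => ?_⟩
  obtain ⟨t, rfl⟩ := Submodule.mem_span_singleton.1 ha
  simp [h]

theorem extension (hC : L.IsStableOdd C) (h : L.IsIsotropicWeight lam C ξ α) {ζ : g} (hζ : ζ ∈ C)
    (hone : (lam : Module.Dual ℂ g) (L.bracket ξ ζ) = 1) :
    Extension L (C ⊓ L.orth lam (ℂ ∙ ξ)) C ζ ((lam : Module.Dual ℂ g) ∘ₗ L.bracket ξ) where
  stableB := h.stable hC le_rfl hC.bracket_mem
  stableC := hC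
  le := inf_le_left
  mem := hζ
  even x hx := evenCharacters_bracket_even' lam hx ξ
  zero b hb := mem_orth_span.1 hb.2
  one := hone
  sub_mem c hc := by
    refine ⟨C.sub_mem hc (C.smul_mem _ hζ), mem_orth_span.2 ?_⟩
    simp [hone]
  weight c hc d hd := by
    rw [LinearMap.comp_apply,
      h.form_bracket hC (L.bracket_odd_odd (hC.le hc) (hC.le hd)) hζ, h.weight_bracket hC hc hd]
    simp

theorem exists_dual (hC : L.IsStableOdd C) (h : L.IsIsotropicWeight lam C ξ α) :
    ∃ ζ ∈ C, (lam : Module.Dual ℂ g) (L.bracket ξ ζ) = 1 := by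
  have h1 : ¬ ∀ y ∈ C, (lam : Module.Dual ℂ g) (L.bracket y ξ) = 0 := h.notMem
  push Not at h1
  obtain ⟨y, hy, hne⟩ := h1
  rw [form_symm_odd (hC.le hy)] at hne
  exact ⟨((lam : Module.Dual ℂ g) (L.bracket ξ y))⁻¹ • y, C.smul_mem _ hy, by simp [hne]⟩

/-- A polarization not containing `ξ` can be modified to contain `ξ`. -/
theorem isPolarizing_sup (hC : L.IsStableOdd C) (h : L.IsIsotropicWeight lam C ξ α)
    (hP : L.IsPolarizing lam C P) {p : g} (hp : p ∈ P)
    (hone : (lam : Module.Dual ℂ g) (L.bracket ξ p) = 1) :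
    L.IsPolarizing lam C (P ⊓ L.orth lam (ℂ ∙ ξ) ⊔ ℂ ∙ ξ) where
  le := sup_le (inf_le_left.trans hP.le) ((Submodule.span_singleton_le_iff_mem _ _).2 h.mem)
  bracket_mem := by
    intro x hx a ha
    obtain ⟨q, hq, y, hy, rfl⟩ := Submodule.mem_sup.1 ha
    obtain ⟨t, rfl⟩ := Submodule.mem_span_singleton.1 hy
    have h1 : L.bracket x ξ - α x • ξ ∈ P ⊓ L.orth lam (ℂ ∙ ξ) := by
      have ho := maxInvariant_le _ _ (h.even x hx)
      exact ⟨hP.mem_of_orth (C.sub_mem (hC.bracket_mem x hx ξ h.mem) (C.smul_mem _ h.mem)) ho,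
        mem_orth_span.2 (ho ξ h.mem)⟩
    have h2 : L.bracket x (q + t • ξ) = (L.bracket x q + t • (L.bracket x ξ - α x • ξ)) +
        (t * α x) • ξ := by
      simp only [map_add, map_smul]
      module
    rw [h2]
    exact Submodule.add_mem_sup (Submodule.add_mem _
      ((h.stable hC hP.le hP.bracket_mem).bracket_mem x hx q hq) (Submodule.smul_mem _ _ h1))
      (Submodule.smul_mem _ _ (Submodule.mem_span_singleton_self ξ))
  isotropic := by
    intro a ha b hb
    obtain ⟨q, hq, y, hy, rfl⟩ := Submodule.mem_sup.1 ha
    obtain ⟨t, rfl⟩ := Submodule.mem_span_singleton.1 hy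
    obtain ⟨q', hq', y, hy, rfl⟩ := Submodule.mem_sup.1 hb
    obtain ⟨t', rfl⟩ := Submodule.mem_span_singleton.1 hy
    have h1 := mem_orth_span.1 hq.2
    have h2 := mem_orth_span.1 hq'.2
    rw [form_symm_odd (hC.le h.mem)] at h1
    simp [hP.isotropic q hq.1 q' hq'.1, h1, h2, h.isotropic]
  maximal := by
    intro q hq hqq hqP
    have h1 : (lam : Module.Dual ℂ g) (L.bracket ξ q) = 0 :=
      hqP ξ (Submodule.mem_sup_right (Submodule.mem_span_singleton_self ξ))
    have h1' : (lam : Module.Dual ℂ g) (L.bracket q ξ) = 0 := by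
      rw [form_symm_odd (hC.le hq), h1]
    -- Correcting `q` by a multiple of `ξ` makes it orthogonal to `p` as well, hence to `P = (P ∩
    -- ξ^⊥) + ℂ p`, and the maximality of `P` applies.
    have hq' : q - (lam : Module.Dual ℂ g) (L.bracket p q) • ξ ∈ P := by
      refine hP.maximal _ (C.sub_mem hq (C.smul_mem _ h.mem)) ?_ fun r hr => ?_
      · simp [hqq, h1, h1', h.isotropic]
      · have h2 : (lam : Module.Dual ℂ g) (L.bracket p ξ) = 1 := by
          rw [form_symm_odd (hC.le (hP.le hp)), hone]
        set s := (lam : Module.Dual ℂ g) (L.bracket ξ r) with hs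
        have h3 : r - s • p ∈ P ⊓ L.orth lam (ℂ ∙ ξ) :=
          ⟨P.sub_mem hr (P.smul_mem _ hp), mem_orth_span.2 (by simp [hone, hs])⟩
        have h4 := hqP _ (Submodule.mem_sup_left h3)
        have h5 : (lam : Module.Dual ℂ g) (L.bracket r ξ) = s := by
          rw [form_symm_odd (hC.le (hP.le hr))]
        simp only [map_sub, map_smul, LinearMap.sub_apply, LinearMap.smul_apply, smul_eq_mul] at h4 ⊢
        rw [h5]
        linear_combination h4
    rw [← sub_add_cancel q ((lam : Module.Dual ℂ g) (L.bracket p q) • ξ)]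
    refine Submodule.add_mem_sup ⟨hq', mem_orth_span.2 ?_⟩
      (Submodule.smul_mem _ _ (Submodule.mem_span_singleton_self ξ))
    simp [h1, h.isotropic]

theorem exists_mem_dual (hC : L.IsStableOdd C) (h : L.IsIsotropicWeight lam C ξ α)
    (hP : L.IsPolarizing lam C P) (hξ : ξ ∉ P) :
    ∃ p ∈ P, (lam : Module.Dual ℂ g) (L.bracket ξ p) = 1 := by
  have h1 : ¬ ∀ p ∈ P, (lam : Module.Dual ℂ g) (L.bracket p ξ) = 0 := fun h1 =>
    hξ (hP.maximal ξ h.mem h.isotropic h1)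
  push Not at h1
  obtain ⟨y, hy, hne⟩ := h1
  rw [form_symm_odd (hC.le (hP.le hy))] at hne
  exact ⟨((lam : Module.Dual ℂ g) (L.bracket ξ y))⁻¹ • y, P.smul_mem _ hy, by simp [hne]⟩

/-- The codimension-one comparison of `P` and of the modified polarization with their
intersection. -/
theorem sub_mem_left {p : g} (hp : p ∈ P)
    (hone : (lam : Module.Dual ℂ g) (L.bracket ξ p) = 1) (q : g) (hq : q ∈ P) :
    q - ((lam : Module.Dual ℂ g) ∘ₗ L.bracket ξ) q • p ∈ P ⊓ L.orth lam (ℂ ∙ ξ) :=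
  ⟨P.sub_mem hq (P.smul_mem _ hp), mem_orth_span.2 (by simp [hone])⟩

theorem sub_mem_right (hC : L.IsStableOdd C) (hP : L.IsPolarizing lam C P) {p : g} (hp : p ∈ P)
    (hone : (lam : Module.Dual ℂ g) (L.bracket ξ p) = 1) (q : g)
    (hqP : q ∈ P ⊓ L.orth lam (ℂ ∙ ξ) ⊔ ℂ ∙ ξ) :
    q - ((lam : Module.Dual ℂ g) ∘ₗ L.bracket p) q • ξ ∈ P ⊓ L.orth lam (ℂ ∙ ξ) := by
  obtain ⟨q, hq, y, hy, rfl⟩ := Submodule.mem_sup.1 hqP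
  obtain ⟨t, rfl⟩ := Submodule.mem_span_singleton.1 hy
  have h1 : (lam : Module.Dual ℂ g) (L.bracket p ξ) = 1 := by
    rw [form_symm_odd (hC.le (hP.le hp)), hone]
  simpa [h1, hP.isotropic p hp q hq.1] using hq

/-- As `p` is dual to `ξ` under an invariant form, its weight modulo `P ∩ ξ^⊥` is opposite to that
of `ξ`. -/
theorem bracket_add_mem (hC : L.IsStableOdd C) (h : L.IsIsotropicWeight lam C ξ α)
    (hP : L.IsPolarizing lam C P) {p : g} (hp : p ∈ P)
    (hone : (lam : Module.Dual ℂ g) (L.bracket ξ p) = 1) {x : g} (hx : x ∈ L.part 0) :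
    L.bracket x p - (-α x) • p ∈ P ⊓ L.orth lam (ℂ ∙ ξ) := by
  have := sub_mem_left hp hone _ (hP.bracket_mem x hx p hp)
  rwa [LinearMap.comp_apply, h.form_bracket hC hx (hP.le hp), hone, mul_one] at this

/-- The exchange removes `p`, of weight `-α`, and adds `ξ`, of weight `α`. The trace on the
polarization grows by `2 α`, half of which enters `relTheta`. -/
theorem relTheta_sup [FiniteDimensional ℂ g] (hC : L.IsStableOdd C)
    (h : L.IsIsotropicWeight lam C ξ α) (hP : L.IsPolarizing lam C P) {p : g} (hp : p ∈ P)
    (hone : (lam : Module.Dual ℂ g) (L.bracket ξ p) = 1) {x : g} (hx : x ∈ L.part 0) :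
    L.relTheta C (P ⊓ L.orth lam (ℂ ∙ ξ) ⊔ ℂ ∙ ξ) x = L.relTheta C P x + α x := by
  have hst := (h.stable hC hP.le hP.bracket_mem).bracket_mem x hx
  have h1 : (lam : Module.Dual ℂ g) (L.bracket p ξ) = 1 := by
    rw [form_symm_odd (hC.le (hP.le hp)), hone]
  have hA : L.adTrace P x = L.adTrace (P ⊓ L.orth lam (ℂ ∙ ξ)) x + -α x :=
    adTrace_extend (φ := (lam : Module.Dual ℂ g) ∘ₗ L.bracket ξ) inf_le_left hp
      (fun v hv => mem_orth_span.1 hv.2) hone (sub_mem_left hp hone) hst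
      (h.bracket_add_mem hC hP hp hone hx)
  have ho := maxInvariant_le _ _ (h.even x hx)
  have hB : L.adTrace (P ⊓ L.orth lam (ℂ ∙ ξ) ⊔ ℂ ∙ ξ) x =
      L.adTrace (P ⊓ L.orth lam (ℂ ∙ ξ)) x + α x :=
    adTrace_extend (φ := (lam : Module.Dual ℂ g) ∘ₗ L.bracket p) le_sup_left
      (Submodule.mem_sup_right (Submodule.mem_span_singleton_self ξ))
      (fun v hv => hP.isotropic p hp v hv.1) h1 (sub_mem_right hC hP hp hone) hst
      ⟨hP.mem_of_orth (C.sub_mem (hC.bracket_mem x hx ξ h.mem) (C.smul_mem _ h.mem)) ho,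
        mem_orth_span.2 (ho ξ h.mem)⟩
  rw [relTheta_apply, relTheta_apply, hA, hB]
  ring

theorem finrank_sup [FiniteDimensional ℂ g] (hC : L.IsStableOdd C)
    (hP : L.IsPolarizing lam C P) {p : g} (hp : p ∈ P)
    (hone : (lam : Module.Dual ℂ g) (L.bracket ξ p) = 1) :
    Module.finrank ℂ ↥(P ⊓ L.orth lam (ℂ ∙ ξ) ⊔ ℂ ∙ ξ) = Module.finrank ℂ P := by
  have h1 : (lam : Module.Dual ℂ g) (L.bracket p ξ) = 1 := by
    rw [form_symm_odd (hC.le (hP.le hp)), hone]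
  rw [finrank_eq_succ (φ := (lam : Module.Dual ℂ g) ∘ₗ L.bracket p)
      (B := P ⊓ L.orth lam (ℂ ∙ ξ)) le_sup_left (fun v hv => hP.isotropic p hp v hv.1)
      (Submodule.mem_sup_right (Submodule.mem_span_singleton_self ξ)) h1
      (sub_mem_right hC hP hp hone),
    finrank_eq_succ (φ := (lam : Module.Dual ℂ g) ∘ₗ L.bracket ξ) (C := P) inf_le_left
      (fun v hv => mem_orth_span.1 hv.2) hp hone (sub_mem_left hp hone)]

end IsIsotropicWeight

end LieSuperalgebra

/-! ### The induction step for an isotropic weight vector -/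

namespace LieSuperalgebra

variable {g : Type*} [AddCommGroup g] [Module ℂ g]
variable {L : LieSuperalgebra g} {lam : L.evenCharacters} {B C P : Submodule ℂ g}
variable {S : Type*} [AddCommGroup S] [Module ℂ S] {ξ : g} {α : Module.Dual ℂ g}

namespace IsIsotropicWeight

theorem relTheta_bracket [FiniteDimensional ℂ g] (hC : L.IsStableOdd C)
    (h : L.IsIsotropicWeight lam C ξ α) (hP : L.IsPolarizing lam C P) {p : g} (hp : p ∈ P)
    (hone : (lam : Module.Dual ℂ g) (L.bracket ξ p) = 1) {q : g} (hq : q ∈ P) :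
    L.relTheta C (P ⊓ L.orth lam (ℂ ∙ ξ) ⊔ ℂ ∙ ξ) (L.bracket q p) = 0 := by
  rw [h.relTheta_sup hC hP hp hone (L.bracket_odd_odd (hC.le (hP.le hq)) (hC.le (hP.le hp))),
    hP.relTheta_bracket hC hq hp, h.weight_bracket hC (hP.le hq) (hP.le hp), add_zero]

theorem relTheta_bracket_self [FiniteDimensional ℂ g] (hC : L.IsStableOdd C)
    (h : L.IsIsotropicWeight lam C ξ α) {P' : Submodule ℂ g} (hP' : L.IsPolarizing lam C P')
    {p : g} (hp : p ∈ C) : L.relTheta C P' (L.bracket ξ p) = 0 := by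
  refine hP'.relTheta_invariant hC (maxInvariant_invariant (L := L) lam C) (maxInvariant_le _ _)
    ?_ (L.bracket_odd_odd (hC.le h.mem) (hC.le hp))
  rw [L.symm_odd (hC.le h.mem) (hC.le hp)]
  exact h.odd p hp

/-- If `v` belongs to the exchanged polarization, then `p v` belongs to `P`. It is nonzero because
`ξ p v = [ξ, p] v = v`, its weight is right because the weight `-α` of `p` cancels the shift in
`relTheta_sup`, and `p p v = ½ [p, p] v = 0`. -/
theorem exists_vector [FiniteDimensional ℂ g] (hC : L.IsStableOdd C)
    (h : L.IsIsotropicWeight lam C ξ α) (hP : L.IsPolarizing lam C P) {p : g} (hp : p ∈ P)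
    (hone : (lam : Module.Dual ℂ g) (L.bracket ξ p) = 1) (R : RelRep L C S)
    (hR : ∃ v ≠ 0, ∃ i, R.parity v = sgn i • v ∧
      (∀ x ∈ L.part 0, R.act x v = ((lam : Module.Dual ℂ g) x +
        L.relTheta C (P ⊓ L.orth lam (ℂ ∙ ξ) ⊔ ℂ ∙ ξ) x) • v) ∧
      ∀ p ∈ P ⊓ L.orth lam (ℂ ∙ ξ) ⊔ ℂ ∙ ξ, R.act p v = 0) :
    ∃ v ≠ 0, ∃ i, R.parity v = sgn i • v ∧
      (∀ x ∈ L.part 0, R.act x v = ((lam : Module.Dual ℂ g) x + L.relTheta C P x) • v) ∧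
      ∀ p ∈ P, R.act p v = 0 := by
  obtain ⟨v, hv, i, hi, hx, hp'⟩ := hR
  have hodd : ∀ q ∈ P, q ∈ L.part 1 := fun q hq => hC.le (hP.le hq)
  have hξ0 : R.act ξ v = 0 :=
    hp' ξ (Submodule.mem_sup_right (Submodule.mem_span_singleton_self ξ))
  have hqp : ∀ q ∈ P, R.act (L.bracket q p) v = 0 := fun q hq => by
    rw [hx _ (L.bracket_odd_odd (hodd q hq) (hodd p hp)), hP.isotropic q hq p hp,
      h.relTheta_bracket hC hP hp hone hq, add_zero, zero_smul]
  refine ⟨R.act p v, fun h0 => hv ?_, i + 1, ?_, fun x hx0 => ?_, fun q hq => ?_⟩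
  · have h1 := R.odd_odd ξ h.mem p (hP.le hp) v
    rw [h0, hξ0, hx _ (L.bracket_odd_odd (hC.le h.mem) (hodd p hp)), hone,
      h.relTheta_bracket_self hC (h.isPolarizing_sup hC hP hp hone) (hP.le hp)] at h1
    simpa using h1
  · rw [R.parity_odd p (hP.le hp), hi, map_smul, sgn_add]
    simp
  · have h1 := R.even_odd x hx0 p (hP.le hp) v
    have h2 := hp' _ (Submodule.mem_sup_left (h.bracket_add_mem hC hP hp hone hx0))
    rw [map_sub, map_smul, LinearMap.sub_apply, LinearMap.smul_apply, sub_eq_zero] at h2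
    rw [h2, hx x hx0, h.relTheta_sup hC hP hp hone hx0, map_smul] at h1
    rw [← sub_add_cancel (R.act x (R.act p v)) (((lam : Module.Dual ℂ g) x +
      (L.relTheta C P x + α x)) • R.act p v), ← h1]
    module
  · have h0 : ∀ q ∈ P ⊓ L.orth lam (ℂ ∙ ξ), R.act q (R.act p v) = 0 := fun q hq => by
      have h1 := R.odd_odd q (hP.le hq.1) p (hP.le hp) v
      rw [hqp q hq.1, hp' q (Submodule.mem_sup_left hq), map_zero, add_zero] at h1
      exact h1.symm
    have h1 := R.odd_odd p (hP.le hp) p (hP.le hp) v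
    rw [hqp p hp, ← two_smul ℂ] at h1
    have h2 : R.act p (R.act p v) = 0 := (smul_eq_zero.1 h1.symm).resolve_left two_ne_zero
    have h3 := h0 _ (sub_mem_left hp hone q hq)
    rwa [map_sub, map_smul, LinearMap.sub_apply, LinearMap.smul_apply, h2, smul_zero,
      sub_zero] at h3

/-- The transpose of `exists_vector`, with `f ∘ p` in place of `p v`. Moving `x` past `p` now
contributes `+α`, in agreement with the sign of `relTheta`. -/
theorem exists_covector [FiniteDimensional ℂ g] (hC : L.IsStableOdd C)
    (h : L.IsIsotropicWeight lam C ξ α) (hP : L.IsPolarizing lam C P) {p : g} (hp : p ∈ P)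
    (hone : (lam : Module.Dual ℂ g) (L.bracket ξ p) = 1) (R : RelRep L C S)
    (hR : ∃ f : Module.Dual ℂ S, f ≠ 0 ∧ ∃ i, (∀ v, f (R.parity v) = sgn i • f v) ∧
      (∀ x ∈ L.part 0, ∀ v, f (R.act x v) = ((lam : Module.Dual ℂ g) x -
        L.relTheta C (P ⊓ L.orth lam (ℂ ∙ ξ) ⊔ ℂ ∙ ξ) x) * f v) ∧
      ∀ p ∈ P ⊓ L.orth lam (ℂ ∙ ξ) ⊔ ℂ ∙ ξ, ∀ v, f (R.act p v) = 0) :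
    ∃ f : Module.Dual ℂ S, f ≠ 0 ∧ ∃ i, (∀ v, f (R.parity v) = sgn i • f v) ∧
      (∀ x ∈ L.part 0, ∀ v, f (R.act x v) =
        ((lam : Module.Dual ℂ g) x - L.relTheta C P x) * f v) ∧
      ∀ p ∈ P, ∀ v, f (R.act p v) = 0 := by
  obtain ⟨f, hf, i, hi, hx, hp'⟩ := hR
  have hodd : ∀ q ∈ P, q ∈ L.part 1 := fun q hq => hC.le (hP.le hq)
  have hξ0 : ∀ v, f (R.act ξ v) = 0 :=
    hp' ξ (Submodule.mem_sup_right (Submodule.mem_span_singleton_self ξ))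
  have hqp : ∀ q ∈ P, ∀ v, f (R.act (L.bracket q p) v) = 0 := fun q hq v => by
    rw [hx _ (L.bracket_odd_odd (hodd q hq) (hodd p hp)), hP.isotropic q hq p hp,
      h.relTheta_bracket hC hP hp hone hq, sub_zero, zero_mul]
  refine ⟨f ∘ₗ R.act p, fun h0 => hf ?_, i + 1, fun v => ?_, fun x hx0 v => ?_, fun q hq v => ?_⟩
  · ext v
    have h1 := congrArg f (R.odd_odd ξ h.mem p (hP.le hp) v)
    have h2 : f (R.act p (R.act ξ v)) = 0 := LinearMap.congr_fun h0 _
    rw [map_add, h2, hξ0, hx _ (L.bracket_odd_odd (hC.le h.mem) (hodd p hp)), hone,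
      h.relTheta_bracket_self hC (h.isPolarizing_sup hC hP hp hone) (hP.le hp)] at h1
    simpa using h1
  · have h1 := R.parity_odd p (hP.le hp) v
    rw [LinearMap.comp_apply, LinearMap.comp_apply, ← neg_eq_iff_eq_neg.2 h1, map_neg, hi, sgn_add]
    simp
  · have h1 := congrArg f (R.even_odd x hx0 p (hP.le hp) v)
    have h2 := hp' _ (Submodule.mem_sup_left (h.bracket_add_mem hC hP hp hone hx0)) v
    rw [map_sub, map_smul, LinearMap.sub_apply, LinearMap.smul_apply, map_sub, map_smul,
      sub_eq_zero] at h2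
    rw [h2, map_sub, hx x hx0, h.relTheta_sup hC hP hp hone hx0, smul_eq_mul] at h1
    simp only [LinearMap.comp_apply]
    linear_combination h1
  · have h0 : ∀ q ∈ P ⊓ L.orth lam (ℂ ∙ ξ), f (R.act p (R.act q v)) = 0 := fun q hq => by
      have h1 := congrArg f (R.odd_odd q (hP.le hq.1) p (hP.le hp) v)
      rw [hqp q hq.1, map_add, hp' q (Submodule.mem_sup_left hq), zero_add] at h1
      exact h1.symm
    have h1 := congrArg f (R.odd_odd p (hP.le hp) p (hP.le hp) v)
    rw [hqp p hp, map_add, ← two_mul] at h1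
    have h2 : f (R.act p (R.act p v)) = 0 := (mul_eq_zero.1 h1.symm).resolve_left two_ne_zero
    have h3 := h0 _ (sub_mem_left hp hone q hq)
    rwa [map_sub, map_smul, LinearMap.sub_apply, LinearMap.smul_apply, map_sub, map_sub, map_smul,
      map_smul, h2, smul_zero, sub_zero] at h3

/-- The subspace `M + ℂ ξ` is orthogonal to `B = C ∩ ξ^⊥`, so `ξ` kills `S` and `[ξ, ζ]` acts there
as the identity. Thus `ξ (s + ζ t) = t`, and an invariant subspace meeting `S` in zero is zero. -/
theorem extend_isGood [FiniteDimensional ℂ g] [FiniteDimensional ℂ S] (hC : L.IsStableOdd C)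
    (h : L.IsIsotropicWeight lam C ξ α) {R : RelRep L (C ⊓ L.orth lam (ℂ ∙ ξ)) S}
    (hR : R.IsGood lam) : ∃ R' : RelRep L C (S × S), R'.IsGood lam := by
  obtain ⟨ζ, hζ, hone⟩ := h.exists_dual hC
  have e := h.extension hC hζ hone
  have hM := maxInvariant_invariant (L := L) lam C
  have hJ := (hM.sup_span (hC.le h.mem) h.odd h.even).mono e.le
  have hJo : L.maxInvariant lam C ⊔ ℂ ∙ ξ ≤ L.orth lam (C ⊓ L.orth lam (ℂ ∙ ξ)) := by
    refine sup_le ((maxInvariant_le _ _).trans (orth_anti e.le))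
      ((Submodule.span_singleton_le_iff_mem _ _).2 fun b hb => ?_)
    rw [form_symm_odd (hC.le hb.1)]
    exact mem_orth_span.1 hb.2
  have hξJ : ξ ∈ L.maxInvariant lam C ⊔ ℂ ∙ ξ :=
    Submodule.mem_sup_right (Submodule.mem_span_singleton_self ξ)
  have hξB : ξ ∈ C ⊓ L.orth lam (ℂ ∙ ξ) := ⟨h.mem, mem_orth_span.2 h.isotropic⟩
  have hact : ∀ s, R.act ξ s = 0 := hR.act_odd _ hJ hJo ξ hξJ hξB
  have hξζ : L.bracket ξ ζ ∈ L.maxInvariant lam C := by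
    rw [L.symm_odd (hC.le h.mem) (hC.le hζ)]
    exact h.odd ζ hζ
  have hact2 : ∀ s, R.act (L.bracket ξ ζ) s = s := fun s => by
    rw [hR.act_even _ hJ hJo _ (Submodule.mem_sup_left hξζ)
      (L.bracket_odd_odd (hC.le h.mem) (hC.le hζ)), hone, one_smul]
  have hB : ∀ c ∈ C, c ∈ L.orth lam C → c ∈ C ⊓ L.orth lam (ℂ ∙ ξ) := fun c hc ho =>
    ⟨hc, mem_orth_span.2 (ho ξ h.mem)⟩
  have hPB : ∀ P, L.IsPolarizing lam C P → ξ ∈ P → P ≤ C ⊓ L.orth lam (ℂ ∙ ξ) :=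
    fun P hP hξ p hp => ⟨hP.le hp, mem_orth_span.2 (hP.isotropic ξ hξ p hp)⟩
  have hself : ∀ P : Submodule ℂ g, ξ ∈ P ⊓ L.orth lam (ℂ ∙ ξ) ⊔ ℂ ∙ ξ := fun P =>
    Submodule.mem_sup_right (Submodule.mem_span_singleton_self ξ)
  have hdim := finrank_eq_succ e.le e.zero e.mem e.one e.sub_mem
  have hnt := hR.nontrivial
  refine ⟨R.extend e, inferInstance, hR.extend_irreducible e ?_, ?_, ?_, ?_, ?_, ?_⟩
  · intro N _ hN1 h0
    refine (Submodule.eq_bot_iff _).2 fun v hv => ?_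
    have h4 := hN1 ξ h.mem v hv
    change R.extendAct ζ _ ξ v ∈ N at h4
    rw [RelRep.extendAct_odd e hξB, hact, hact, hact2, zero_add, neg_zero] at h4
    have h5 := h0 _ h4
    exact Prod.ext (h0 _ (by rw [← h5]; exact hv)) h5
  · exact fun J hJ hJo => (hR.extend_ideal e hB hJ hJo).1
  · exact fun J hJ hJo => (hR.extend_ideal e hB hJ hJo).2
  · intro P hP
    by_cases hξ : ξ ∈ P
    · exact hR.extend_vector e hP (hPB P hP hξ)
    · obtain ⟨p, hp, hpone⟩ := h.exists_mem_dual hC hP hξ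
      have hP' := h.isPolarizing_sup hC hP hp hpone
      exact h.exists_vector hC hP hp hpone _ (hR.extend_vector e hP' (hPB _ hP' (hself P)))
  · intro P hP
    by_cases hξ : ξ ∈ P
    · exact hR.extend_covector e hP (hPB P hP hξ)
    · obtain ⟨p, hp, hpone⟩ := h.exists_mem_dual hC hP hξ
      have hP' := h.isPolarizing_sup hC hP hp hpone
      exact h.exists_covector hC hP hp hpone _ (hR.extend_covector e hP' (hPB _ hP' (hself P)))
  · have key : ∀ P, L.IsPolarizing lam C P → ξ ∈ P →
        Module.finrank ℂ (S × S) * 2 ^ Module.finrank ℂ P = 2 ^ Module.finrank ℂ C := by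
      intro P hP hξ
      have := hR.finrank_eq P (hP.of_le (hPB P hP hξ) e.le)
      rw [Module.finrank_prod, hdim, pow_succ, ← this]
      ring
    intro P hP
    by_cases hξ : ξ ∈ P
    · exact key P hP hξ
    · obtain ⟨p, hp, hpone⟩ := h.exists_mem_dual hC hP hξ
      rw [← finrank_sup hC hP hp hpone]
      exact key _ (h.isPolarizing_sup hC hP hp hpone) (hself P)

end IsIsotropicWeight

/-- Every functional `lam` has an irreducible representation attached to it. -/
theorem exists_isGood [FiniteDimensional ℂ g] (hL : L.IsSolvable) (lam : L.evenCharacters)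
    (C : Submodule ℂ g) (hC : L.IsStableOdd C) :
    ∃ (V : Type) (_ : AddCommGroup V) (_ : Module ℂ V) (_ : FiniteDimensional ℂ V)
      (R : RelRep L C V), R.IsGood lam := by
  induction hn : Module.finrank ℂ C using Nat.strong_induction_on generalizing C with
  | _ n ih =>
    by_cases ho : C ≤ L.orth lam C
    · exact ⟨ℂ, inferInstance, inferInstance, inferInstance, _, charRep_isGood hC ho⟩
    rcases exists_isotropic_weight hL hC ho with ⟨ζ, hζ, hne, hrad⟩ | ⟨ξ, h1, h2, h3, h4, α, h5⟩
    · exact ⟨ℂ × ℂ, inferInstance, inferInstance, inferInstance,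
        exists_isGood_of_anisotropic hC hζ hne hrad⟩
    have h : L.IsIsotropicWeight lam C ξ α := ⟨h1, h2, h3, h4, h5⟩
    obtain ⟨ζ, hζ, hone⟩ := h.exists_dual hC
    have e := h.extension hC hζ hone
    have hdim := finrank_eq_succ e.le e.zero e.mem e.one e.sub_mem
    obtain ⟨S, _, _, _, R, hR⟩ := ih _ (by omega) _ e.stableB rfl
    exact ⟨S × S, inferInstance, inferInstance, inferInstance, h.extend_isGood hC hR⟩

end LieSuperalgebra

namespace SuperSpace

variable {V : Type*} [AddCommGroup V] [Module ℂ V] {S : SuperSpace V}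

theorem ofInvolution_parity {σ : V →ₗ[ℂ] V} {hσ : ∀ v, σ (σ v) = v} :
    (ofInvolution σ hσ).parity = σ :=
  (ofInvolution σ hσ).linearMap_ext_parts fun _ v hv => by
    rw [parity_of_mem _ hv, mem_ofInvolution.1 hv]

theorem isGraded_iff {N : Submodule ℂ V} : S.IsGraded N ↔ ∀ v ∈ N, S.parity v ∈ N := by
  refine ⟨fun h v hv => N.sub_mem (h.evenProj_mem hv) (h.oddProj_mem hv), fun h v hv => ?_⟩
  have he : S.evenProj v = (2⁻¹ : ℂ) • (v + S.parity v) := by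
    conv_rhs => enter [2, 1]; rw [← S.evenProj_add_oddProj v]
    rw [parity, LinearMap.sub_apply, add_add_sub_cancel, ← two_smul ℂ, smul_smul]
    norm_num
  have ho : S.oddProj v = (2⁻¹ : ℂ) • (v - S.parity v) := by
    conv_rhs => enter [2, 1]; rw [← S.evenProj_add_oddProj v]
    rw [parity, LinearMap.sub_apply, add_sub_sub_cancel, ← two_smul ℂ, smul_smul]
    norm_num
  rw [← S.evenProj_add_oddProj v]
  exact Submodule.add_mem_sup
    ⟨he ▸ N.smul_mem _ (N.add_mem hv (h v hv)), S.evenProj_mem v⟩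
    ⟨ho ▸ N.smul_mem _ (N.sub_mem hv (h v hv)), S.oddProj_mem v⟩

end SuperSpace

namespace LieSuperalgebra

variable {g : Type*} [AddCommGroup g] [Module ℂ g] {L : LieSuperalgebra g}

/-! # The invariant subspace generated by a vector -/

theorem isStableOdd_part_one : L.IsStableOdd (L.part 1) :=
  ⟨le_rfl, fun _ hx _ hy => L.bracket_even_odd hx hy⟩

/-- A representation of the subsuperalgebra formed by the even and the whole odd part is a
representation of the Lie superalgebra. -/
def RelRep.toModule {V : Type*} [AddCommGroup V] [Module ℂ V] (R : RelRep L (L.part 1) V) :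
    LieSupermodule L V where
  toSuperSpace := SuperSpace.ofInvolution R.parity R.parity_parity
  act := R.act
  act_mem i j x hx v hv := by
    rw [SuperSpace.mem_ofInvolution] at hv ⊢
    rcases zmod2_cases i with rfl | rfl
    · rw [R.parity_even x hx, hv, map_smul, zero_add]
    · rw [R.parity_odd x hx, hv, map_smul, sgn_add, sgn_one, neg_one_mul, neg_smul]
  act_bracket i j x hx y hy := by
    ext v
    rcases zmod2_cases i with rfl | rfl <;> rcases zmod2_cases j with rfl | rfl
    · simpa using R.even_even x hx y hy v
    · simpa using R.even_odd x hx y hy v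
    · have := R.even_odd y hy x hx v
      rw [L.skew_even_left hy, map_neg, LinearMap.neg_apply] at this
      simp [← neg_eq_iff_eq_neg.2 this.symm]
    · simpa using R.odd_odd x hx y hy v

theorem RelRep.toModule_parity {V : Type*} [AddCommGroup V] [Module ℂ V]
    (R : RelRep L (L.part 1) V) : R.toModule.parity = R.parity :=
  SuperSpace.ofInvolution_parity (hσ := R.parity_parity)

namespace Polarization

variable {lam : L.evenCharacters} (h : L.Polarization lam)

/-- An isotropic vector of `g₁` orthogonal to `h ∩ g₁` can be adjoined to it without losing
isotropy, so it already belongs to it. -/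
theorem isPolarizing : L.IsPolarizing lam (L.part 1) (h.carrier ⊓ L.part 1) := by
  refine ⟨inf_le_right, fun x hx p hp => ⟨h.bracket_mem' x (h.even_le hx) p hp.1,
    L.bracket_even_odd hx hp.2⟩, h.maximal.prop.2, fun q hq hqq hpq => ?_⟩
  refine h.maximal.le_of_ge (y := (h.carrier ⊓ L.part 1) ⊔ ℂ ∙ q)
    ⟨sup_le inf_le_right ((Submodule.span_singleton_le_iff_mem _ _).2 hq), ?_⟩ le_sup_left
    (Submodule.mem_sup_right (Submodule.mem_span_singleton_self q))
  intro x hx y hy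
  obtain ⟨a, ha, _, hb, rfl⟩ := Submodule.mem_sup.1 hx
  obtain ⟨b, rfl⟩ := Submodule.mem_span_singleton.1 hb
  obtain ⟨c, hc, _, hd, rfl⟩ := Submodule.mem_sup.1 hy
  obtain ⟨d, rfl⟩ := Submodule.mem_span_singleton.1 hd
  have h1 := hpq c hc
  rw [L.symm_odd hc.2 hq] at h1
  simp [h.maximal.prop.2 a ha c hc, hpq a ha, h1, hqq]

/-- Since `h` contains the even part, the traces of `ad x` on `g₀` cancel and the trace on `g / h`
is that on `g₁ / (h ∩ g₁)`. -/
theorem theta_eq [FiniteDimensional ℂ g] {x : g} (hx : x ∈ L.part 0) :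
    h.toSub.theta h.even_le x = L.relTheta (L.part 1) (h.carrier ⊓ L.part 1) x := by
  obtain ⟨p, hp⟩ := exists_isProj (h.carrier ⊓ L.part 1)
  have hodd : LinearMap.IsProj (L.part 1) L.oddProj := ⟨L.oddProj_mem, fun _ => L.oddProj_of_odd⟩
  have hq : LinearMap.IsProj (h.carrier ⊓ L.part 1) (p * L.oddProj) :=
    ⟨fun v => hp.map_mem _, fun v hv => by
      rw [Module.End.mul_apply, L.oddProj_of_odd hv.2, hp.map_id v hv]⟩
  have hH : LinearMap.IsProj h.carrier (L.evenProj + p * L.oddProj) :=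
    ⟨fun v => h.carrier.add_mem (h.even_le (L.evenProj_mem v)) (hp.map_mem _).1, fun v hv => by
      have := hp.map_id _ ⟨h.graded.oddProj_mem hv, L.oddProj_mem v⟩
      rw [LinearMap.add_apply, Module.End.mul_apply, this, L.evenProj_add_oddProj]⟩
  have hsum : L.bracket x = L.bracket x * L.evenProj + L.bracket x * L.oddProj := by
    ext v
    simp [← map_add, L.evenProj_add_oddProj]
  have htr := trace_mapQ (T := L.bracket x)
    (fun y hy => h.bracket_mem' x (h.even_le hx) y hy) hH
  rw [h.toSub.theta_even h.even_le hx, h.toSub.str_quot h.even_le, relTheta_apply,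
    adTrace_apply le_rfl (fun c hc => L.bracket_even_odd hx hc) hodd,
    adTrace_apply le_rfl (h.isPolarizing.bracket_mem x hx) hq]
  change (1 / 2 : ℂ) * -LinearMap.trace ℂ _ (h.carrier.mapQ h.carrier (L.bracket x)
    fun y hy => h.bracket_mem' x (h.even_le hx) y hy) = _
  rw [htr, mul_add, map_add]
  conv_lhs => enter [2, 1, 1]; rw [hsum, map_add]
  ring

end Polarization

/-- Adjoin to `B` a weight vector `ζ` of `g₁ / B` and replace `E` by `E + ζ E`: the dimension at
most doubles while `dim B` grows, and invariance follows from the commutation relations and `ζ ζ = ½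
[ζ, ζ]`. The factor `d` will be `2 ^ dim P`. The sign `ε` is `1` for a module and `-1` for the
transposed operators on its dual, where products are reversed. -/
theorem exists_invariant_finrank_le_aux [FiniteDimensional ℂ g] (hL : L.IsSolvable) {W : Type*}
    [AddCommGroup W] [Module ℂ W] (ρ : g →ₗ[ℂ] Module.End ℂ W) (ε : ℂ)
    (h01 : ∀ x ∈ L.part 0, ∀ y ∈ L.part 1, ∀ v,
      ρ x (ρ y v) = ρ y (ρ x v) + ε • ρ (L.bracket x y) v)
    (h11 : ∀ x ∈ L.part 1, ∀ y ∈ L.part 1, ∀ v,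
      ρ x (ρ y v) = ρ (L.bracket x y) v - ρ y (ρ x v)) (d n : ℕ) :
    ∀ B ≤ L.part 1, (∀ x ∈ L.part 0, ∀ b ∈ B, L.bracket x b ∈ B) →
    Module.finrank ℂ (L.part 1) ≤ Module.finrank ℂ B + n →
    ∀ E : Submodule ℂ W, FiniteDimensional ℂ E → (∀ x ∈ L.part 0, ∀ v ∈ E, ρ x v ∈ E) →
    (∀ b ∈ B, ∀ v ∈ E, ρ b v ∈ E) → Module.finrank ℂ E * d ≤ 2 ^ Module.finrank ℂ B →
    ∃ E' ≥ E, FiniteDimensional ℂ E' ∧ (∀ x ∈ L.part 0, ∀ v ∈ E', ρ x v ∈ E') ∧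
      (∀ y ∈ L.part 1, ∀ v ∈ E', ρ y v ∈ E') ∧
      Module.finrank ℂ E' * d ≤ 2 ^ Module.finrank ℂ (L.part 1) := by
  induction n with
  | zero =>
    intro B hB _ hn E _ hE0 hE1 hd
    obtain rfl := Submodule.eq_of_le_of_finrank_le hB hn
    exact ⟨E, le_rfl, inferInstance, hE0, hE1, hd⟩
  | succ n ih =>
    intro B hB hxB hn E hfin hE0 hE1 hd
    by_cases hBC : L.part 1 ≤ B
    · obtain rfl := le_antisymm hB hBC
      exact ⟨E, le_rfl, inferInstance, hE0, hE1, hd⟩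
    obtain ⟨ζ, hζ, hζB, γ, -, hγ⟩ := hL.exists_weight hxB
      (fun x hx c hc => L.bracket_even_odd hx hc) hBC
    have hbr : ∀ x ∈ L.part 0, L.bracket x ζ ∈ B ⊔ ℂ ∙ ζ := fun x hx => by
      rw [← sub_add_cancel (L.bracket x ζ) (γ x • ζ)]
      exact Submodule.add_mem_sup (hγ x hx)
        (Submodule.smul_mem _ _ (Submodule.mem_span_singleton_self ζ))
    have hlt : B < B ⊔ ℂ ∙ ζ := lt_of_le_of_ne le_sup_left fun h =>
      hζB (h ▸ Submodule.mem_sup_right (Submodule.mem_span_singleton_self ζ))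
    have hrank := Submodule.finrank_lt_finrank_of_lt hlt
    have hl : ∀ v ∈ E, v ∈ E ⊔ E.map (ρ ζ) := fun v hv => Submodule.mem_sup_left hv
    have hr : ∀ v ∈ E, ρ ζ v ∈ E ⊔ E.map (ρ ζ) := fun v hv =>
      Submodule.mem_sup_right (Submodule.mem_map_of_mem hv)
    have ext : ∀ T : Module.End ℂ W, (∀ v ∈ E, T v ∈ E ⊔ E.map (ρ ζ)) →
        (∀ v ∈ E, T (ρ ζ v) ∈ E ⊔ E.map (ρ ζ)) → ∀ v ∈ E ⊔ E.map (ρ ζ), T v ∈ E ⊔ E.map (ρ ζ) := by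
      intro T h1 h2 v hv
      obtain ⟨a, ha, _, ⟨b, hb, rfl⟩, rfl⟩ := Submodule.mem_sup.1 hv
      rw [map_add]
      exact Submodule.add_mem _ (h1 a ha) (h2 b hb)
    have hBE : ∀ b ∈ B ⊔ ℂ ∙ ζ, ∀ v ∈ E, ρ b v ∈ E ⊔ E.map (ρ ζ) := by
      intro b hb v hv
      obtain ⟨a, ha, _, hc, rfl⟩ := Submodule.mem_sup.1 hb
      obtain ⟨c, rfl⟩ := Submodule.mem_span_singleton.1 hc
      rw [map_add, map_smul]
      exact Submodule.add_mem _ (hl _ (hE1 a ha v hv)) (Submodule.smul_mem _ _ (hr v hv))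
    have hζE : ∀ v ∈ E, ρ ζ (ρ ζ v) ∈ E := fun v hv => by
      have h2 : (2 : ℂ) • ρ ζ (ρ ζ v) ∈ E := by
        rw [two_smul, eq_sub_iff_add_eq.1 (h11 ζ hζ ζ hζ v)]
        exact hE0 _ (L.bracket_odd_odd hζ hζ) v hv
      exact (E.smul_mem_iff two_ne_zero).1 h2
    have hle : B ⊔ ℂ ∙ ζ ≤ L.part 1 :=
      sup_le hB ((Submodule.span_singleton_le_iff_mem _ _).2 hζ)
    have H := ih (B ⊔ ℂ ∙ ζ) hle ?_ (by omega) (E ⊔ E.map (ρ ζ)) inferInstance ?_ ?_ ?_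
    · obtain ⟨E', hE', h⟩ := H
      exact ⟨E', le_sup_left.trans hE', h⟩
    · intro x hx b hb
      obtain ⟨a, ha, _, hc, rfl⟩ := Submodule.mem_sup.1 hb
      obtain ⟨c, rfl⟩ := Submodule.mem_span_singleton.1 hc
      rw [map_add, map_smul]
      exact Submodule.add_mem _ (Submodule.mem_sup_left (hxB x hx a ha))
        (Submodule.smul_mem _ _ (hbr x hx))
    · intro x hx
      refine ext _ (fun v hv => hl _ (hE0 x hx v hv)) fun v hv => ?_
      rw [h01 x hx ζ hζ]
      exact Submodule.add_mem _ (hr _ (hE0 x hx v hv))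
        (Submodule.smul_mem _ _ (hBE _ (hbr x hx) v hv))
    · intro b hb
      refine ext _ (hBE b hb) fun v hv => ?_
      obtain ⟨a, ha, _, hc, rfl⟩ := Submodule.mem_sup.1 hb
      obtain ⟨c, rfl⟩ := Submodule.mem_span_singleton.1 hc
      rw [map_add, map_smul, LinearMap.add_apply, LinearMap.smul_apply, h11 a (hB ha) ζ hζ]
      exact Submodule.add_mem _ (Submodule.sub_mem _
        (hl _ (hE0 _ (L.bracket_odd_odd (hB ha) hζ) v hv)) (hr _ (hE1 a ha v hv)))
        (Submodule.smul_mem _ _ (hl _ (hζE v hv)))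
    · calc Module.finrank ℂ ↥(E ⊔ E.map (ρ ζ)) * d ≤ (2 * Module.finrank ℂ E) * d := by
            gcongr
            have h1 := Submodule.finrank_add_le_finrank_add_finrank E (E.map (ρ ζ))
            have h2 := Submodule.finrank_map_le (ρ ζ) E
            omega
        _ ≤ 2 ^ (Module.finrank ℂ B + 1) := by rw [pow_succ, mul_assoc]; omega
        _ ≤ _ := Nat.pow_le_pow_right two_pos hrank

/-- Let `part 0` and `part 1` act in `W` by operators satisfying the commutation relations, and
let `w` be an eigenvector of the even part annihilated by `P`. Then `w` lies in an invariant
subspace of dimension at most `2 ^ (dim part 1 - dim P)`. -/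
theorem exists_invariant_finrank_le [FiniteDimensional ℂ g] (hL : L.IsSolvable) {W : Type*}
    [AddCommGroup W] [Module ℂ W] (ρ : g →ₗ[ℂ] Module.End ℂ W) (ε : ℂ)
    (h01 : ∀ x ∈ L.part 0, ∀ y ∈ L.part 1, ∀ v,
      ρ x (ρ y v) = ρ y (ρ x v) + ε • ρ (L.bracket x y) v)
    (h11 : ∀ x ∈ L.part 1, ∀ y ∈ L.part 1, ∀ v,
      ρ x (ρ y v) = ρ (L.bracket x y) v - ρ y (ρ x v))
    {P : Submodule ℂ g} (hP : P ≤ L.part 1) (hxP : ∀ x ∈ L.part 0, ∀ p ∈ P, L.bracket x p ∈ P)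
    (w : W) (hw : ∀ x ∈ L.part 0, ρ x w ∈ ℂ ∙ w) (hPw : ∀ p ∈ P, ρ p w = 0) :
    ∃ E : Submodule ℂ W, w ∈ E ∧ FiniteDimensional ℂ E ∧ (∀ x, ∀ v ∈ E, ρ x v ∈ E) ∧
      Module.finrank ℂ E * 2 ^ Module.finrank ℂ P ≤ 2 ^ Module.finrank ℂ (L.part 1) := by
  obtain ⟨E, hE, hfin, h0, h1, hd⟩ := exists_invariant_finrank_le_aux hL ρ ε h01 h11
    (2 ^ Module.finrank ℂ P) _ P hP hxP (Nat.le_add_left _ _) (ℂ ∙ w) inferInstance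
    (fun x hx v hv => by
      obtain ⟨c, rfl⟩ := Submodule.mem_span_singleton.1 hv
      rw [map_smul]
      exact Submodule.smul_mem _ _ (hw x hx))
    (fun p hp v hv => by
      obtain ⟨c, rfl⟩ := Submodule.mem_span_singleton.1 hv
      rw [map_smul, hPw p hp, smul_zero]
      exact Submodule.zero_mem _)
    (Nat.mul_le_of_le_div _ _ _ (by
      rw [Nat.div_self (by positivity)]
      exact (finrank_span_le_card {w}).trans (by simp)))
  refine ⟨E, hE (Submodule.mem_span_singleton_self w), hfin, fun x v hv => ?_, hd⟩
  rw [← L.evenProj_add_oddProj x, map_add]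
  exact E.add_mem (h0 _ (L.evenProj_mem x) v hv) (h1 _ (L.oddProj_mem x) v hv)

end LieSuperalgebra

namespace LieSupermodule

variable {g : Type*} [AddCommGroup g] [Module ℂ g] {L : LieSuperalgebra g}
variable {V : Type*} [AddCommGroup V] [Module ℂ V]
variable {W : Type*} [AddCommGroup W] [Module ℂ W]
variable {X : Type*} [AddCommGroup X] [Module ℂ X]

/-! # Homogeneous isomorphisms -/

/-- Isomorphism by a homogeneous map, even or odd, that commutes with the action. -/
def HomogeneousIso (M : LieSupermodule L V) (M' : LieSupermodule L W) : Prop :=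
  ∃ (i : ZMod 2) (e : V ≃ₗ[ℂ] W), (∀ v, M'.parity (e v) = sgn i • e (M.parity v)) ∧
    ∀ x v, e (M.act x v) = M'.act x (e v)

namespace HomogeneousIso

variable {M : LieSupermodule L V} {M' : LieSupermodule L W} {M'' : LieSupermodule L X}

theorem symm (h : M.HomogeneousIso M') : M'.HomogeneousIso M := by
  obtain ⟨i, e, h1, h2⟩ := h
  refine ⟨i, e.symm, fun v => e.injective ?_, fun x v => e.injective ?_⟩
  · have := h1 (e.symm v)
    rw [e.apply_symm_apply] at this
    rw [map_smul, e.apply_symm_apply, this, smul_smul, sgn_mul_self, one_smul]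
  · rw [h2, e.apply_symm_apply, e.apply_symm_apply]

theorem trans (h : M.HomogeneousIso M') (h' : M'.HomogeneousIso M'') : M.HomogeneousIso M'' := by
  obtain ⟨i, e, h1, h2⟩ := h
  obtain ⟨j, e', h1', h2'⟩ := h'
  refine ⟨j + i, e.trans e', fun v => ?_, fun x v => ?_⟩
  · simp only [LinearEquiv.trans_apply, h1', h1, map_smul, smul_smul, sgn_add]
  · simp only [LinearEquiv.trans_apply, h2', h2]

theorem isoUpToParity (h : M.HomogeneousIso M') : M.IsoUpToParity M' := by
  obtain ⟨i, e, h1, h2⟩ := h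
  rcases zmod2_cases i with rfl | rfl
  · refine Or.inl ⟨e, fun j v hv => M'.mem_part_iff.2 ?_, h2⟩
    rw [h1, M.parity_of_mem hv, map_smul, sgn_zero, one_smul]
  -- An odd intertwiner becomes even as a map to `Π M'` after composition with the parity operator,
  -- which also accounts for the sign in the action on `Π M'`.
  · refine Or.inr ⟨(LinearEquiv.ofInvolutive M.parity M.parity_parity).trans e,
      fun j v hv => M'.mem_part_iff.2 ?_, fun x v => ?_⟩
    · change M'.parity (e (M.parity v)) = sgn (j + 1) • e (M.parity v)
      rw [h1, M.parity_parity, M.parity_of_mem hv, map_smul, smul_smul, sgn_add, mul_right_comm,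
        sgn_mul_self, one_mul]
    · change e (M.parity (M.act x v)) = M'.act (L.parity x) (e (M.parity v))
      rw [M.parity_act, h2]

theorem isIrreducible (h : M.HomogeneousIso M') (hM : M'.IsIrreducible) : M.IsIrreducible := by
  obtain ⟨i, e, h1, h2⟩ := h
  obtain ⟨hn, hirr⟩ := hM
  refine ⟨e.toEquiv.nontrivial, fun N hN hst => ?_⟩
  rw [SuperSpace.isGraded_iff] at hN
  have key := hirr (N.map e.toLinearMap) (SuperSpace.isGraded_iff.2 ?_) ?_
  · rw [← Submodule.map_eq_top_iff (e := e), ← Submodule.map_eq_bot_iff (e := e)]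
    exact key
  · rintro _ ⟨v, hv, rfl⟩
    change M'.parity (e v) ∈ _
    rw [h1]
    exact Submodule.smul_mem _ _ (Submodule.mem_map_of_mem (hN v hv))
  · rintro x _ ⟨v, hv, rfl⟩
    change M'.act x (e v) ∈ _
    rw [← h2]
    exact Submodule.mem_map_of_mem (hst x v hv)

end HomogeneousIso

theorem envAct_ι (M : LieSupermodule L V) (x : g) : M.envAct (L.ι x) = M.act x :=
  L.lift_ι _ _ x

theorem act_even_odd (M : LieSupermodule L V) {x y : g} (hx : x ∈ L.part 0) (hy : y ∈ L.part 1)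
    (v : V) : M.act x (M.act y v) = M.act y (M.act x v) + M.act (L.bracket x y) v := by
  simp [M.act_bracket 0 1 x hx y hy]

theorem act_odd_odd (M : LieSupermodule L V) {x y : g} (hx : x ∈ L.part 1) (hy : y ∈ L.part 1)
    (v : V) : M.act x (M.act y v) = M.act (L.bracket x y) v - M.act y (M.act x v) := by
  simp [M.act_bracket 1 1 x hx y hy]

theorem ofCharacter_parity (χ : Module.Dual ℂ g) (hodd : ∀ x ∈ L.part 1, χ x = 0)
    (hbr : ∀ x y, χ (L.bracket x y) = 0) (w : ℂ) : (ofCharacter L χ hodd hbr).parity w = w := by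
  rw [SuperSpace.parity_of_mem (i := 0) _ (by simp [ofCharacter]), sgn_zero, one_smul]

/-! # Maps from induced and to coinduced representations -/

section

variable {h : L.Sub} {M : LieSupermodule L V} {N : LieSupermodule h.toLie ℂ}

theorem envAct_eigenvector {v : V} (hv : ∀ a : h.carrier, M.act a v = N.act a 1 • v)
    (a : h.toLie.Env) : M.envAct (h.envMap a) v = N.envAct a 1 • v := by
  induction a using h.toLie.env_induction with
  | hc c => simp [Algebra.algebraMap_eq_smul_one]
  | hι x => rw [h.envMap_ι, envAct_ι, envAct_ι, hv]
  | hm a b ha hb =>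
    have : N.envAct a (N.envAct b 1) = N.envAct b 1 • N.envAct a 1 := by
      rw [← map_smul, smul_eq_mul, mul_one]
    rw [map_mul, map_mul, map_mul, Module.End.mul_apply, Module.End.mul_apply, hb, map_smul, ha,
      this, smul_smul, smul_eq_mul]
  | ha a b ha hb => simp only [map_add, LinearMap.add_apply, ha, hb, add_smul]

theorem envAct_eigencovector {f : Module.Dual ℂ V}
    (hf : ∀ (a : h.carrier) v, f (M.act a v) = N.act a (f v))
    (a : h.toLie.Env) (v : V) : f (M.envAct (h.envMap a) v) = N.envAct a (f v) := by
  induction a using h.toLie.env_induction generalizing v with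
  | hc c => simp [Algebra.algebraMap_eq_smul_one]
  | hι x => rw [h.envMap_ι, envAct_ι, envAct_ι, hf]
  | hm a b ha hb => simp only [map_mul, Module.End.mul_apply, ha, hb]
  | ha a b ha hb => simp only [map_add, LinearMap.add_apply, ha, hb]

theorem envAct_mem {E : Submodule ℂ V} (hE : ∀ x, ∀ v ∈ E, M.act x v ∈ E) (u : L.Env) :
    ∀ v ∈ E, M.envAct u v ∈ E := by
  induction u using L.env_induction with
  | hc c => exact fun v hv => by simpa [Algebra.algebraMap_eq_smul_one] using E.smul_mem c hv
  | hι x => exact fun v hv => by rw [envAct_ι]; exact hE x v hv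
  | hm a b ha hb => exact fun v hv => by rw [map_mul]; exact ha _ (hb v hv)
  | ha a b ha hb => exact fun v hv => by rw [map_add]; exact E.add_mem (ha v hv) (hb v hv)

/-- The map `u ⊗ w ↦ w • u v` from the induced representation of a character. -/
def indLift {v : V} (hv : ∀ a : h.carrier, M.act a v = N.act a 1 • v) : IndSpace h N →ₗ[ℂ] V :=
  (balanced h N).liftQ (TensorProduct.lift
      ((LinearMap.lsmul ℂ V).flip ∘ₗ LinearMap.applyₗ v ∘ₗ M.envAct.toLinearMap)) (by
    rw [balanced, Submodule.span_le]
    rintro _ ⟨u, a, w, rfl⟩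
    have h1 : N.envAct a w = w • N.envAct a 1 := by rw [← map_smul, smul_eq_mul, mul_one]
    rw [SetLike.mem_coe, LinearMap.mem_ker, map_sub, sub_eq_zero, TensorProduct.lift.tmul,
      TensorProduct.lift.tmul]
    change w • M.envAct (u * h.envMap a) v = N.envAct a w • M.envAct u v
    rw [map_mul, Module.End.mul_apply, envAct_eigenvector hv, map_smul, h1, smul_smul, smul_eq_mul])

theorem indLift_mk {v : V} (hv : ∀ a : h.carrier, M.act a v = N.act a 1 • v) (u : L.Env) (w : ℂ) :
    indLift hv ((balanced h N).mkQ (u ⊗ₜ w)) = w • M.envAct u v := rfl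

theorem ind_act_mk (x : g) (u : L.Env) (w : ℂ) :
    (ind h N).act x ((balanced h N).mkQ (u ⊗ₜ w)) = (balanced h N).mkQ ((L.ι x * u) ⊗ₜ w) :=
  indMul_mk h N (L.ι x) u w

theorem envAct_ind_mk (u u' : L.Env) (w : ℂ) :
    (ind h N).envAct u ((balanced h N).mkQ (u' ⊗ₜ w)) = (balanced h N).mkQ ((u * u') ⊗ₜ w) := by
  induction u using L.env_induction generalizing u' with
  | hc c =>
    simp only [Algebra.algebraMap_eq_smul_one, map_smul, map_one, LinearMap.smul_apply,
      Module.End.one_apply, smul_mul_assoc, one_mul, ← TensorProduct.smul_tmul']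
  | hι x => rw [envAct_ι, ind_act_mk]
  | hm a b ha hb => rw [map_mul, Module.End.mul_apply, hb, ha, mul_assoc]
  | ha a b ha hb =>
    rw [map_add, LinearMap.add_apply, ha, hb, add_mul, TensorProduct.add_tmul, map_add]

theorem indLift_act {v : V} (hv : ∀ a : h.carrier, M.act a v = N.act a 1 • v) (x : g)
    (t : IndSpace h N) : indLift hv ((ind h N).act x t) = M.act x (indLift hv t) := by
  have : indLift hv ∘ₗ (ind h N).act x = M.act x ∘ₗ indLift hv := ind_ext fun u w => by
    rw [LinearMap.comp_apply, LinearMap.comp_apply, ind_act_mk, indLift_mk, indLift_mk, map_mul,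
      envAct_ι, map_smul, Module.End.mul_apply]
  exact LinearMap.congr_fun this t

theorem indLift_parity (hN : ∀ w, N.parity w = w) {v : V} {i : ZMod 2} (hi : M.parity v = sgn i • v)
    (hv : ∀ a : h.carrier, M.act a v = N.act a 1 • v) (t : IndSpace h N) :
    M.parity (indLift hv t) = sgn i • indLift hv ((ind h N).parity t) := by
  have : M.parity ∘ₗ indLift hv = sgn i • indLift hv ∘ₗ indParity h N := ind_ext fun u w => by
    rw [LinearMap.comp_apply, LinearMap.smul_apply, LinearMap.comp_apply, indParity_mk, indLift_mk,
      indLift_mk, map_smul, M.parity_envAct, hi, map_smul, hN, smul_comm]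
  rw [ind, SuperSpace.ofInvolution_parity]
  exact LinearMap.congr_fun this t

/-- The image is a graded invariant subspace containing `v`. -/
theorem indLift_surjective (hN : ∀ w, N.parity w = w) (hM : M.IsIrreducible) {v : V} (hv0 : v ≠ 0)
    {i : ZMod 2} (hi : M.parity v = sgn i • v)
    (hv : ∀ a : h.carrier, M.act a v = N.act a 1 • v) : Function.Surjective (indLift hv) := by
  rw [← LinearMap.range_eq_top]
  refine (hM.2 _ (SuperSpace.isGraded_iff.2 ?_) ?_).resolve_left fun hbot => hv0 ?_
  · rintro _ ⟨t, rfl⟩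
    rw [indLift_parity hN hi]
    exact Submodule.smul_mem _ _ ⟨_, rfl⟩
  · rintro x _ ⟨t, rfl⟩
    exact ⟨_, indLift_act hv x t⟩
  · rw [← Submodule.mem_bot ℂ, ← hbot]
    exact ⟨(balanced h N).mkQ (1 ⊗ₜ 1), by rw [indLift_mk, map_one, one_smul]; rfl⟩

/-- The map `v ↦ (u ↦ f (u v))` to the coinduced representation of a character. -/
def coindLift {f : Module.Dual ℂ V} (hf : ∀ (a : h.carrier) v, f (M.act a v) = N.act a (f v)) :
    V →ₗ[ℂ] coindSpace h N :=
  LinearMap.codRestrict _ (LinearMap.compRight ℂ f ∘ₗ M.envAct.toLinearMap.flip) fun v a u => by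
    simp [envAct_eigencovector hf]

theorem coindLift_apply {f : Module.Dual ℂ V}
    (hf : ∀ (a : h.carrier) v, f (M.act a v) = N.act a (f v)) (v : V) (u : L.Env) :
    (coindLift hf v).1 u = f (M.envAct u v) := rfl

theorem coindLift_act {f : Module.Dual ℂ V}
    (hf : ∀ (a : h.carrier) v, f (M.act a v) = N.act a (f v)) (x : g) (v : V) :
    coindLift hf (M.act x v) = (coind h N).act x (coindLift hf v) := by
  refine Subtype.ext (LinearMap.ext fun u => ?_)
  change f (M.envAct u (M.act x v)) = f (M.envAct (u * L.ι x) v)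
  rw [map_mul, envAct_ι, Module.End.mul_apply]

theorem coindLift_parity (hN : ∀ w, N.parity w = w) {f : Module.Dual ℂ V} {i : ZMod 2}
    (hi : ∀ v, f (M.parity v) = sgn i • f v)
    (hf : ∀ (a : h.carrier) v, f (M.act a v) = N.act a (f v)) (v : V) :
    (coind h N).parity (coindLift hf v) = sgn i • coindLift hf (M.parity v) := by
  rw [coind, SuperSpace.ofInvolution_parity]
  refine Subtype.ext (LinearMap.ext fun u => ?_)
  change N.parity (f (M.envAct (L.envParity u) v)) = sgn i • f (M.envAct u (M.parity v))
  have := M.parity_envAct (L.envParity u) v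
  rw [L.envParity_envParity] at this
  rw [hN, ← this, hi, smul_smul, sgn_mul_self, one_smul]

/-- The kernel is a graded invariant subspace contained in the kernel of `f`, as evaluation at `1`
shows. -/
theorem coindLift_injective (hN : ∀ w, N.parity w = w) (hM : M.IsIrreducible)
    {f : Module.Dual ℂ V} (hf0 : f ≠ 0) {i : ZMod 2} (hi : ∀ v, f (M.parity v) = sgn i • f v)
    (hf : ∀ (a : h.carrier) v, f (M.act a v) = N.act a (f v)) :
    Function.Injective (coindLift hf) := by
  rw [← LinearMap.ker_eq_bot]
  refine (hM.2 _ (SuperSpace.isGraded_iff.2 fun v hv => ?_) fun x v hv => ?_).resolve_right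
    fun htop => hf0 (LinearMap.ext fun v => ?_)
  · rw [LinearMap.mem_ker] at hv ⊢
    have := coindLift_parity hN hi hf v
    rw [hv, map_zero] at this
    have h2 := congrArg (sgn i • ·) this.symm
    simpa [smul_smul, sgn_mul_self] using h2
  · rw [LinearMap.mem_ker] at hv ⊢
    rw [coindLift_act, hv, map_zero]
  · have h1 : v ∈ LinearMap.ker (coindLift hf) := htop ▸ Submodule.mem_top
    have h2 := coindLift_apply hf v 1
    rw [LinearMap.mem_ker.1 h1, map_one M.envAct] at h2
    exact h2.symm

end

end LieSupermodule

namespace LieSuperalgebra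

variable {g : Type*} [AddCommGroup g] [Module ℂ g] {L : LieSuperalgebra g}

/-! # Twisted induced and coinduced representations -/

open LieSupermodule

/-- Evaluation embeds `W` into the dual of `E`; in particular `W` need not be known to be
finite-dimensional beforehand. -/
theorem finrank_le_of_separating {W : Type*} [AddCommGroup W] [Module ℂ W]
    (E : Submodule ℂ (Module.Dual ℂ W)) [FiniteDimensional ℂ E]
    (hE : ∀ w, (∀ f ∈ E, f w = 0) → w = 0) :
    FiniteDimensional ℂ W ∧ Module.finrank ℂ W ≤ Module.finrank ℂ E := by
  have hinj : Function.Injective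
      (LinearMap.lcomp ℂ ℂ E.subtype ∘ₗ Module.Dual.eval ℂ W : W →ₗ[ℂ] Module.Dual ℂ E) := by
    rw [← LinearMap.ker_eq_bot, LinearMap.ker_eq_bot']
    exact fun w hw => hE w fun f hf => LinearMap.congr_fun hw ⟨f, hf⟩
  have hle := LinearMap.finrank_le_finrank_of_injective hinj
  rw [Subspace.dual_finrank_eq] at hle
  exact ⟨FiniteDimensional.of_injective _ hinj, hle⟩

namespace Polarization

variable {lam : L.evenCharacters} (h : L.Polarization lam)

theorem character_act (c : ℂ) (a : h.carrier) (w : ℂ) : (h.character c).act a w =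
    ((lam : Module.Dual ℂ g) a + c * h.toSub.theta h.even_le a) * w := rfl

theorem character_parity (c w : ℂ) : (h.character c).parity w = w :=
  ofCharacter_parity _ _ _ w

/-- Equations between linear maps on `h` are checked on the even part and on the odd part. -/
theorem linearMap_ext {X : Type*} [AddCommGroup X] [Module ℂ X] {f f' : g →ₗ[ℂ] X}
    (h0 : ∀ x ∈ L.part 0, f x = f' x) (h1 : ∀ p ∈ h.carrier ⊓ L.part 1, f p = f' p)
    (a : h.carrier) : f a = f' a := by
  rw [← L.evenProj_add_oddProj a, map_add, map_add, h0 _ (L.evenProj_mem _),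
    h1 _ ⟨h.graded.oddProj_mem a.2, L.oddProj_mem _⟩]

theorem character_odd (c : ℂ) {p : g} (hp : p ∈ h.carrier ⊓ L.part 1) :
    (lam : Module.Dual ℂ g) p + c * h.toSub.theta h.even_le p = 0 := by
  rw [evenCharacters_odd lam hp.2, h.toSub.theta_odd h.even_le hp.2, mul_zero, add_zero]

theorem exists_act_eq [FiniteDimensional ℂ g] {V : Type*} [AddCommGroup V] [Module ℂ V]
    {R : RelRep L (L.part 1) V} (hR : R.IsGood lam) :
    ∃ v ≠ 0, ∃ i, R.toModule.parity v = sgn i • v ∧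
      ∀ a : h.carrier, R.toModule.act a v = (h.character 1).act a 1 • v := by
  obtain ⟨v, hv, i, hi, h0, h1⟩ := hR.exists_vector _ h.isPolarizing
  refine ⟨v, hv, i, by rw [R.toModule_parity, hi], fun a => ?_⟩
  have key := h.linearMap_ext (f := R.act.flip v)
    (f' := ((lam : Module.Dual ℂ g) + (1 : ℂ) • h.toSub.theta h.even_le).smulRight v)
    (fun x hx => ?_) (fun p hp => ?_) a
  · rw [character_act, mul_one]
    exact key
  · change R.act x v = ((lam : Module.Dual ℂ g) x + 1 * h.toSub.theta h.even_le x) • v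
    rw [h0 x hx, h.theta_eq hx, one_mul]
  · change R.act p v = ((lam : Module.Dual ℂ g) p + 1 * h.toSub.theta h.even_le p) • v
    rw [h1 p hp, h.character_odd 1 hp, zero_smul]

theorem exists_covector_act_eq [FiniteDimensional ℂ g] {V : Type*} [AddCommGroup V] [Module ℂ V]
    {R : RelRep L (L.part 1) V} (hR : R.IsGood lam) :
    ∃ f : Module.Dual ℂ V, f ≠ 0 ∧ ∃ i, (∀ v, f (R.toModule.parity v) = sgn i • f v) ∧
      ∀ (a : h.carrier) v, f (R.toModule.act a v) = (h.character (-1)).act a (f v) := by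
  obtain ⟨f, hf, i, hi, h0, h1⟩ := hR.exists_covector _ h.isPolarizing
  refine ⟨f, hf, i, fun v => by rw [R.toModule_parity, hi], fun a v => ?_⟩
  refine h.linearMap_ext (f := f ∘ₗ R.act.flip v)
    (f' := ((lam : Module.Dual ℂ g) + (-1 : ℂ) • h.toSub.theta h.even_le).smulRight (f v))
    (fun x hx => ?_) (fun p hp => ?_) a
  · change f (R.act x v) = ((lam : Module.Dual ℂ g) x + -1 * h.toSub.theta h.even_le x) * f v
    rw [h0 x hx, h.theta_eq hx, neg_one_mul, sub_eq_add_neg]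
  · change f (R.act p v) = ((lam : Module.Dual ℂ g) p + -1 * h.toSub.theta h.even_le p) * f v
    rw [h1 p hp, h.character_odd (-1) hp, zero_mul]

theorem isGood_isIrreducible {V : Type*} [AddCommGroup V] [Module ℂ V]
    {R : RelRep L (L.part 1) V} (hR : R.IsGood lam) : R.toModule.IsIrreducible := by
  refine ⟨hR.nontrivial, fun N hN hst => hR.irreducible N (fun v hv => ?_)
    (fun x _ => hst x) (fun x _ => hst x)⟩
  rw [← R.toModule_parity]
  exact SuperSpace.isGraded_iff.1 hN v hv

/-- The dimension of the twisted induced representation is at most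
`2 ^ (dim part 1 - dim (h ⊓ part 1))`. -/
theorem twistedInd_finrank_le [FiniteDimensional ℂ g] (hL : L.IsSolvable) :
    FiniteDimensional ℂ (IndSpace h.toSub (h.character 1)) ∧
      Module.finrank ℂ (IndSpace h.toSub (h.character 1)) *
        2 ^ Module.finrank ℂ ↥(h.carrier ⊓ L.part 1) ≤ 2 ^ Module.finrank ℂ (L.part 1) := by
  set mk := (balanced h.toSub (h.character 1)).mkQ with hmk
  have hchar : ∀ a : h.carrier, h.twistedInd.act a (mk (1 ⊗ₜ 1)) =
      ((lam : Module.Dual ℂ g) a + 1 * h.toSub.theta h.even_le a) • mk (1 ⊗ₜ 1) := fun a => by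
    have h1 : mk ((1 * h.toSub.envMap (h.toSub.toLie.ι a)) ⊗ₜ (1 : ℂ)) =
        mk (1 ⊗ₜ (h.character 1).envAct (h.toSub.toLie.ι a) 1) :=
      (Submodule.Quotient.eq _).2 (Submodule.subset_span ⟨1, _, 1, rfl⟩)
    rw [h.toSub.envMap_ι, envAct_ι, character_act, one_mul, mul_one] at h1
    rw [twistedInd, hmk, ind_act_mk, mul_one, ← hmk, h1, ← map_smul,
      ← TensorProduct.tmul_smul, smul_eq_mul, mul_one]
  obtain ⟨E, hE, hfin, hst, hd⟩ := exists_invariant_finrank_le hL h.twistedInd.act 1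
    (fun x hx y hy v => by rw [one_smul, act_even_odd _ hx hy])
    (fun x hx y hy v => act_odd_odd _ hx hy v) inf_le_right
    h.isPolarizing.bracket_mem (mk (1 ⊗ₜ 1))
    (fun x hx => by
      rw [hchar ⟨x, h.even_le hx⟩]
      exact Submodule.smul_mem _ _ (Submodule.mem_span_singleton_self _))
    (fun p hp => by
      rw [hchar ⟨p, hp.1⟩, h.character_odd 1 hp, zero_smul])
  have htop : E = ⊤ := by
    rw [eq_top_iff]
    rintro t -
    obtain ⟨t, rfl⟩ := (balanced h.toSub (h.character 1)).mkQ_surjective t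
    induction t with
    | zero => rw [map_zero]; exact E.zero_mem
    | add a b ha hb => rw [map_add]; exact E.add_mem ha hb
    | tmul u w =>
      have h1 := envAct_mem hst u _ hE
      rw [twistedInd, hmk, envAct_ind_mk, mul_one] at h1
      have h2 : u ⊗ₜ[ℂ] w = w • (u ⊗ₜ[ℂ] (1 : ℂ)) := by
        rw [← TensorProduct.tmul_smul, smul_eq_mul, mul_one]
      rw [h2, map_smul]
      exact E.smul_mem w h1
  subst htop
  exact ⟨Module.finite_def.2 ((Submodule.fg_top _).1 (Module.finite_def.1 hfin)),
    by rwa [finrank_top] at hd⟩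

/-- The dimension of the twisted coinduced representation is at most
`2 ^ (dim part 1 - dim (h ⊓ part 1))`. -/
theorem twistedCoind_finrank_le [FiniteDimensional ℂ g] (hL : L.IsSolvable) :
    FiniteDimensional ℂ (coindSpace h.toSub (h.character (-1))) ∧
      Module.finrank ℂ (coindSpace h.toSub (h.character (-1))) *
        2 ^ Module.finrank ℂ ↥(h.carrier ⊓ L.part 1) ≤ 2 ^ Module.finrank ℂ (L.part 1) := by
  -- The bound is applied in the dual space: evaluation at `1` is an eigenvector of the transposed
  -- action of `h`, while the coinduced representation has no evident generator.
  set ε : Module.Dual ℂ (coindSpace h.toSub (h.character (-1))) :=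
    LinearMap.applyₗ 1 ∘ₗ Submodule.subtype _
  have hchar : ∀ (a : h.carrier) f, ε (h.twistedCoind.act a f) =
      ((lam : Module.Dual ℂ g) a + -1 * h.toSub.theta h.even_le a) * ε f := fun a f => by
    have h1 := f.2 (h.toSub.toLie.ι a) 1
    rw [h.toSub.envMap_ι, envAct_ι, character_act, mul_one] at h1
    refine Eq.trans ?_ h1
    change f.1 (1 * L.ι a) = _
    rw [one_mul]
  obtain ⟨E, hE, hfin, hst, hd⟩ := exists_invariant_finrank_le hL
    (Module.Dual.transpose (R := ℂ) ∘ₗ h.twistedCoind.act) (-1)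
    (fun x hx y hy τ => LinearMap.ext fun f => by
      change τ (h.twistedCoind.act y (h.twistedCoind.act x f)) =
        τ (h.twistedCoind.act x (h.twistedCoind.act y f)) +
          -1 * τ (h.twistedCoind.act (L.bracket x y) f)
      rw [act_even_odd _ hx hy, map_add]
      ring)
    (fun x hx y hy τ => LinearMap.ext fun f => by
      change τ (h.twistedCoind.act y (h.twistedCoind.act x f)) =
        τ (h.twistedCoind.act (L.bracket x y) f) -
          τ (h.twistedCoind.act x (h.twistedCoind.act y f))
      rw [act_odd_odd _ hx hy, map_sub]
      ring)
    inf_le_right h.isPolarizing.bracket_mem ε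
    (fun x hx => Submodule.mem_span_singleton.2 ⟨_, LinearMap.ext fun f =>
      (hchar ⟨x, h.even_le hx⟩ f).symm⟩)
    (fun p hp => LinearMap.ext fun f => by
      change ε (h.twistedCoind.act p f) = 0
      rw [hchar ⟨p, hp.1⟩, h.character_odd (-1) hp, zero_mul])
  have hu : ∀ u : L.Env, ∀ τ ∈ E, τ ∘ₗ coindMulHom h.toSub (h.character (-1)) u ∈ E := by
    intro u
    induction u using L.env_induction with
    | hc c =>
      intro τ hτ
      convert E.smul_mem c hτ using 1
      ext f
      simp [Algebra.algebraMap_eq_smul_one]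
    | hι x => exact hst x
    | hm a b ha hb =>
      intro τ hτ
      rw [map_mul]
      exact hb _ (ha τ hτ)
    | ha a b ha hb =>
      intro τ hτ
      rw [map_add, LinearMap.comp_add]
      exact E.add_mem (ha τ hτ) (hb τ hτ)
  -- The value `f u` is the value at `1` of `u f`, so the functionals in `E` separate points.
  obtain ⟨hfd, hle⟩ := finrank_le_of_separating E fun f hf =>
    Subtype.ext (LinearMap.ext fun u => by
      have h1 : f.1 (1 * u) = 0 := hf _ (hu u ε hE)
      rwa [one_mul] at h1)
  exact ⟨hfd, (Nat.mul_le_mul_right _ hle).trans hd⟩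

/-- The model is a quotient of the induced representation, and its dimension equals the upper bound
for the latter. -/
theorem twistedInd_homogeneousIso [FiniteDimensional ℂ g] (hL : L.IsSolvable) {V : Type*}
    [AddCommGroup V] [Module ℂ V] [FiniteDimensional ℂ V] {R : RelRep L (L.part 1) V}
    (hR : R.IsGood lam) : h.twistedInd.HomogeneousIso R.toModule := by
  obtain ⟨v, hv0, i, hi, hv⟩ := h.exists_act_eq hR
  obtain ⟨_, hd⟩ := h.twistedInd_finrank_le hL
  have hN := h.character_parity 1
  have hs := indLift_surjective hN (isGood_isIrreducible hR) hv0 hi hv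
  rw [← hR.finrank_eq _ h.isPolarizing] at hd
  have heq := le_antisymm (Nat.le_of_mul_le_mul_right hd (by positivity))
    (LinearMap.finrank_le_finrank_of_surjective hs)
  refine ⟨i, LinearEquiv.ofBijective (indLift hv)
    ⟨(LinearMap.injective_iff_surjective_of_finrank_eq_finrank heq).2 hs, hs⟩,
    indLift_parity hN hi hv, indLift_act hv⟩

theorem homogeneousIso_twistedCoind [FiniteDimensional ℂ g] (hL : L.IsSolvable) {V : Type*}
    [AddCommGroup V] [Module ℂ V] [FiniteDimensional ℂ V] {R : RelRep L (L.part 1) V}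
    (hR : R.IsGood lam) : R.toModule.HomogeneousIso h.twistedCoind := by
  obtain ⟨f, hf0, i, hi, hf⟩ := h.exists_covector_act_eq hR
  obtain ⟨_, hd⟩ := h.twistedCoind_finrank_le hL
  have hN := h.character_parity (-1)
  have hs := coindLift_injective hN (isGood_isIrreducible hR) hf0 hi hf
  rw [← hR.finrank_eq _ h.isPolarizing] at hd
  have heq := le_antisymm (LinearMap.finrank_le_finrank_of_injective hs)
    (Nat.le_of_mul_le_mul_right hd (by positivity))
  refine ⟨i, LinearEquiv.ofBijective (coindLift hf)
    ⟨hs, (LinearMap.injective_iff_surjective_of_finrank_eq_finrank heq).1 hs⟩,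
    coindLift_parity hN hi hf, coindLift_act hf⟩

end Polarization

end LieSuperalgebra

end SolvSuper

end

theorem mainTheorem2 {g : Type*} [AddCommGroup g] [Module ℂ g] [FiniteDimensional ℂ g]
    (L : SolvSuper.LieSuperalgebra g) (hL : L.IsSolvable) (lam : L.evenCharacters) :
    (∀ h : L.Polarization lam,
      FiniteDimensional ℂ (SolvSuper.LieSupermodule.IndSpace h.toSub (h.character 1)) ∧
        h.twistedInd.IsIrreducible) ∧
    (∀ h t : L.Polarization lam, h.twistedInd.IsoUpToParity t.twistedInd) ∧
    (∀ h t : L.Polarization lam, h.twistedCoind.IsoUpToParity t.twistedInd) := by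
  -- The model depends on `lam` only, so it serves all polarizations at once.
  obtain ⟨V, _, _, _, R, hR⟩ := SolvSuper.LieSuperalgebra.exists_isGood hL lam _
    SolvSuper.LieSuperalgebra.isStableOdd_part_one
  refine ⟨fun h => ⟨(h.twistedInd_finrank_le hL).1, ?_⟩, fun h t => ?_, fun h t => ?_⟩
  · exact (h.twistedInd_homogeneousIso hL hR).isIrreducible
      (SolvSuper.LieSuperalgebra.Polarization.isGood_isIrreducible hR)
  · exact ((h.twistedInd_homogeneousIso hL hR).trans
      (t.twistedInd_homogeneousIso hL hR).symm).isoUpToParity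
  · exact ((h.homogeneousIso_twistedCoind hL hR).symm.trans
      (t.twistedInd_homogeneousIso hL hR).symm).isoUpToParity
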